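/- **Theorem 7.** *Setting.* Let $x_c>0$ and let $G,\psi$ be real functions that are analytic on $(-\infty,x_c]$, the metric functions of the self-similar spherically symmetric space-time $ds^2=-2Ge^{\psi}dv^2+2e^{\psi}dv\,dr+r^2d\Omega^2$, $G=G(x)$, $\psi=\psi(x)$, $x=v/r$, and suppose that: $x\psi'\le 0$ and $G'-\psi'(1-xG)G\le 0$ on $(-\infty,x_c]$ (null energy condition); $G>0$ for $x<0$ (no trapped spheres inside the past null cone of the scaling origin); $x_c$ is the smallest positive root of $xG(x)=1$ (so $x=x_c$ is the Cauchy horizon of a naked singularity); $1+x_c^2G'(x_c)>0$; and $G'(x_c)<0$. Let $\rho=\ln r$, $\ell\in\{0,1,2,\dots\}$, $x_i\in(0,x_c)$, $0\le\kappa\le\frac12\bigl(1-x_c^2G'(x_c)\bigr)$, and $$\alpha=-2x(1-xG),\qquad \beta=1-2xG,\qquad \gamma=2G .$$ For a multipole $\phi(x,\rho)$ of order $\ell$ of a massless minimally coupled scalar field, $\tilde\phi=e^{\kappa\rho}\phi$ satisfies $$\alpha\tilde\phi_{,xx}+2\beta\tilde\phi_{,x\rho}+\gamma\tilde\phi_{,\rho\rho}+(\alpha'+2(1-\kappa)\beta)\tilde\phi_{,x}+(\beta'+2(1-\kappa)\gamma)\tilde\phi_{,\rho}+\bigl[(\kappa^2-2\kappa)\gamma-\kappa\beta'-\ell(\ell+1)e^{\psi}\bigr]\tilde\phi=0.\tag{W}$$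 Let $H^{m,2}(\mathbb R)$ be the space of real functions of $\rho$ with weak derivatives up to order $m$ in $L^2(\mathbb R)$. A curve $\tilde\phi\in C([x_i,x_c],H^{3,2}(\mathbb R))$ is called a solution of the initial value problem with data $\tilde\phi|_{x=x_i}=f$, $\tilde\phi_{,x}|_{x=x_i}=g$ if (W) holds, with these data, in the sense of $L^2(\mathbb R)$-valued distributions in $x\in[x_i,x_c)$. *(a)* For all $f\in H^{3,2}(\mathbb R)$ and $g\in H^{2,2}(\mathbb R)$ the initial value problem has a unique solution $\tilde\phi\in C([x_i,x_c],H^{3,2}(\mathbb R))$. The solution is (represented by) a $C^2$ function on $[x_i,x_c)\times\mathbb R$ that satisfies (W) pointwise and takes the initial data. *(b)* If moreover $\kappa<-x_c^2G'(x_c)$, then there are positive constants $C_0,C_1,C_2$, independent of $f$ and $g$ (they depend only on $G,\psi,\ell,\kappa,x_i$), such that for each of these solutions and all $\rho\in\mathbb R$ the limit $\lim_{x\to x_c^-}\tilde\phi_{,x}(x,\rho)$ exists in $\mathbb R$ and $$\Bigl(\lim_{x\to x_c^-}\bigl|\tilde\phi_{,x}(x,\rho)\bigr|\Bigr)^2\le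 C_0\,\hat E[\vec\varphi](0)+C_1\,\hat E[\vec\varphi_{,\rho}](0)+C_2\,\hat E[\vec\varphi_{,\rho\rho}](0),$$ where $\vec\varphi=(\tilde\phi,\ \alpha\tilde\phi_{,x}+\beta\tilde\phi_{,\rho},\ \tilde\phi_{,\rho})$ and $\hat E[\cdot](0)=\int_{\mathbb R}\|\cdot\|^2\,d\rho$ is evaluated at $x=x_i$, that is, with $\tilde\phi=f$, $\tilde\phi_{,x}=g$. *(c)* Under the hypotheses of (b), the local energy is finite at the Cauchy horizon, without any condition on $\phi=e^{-\kappa\rho}\tilde\phi$ at the centre $\rho\to-\infty$: along every time-like geodesic, with unit tangent $u^a$, that runs in $x_i<x<x_c$ and tends to a point $(x_c,\rho_0)$, $\rho_0\in\mathbb R$, of the Cauchy horizon as proper time tends to a finite value, the flux $\mathcal F=u^a\partial_a\phi$ and the energy $\mathcal E=(u^c\partial_c\phi)^2+\frac12g^{cd}\partial_c\phi\,\partial_d\phi$ of the multipole field $\phi(x,\rho)$ have finite limits. -/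

import Mathlib

open MeasureTheory Set Filter Topology
open scoped ContDiff

noncomputable section

/-! ### Real Sobolev spaces `H^{m,2}(ℝ)` -/

/-- Real-valued square integrable functions on the line (Lebesgue measure). -/
abbrev RealL2 : Type := Lp ℝ 2 (volume : Measure ℝ)

/-- `v` is the weak derivative of `u`. -/
def IsWeakDeriv (u v : RealL2) : Prop :=
  ∀ η : ℝ → ℝ, ContDiff ℝ ∞ η → HasCompactSupport η →
    ∫ s, u s * deriv η s = - ∫ s, v s * η s

lemma RealL2.integrable_mul_test (u : RealL2) {θ : ℝ → ℝ} (hθ : Continuous θ)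
    (hc : HasCompactSupport θ) : Integrable (fun s => u s * θ s) :=
  MemLp.integrable_mul (p := 2) (q := 2) (Lp.memLp u) (hθ.memLp_of_hasCompactSupport hc)

lemma IsWeakDeriv.zero : IsWeakDeriv 0 0 := by
  intro η _ _
  have h : ∀ θ : ℝ → ℝ, ∫ s, (0 : RealL2) s * θ s = 0 := by
    intro θ
    rw [← integral_zero ℝ ℝ (μ := volume)]
    refine integral_congr_ae ?_
    filter_upwards [Lp.coeFn_zero ℝ 2 (volume : Measure ℝ)] with s hs
    rw [hs]; simp
  rw [h, h, neg_zero]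

lemma IsWeakDeriv.add {u v u' v' : RealL2} (h : IsWeakDeriv u v) (h' : IsWeakDeriv u' v') :
    IsWeakDeriv (u + u') (v + v') := by
  intro η hη hc
  have key : ∀ (a b : RealL2) {θ : ℝ → ℝ}, Continuous θ → HasCompactSupport θ →
      ∫ s, (a + b : RealL2) s * θ s = (∫ s, a s * θ s) + ∫ s, b s * θ s := by
    intro a b θ hθ hcθ
    rw [← integral_add (a.integrable_mul_test hθ hcθ) (b.integrable_mul_test hθ hcθ)]
    refine integral_congr_ae ?_
    filter_upwards [Lp.coeFn_add a b] with s hs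
    rw [hs]; simp [add_mul]
  rw [key _ _ (hη.continuous_deriv (by simp)) hc.deriv, key _ _ hη.continuous hc,
    h η hη hc, h' η hη hc]
  ring

lemma IsWeakDeriv.smul {u v : RealL2} (c : ℝ) (h : IsWeakDeriv u v) :
    IsWeakDeriv (c • u) (c • v) := by
  intro η hη hc
  have key : ∀ (a : RealL2) (θ : ℝ → ℝ),
      ∫ s, (c • a : RealL2) s * θ s = c * ∫ s, a s * θ s := by
    intro a θ
    rw [← integral_const_mul]
    refine integral_congr_ae ?_
    filter_upwards [Lp.coeFn_smul c a] with s hs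
    rw [hs]; simp [mul_assoc]
  rw [key, key, h η hη hc]
  ring

/-- The Sobolev space `H^{m,2}(ℝ)`. A function `u` is stored together with its weak derivatives
`(u, u', …, u^(m))`, all in `L²`; these are determined by `u`. The norm inherited from the
`ℓ²`-product is `‖u‖² = ∑ j ≤ m, ‖u^(j)‖²`. -/
def SobolevSpace (m : ℕ) : Submodule ℝ (PiLp 2 (fun _ : Fin (m + 1) => RealL2)) where
  carrier := {u | ∀ i : Fin m, IsWeakDeriv (u i.castSucc) (u i.succ)}
  add_mem' hu hv i := (hu i).add (hv i)
  zero_mem' _ := IsWeakDeriv.zero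
  smul_mem' c _ hu i := (hu i).smul c

/-- The `j`-th weak derivative of `u ∈ H^{m,2}(ℝ)`, for `j ≤ m` (`j = 0` is `u` itself). -/
def weakD {m : ℕ} (u : SobolevSpace m) (j : Fin (m + 1)) : RealL2 := u.1 j

/-! ### The background space-time -/

/-- The metric functions `G`, `ψ` of a self-similar spherically symmetric space-time
`ds² = -2 G e^ψ dv² + 2 e^ψ dv dr + r² dΩ²`, `G = G(x)`, `ψ = ψ(x)`, `x = v / r`, which has
a naked singularity with Cauchy horizon `x = xc`. -/
structure IsBackground (G ψ : ℝ → ℝ) (xc : ℝ) : Prop where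
  analytic_G : AnalyticOnNhd ℝ G (Iic xc)
  analytic_psi : AnalyticOnNhd ℝ ψ (Iic xc)
  null_energy_one : ∀ x ≤ xc, x * deriv ψ x ≤ 0
  null_energy_two : ∀ x ≤ xc, deriv G x - deriv ψ x * (1 - x * G x) * G x ≤ 0
  /-- no trapped spheres inside the past null cone of the scaling origin -/
  no_trapped : ∀ x < 0, 0 < G x
  horizon_pos : 0 < xc
  horizon_root : xc * G xc = 1
  horizon_first : ∀ x, 0 < x → x < xc → x * G x ≠ 1
  horizon_slope : 0 < 1 + xc ^ 2 * deriv G xc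
  horizon_flux : deriv G xc < 0

/-! ### The wave equation for the rescaled multipole -/

/-- `α = -2 x (1 - x G)` -/
def coeffA (G : ℝ → ℝ) (x : ℝ) : ℝ := -2 * x * (1 - x * G x)

/-- `β = 1 - 2 x G` -/
def coeffB (G : ℝ → ℝ) (x : ℝ) : ℝ := 1 - 2 * x * G x

/-- `γ = 2 G` -/
def coeffC (G : ℝ → ℝ) (x : ℝ) : ℝ := 2 * G x

/-- coefficient `α' + 2 (1 - κ) β` of `φ̃_x` -/
def coeffX (G : ℝ → ℝ) (κ x : ℝ) : ℝ := deriv (coeffA G) x + 2 * (1 - κ) * coeffB G x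

/-- coefficient `β' + 2 (1 - κ) γ` of `φ̃_ρ` -/
def coeffR (G : ℝ → ℝ) (κ x : ℝ) : ℝ := deriv (coeffB G) x + 2 * (1 - κ) * coeffC G x

/-- coefficient `(κ² - 2 κ) γ - κ β' - ℓ (ℓ + 1) e^ψ` of `φ̃` -/
def coeffZ (G ψ : ℝ → ℝ) (ℓ : ℕ) (κ x : ℝ) : ℝ :=
  (κ ^ 2 - 2 * κ) * coeffC G x - κ * deriv (coeffB G) x
    - (ℓ : ℝ) * ((ℓ : ℝ) + 1) * Real.exp (ψ x)

/-- The left-hand side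
`α φ̃_xx + 2 β φ̃_xρ + γ φ̃_ρρ + (α' + 2(1-κ)β) φ̃_x + (β' + 2(1-κ)γ) φ̃_ρ
  + [(κ² - 2κ)γ - κβ' - ℓ(ℓ+1)e^ψ] φ̃` of the wave equation, at the point `(x, ρ)`. -/
def waveOp (G ψ : ℝ → ℝ) (ℓ : ℕ) (κ : ℝ) (φ : ℝ → ℝ → ℝ) (x ρ : ℝ) : ℝ :=
  coeffA G x * iteratedDeriv 2 (fun s => φ s ρ) x
    + 2 * coeffB G x * deriv (fun s => deriv (φ s) ρ) x
    + coeffC G x * iteratedDeriv 2 (φ x) ρ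
    + coeffX G κ x * deriv (fun s => φ s ρ) x
    + coeffR G κ x * deriv (φ x) ρ
    + coeffZ G ψ ℓ κ x * φ x ρ

/-- A curve `Φ ∈ C([xi, xc], H^{3,2}(ℝ))` solves the initial value problem with data
`φ̃ = f`, `φ̃_x = g` at `x = xi`: the wave equation holds in the sense of `L²(ℝ)`-valued
distributions in `x ∈ [xi, xc)`. The terms without `Φ` on the right are the boundary terms at
`xi` that arise when all `x`-derivatives are moved to the test function `χ`. -/
def IsSolution (G ψ : ℝ → ℝ) (ℓ : ℕ) (κ : ℝ) {xi xc : ℝ} (h : xi ≤ xc)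
    (Φ : C(Icc xi xc, SobolevSpace 3)) (f : SobolevSpace 3) (g : SobolevSpace 2) : Prop :=
  ∀ χ : ℝ → ℝ, ContDiff ℝ ∞ χ → HasCompactSupport χ → tsupport χ ⊆ Iio xc →
    (∫ x in xi..xc,
      (iteratedDeriv 2 (fun s => coeffA G s * χ s) x • weakD (IccExtend h Φ x) 0
        - (2 * deriv (fun s => coeffB G s * χ s) x) • weakD (IccExtend h Φ x) 1
        + (coeffC G x * χ x) • weakD (IccExtend h Φ x) 2
        - deriv (fun s => coeffX G κ s * χ s) x • weakD (IccExtend h Φ x) 0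
        + (coeffR G κ x * χ x) • weakD (IccExtend h Φ x) 1
        + (coeffZ G ψ ℓ κ x * χ x) • weakD (IccExtend h Φ x) 0 : RealL2))
    = (coeffA G xi * χ xi) • weakD g 0
        - deriv (fun s => coeffA G s * χ s) xi • weakD f 0
        + (2 * coeffB G xi * χ xi) • weakD f 1
        + (coeffX G κ xi * χ xi) • weakD f 0

/-- `φ` is a `C²` function on `[xi, xc) × ℝ` that represents the curve `Φ`, satisfies the wave
equation pointwise, and takes the initial data `φ̃ = f`, `φ̃_x = g` at `x = xi`. -/
structure IsClassicalVersion (G ψ : ℝ → ℝ) (ℓ : ℕ) (κ : ℝ) {xi xc : ℝ}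
    (Φ : C(Icc xi xc, SobolevSpace 3)) (f : SobolevSpace 3) (g : SobolevSpace 2)
    (φ : ℝ → ℝ → ℝ) : Prop where
  represents : ∀ x : Icc xi xc, φ x =ᵐ[volume] weakD (Φ x) 0
  smooth : ContDiffOn ℝ 2 (fun p : ℝ × ℝ => φ p.1 p.2) (Ico xi xc ×ˢ univ)
  wave_eq : ∀ x ∈ Ioo xi xc, ∀ ρ, waveOp G ψ ℓ κ φ x ρ = 0
  initial : φ xi =ᵐ[volume] weakD f 0
  initial_deriv : ∀ᵐ ρ : ℝ, HasDerivWithinAt (fun x => φ x ρ) (weakD g 0 ρ) (Ici xi) xi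

/-- With `w = (φ̃, α φ̃_x + β φ̃_ρ, φ̃_ρ)`, the initial energy `∫ ‖∂_ρ^j w‖² dρ` at `x = xi`,
in terms of the data `φ̃ = f`, `φ̃_x = g`; here `j = 0, 1, 2`. -/
def initialEnergy (G : ℝ → ℝ) (xi : ℝ) (f : SobolevSpace 3) (g : SobolevSpace 2)
    (j : Fin 3) : ℝ :=
  ∫ ρ : ℝ, ((weakD f j.castSucc ρ) ^ 2
    + (coeffA G xi * weakD g j ρ + coeffB G xi * weakD f j.succ ρ) ^ 2
    + (weakD f j.succ ρ) ^ 2)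

/-! ### Observers and local energy -/

/-- The Lagrangian `½ g(u, u)` in the equatorial plane, in the coordinates `(x, ρ, ϑ)`,
`x = v / r`, `ρ = ln r`, where
`ds² = e^{2ρ} (-2 G e^ψ dx² + 2 e^ψ (1 - 2xG) dx dρ + 2 x e^ψ (1 - xG) dρ² + dϑ²)`. -/
def lagrangian (G ψ : ℝ → ℝ) (x ρ ux ur ut : ℝ) : ℝ :=
  1 / 2 * Real.exp (2 * ρ) *
    (-2 * G x * Real.exp (ψ x) * ux ^ 2
      + 2 * Real.exp (ψ x) * (1 - 2 * x * G x) * ux * ur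
      + 2 * x * Real.exp (ψ x) * (1 - x * G x) * ur ^ 2
      + ut ^ 2)

/-- `τ ↦ (x, ρ, ϑ)`, `a < τ < b`, is a time-like geodesic parametrised by proper time, with unit
tangent `(ux, ur, ut)`: the Euler-Lagrange equations of `½ g(u, u)` and `g(u, u) = -1`. By
spherical symmetry every geodesic lies in the equatorial plane of suitable angular coordinates. -/
structure IsTimelikeGeodesic (G ψ : ℝ → ℝ) (a b : ℝ) (x ρ ϑ ux ur ut : ℝ → ℝ) : Prop where
  tangent_x : ∀ τ ∈ Ioo a b, HasDerivAt x (ux τ) τ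
  tangent_rho : ∀ τ ∈ Ioo a b, HasDerivAt ρ (ur τ) τ
  tangent_theta : ∀ τ ∈ Ioo a b, HasDerivAt ϑ (ut τ) τ
  unit : ∀ τ ∈ Ioo a b, 2 * lagrangian G ψ (x τ) (ρ τ) (ux τ) (ur τ) (ut τ) = -1
  euler_x : ∀ τ ∈ Ioo a b,
    HasDerivAt (fun σ => deriv (fun w => lagrangian G ψ (x σ) (ρ σ) w (ur σ) (ut σ)) (ux σ))
      (deriv (fun s => lagrangian G ψ s (ρ τ) (ux τ) (ur τ) (ut τ)) (x τ)) τ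
  euler_rho : ∀ τ ∈ Ioo a b,
    HasDerivAt (fun σ => deriv (fun w => lagrangian G ψ (x σ) (ρ σ) (ux σ) w (ut σ)) (ur σ))
      (deriv (fun s => lagrangian G ψ (x τ) s (ux τ) (ur τ) (ut τ)) (ρ τ)) τ
  euler_theta : ∀ τ ∈ Ioo a b,
    HasDerivAt (fun σ => deriv (fun w => lagrangian G ψ (x σ) (ρ σ) (ux σ) (ur σ) w) (ut σ))
      0 τ

/-- The multipole `φ = e^{-κρ} φ̃` of the scalar field. -/
def multipole (κ : ℝ) (φt : ℝ → ℝ → ℝ) (x ρ : ℝ) : ℝ := Real.exp (-κ * ρ) * φt x ρ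

/-- The flux `u^a ∂_a φ` of the multipole field `φ(x, ρ)`. -/
def fieldFlux (φ : ℝ → ℝ → ℝ) (x ρ ux ur : ℝ) : ℝ :=
  ux * deriv (fun s => φ s ρ) x + ur * deriv (φ x) ρ

/-- `g^{cd} ∂_c φ ∂_d φ`; the inverse of the `(x, ρ)`-part of the metric is
`e^{-2ρ-ψ} (α, β; β, γ)`. -/
def gradSq (G ψ : ℝ → ℝ) (φ : ℝ → ℝ → ℝ) (x ρ : ℝ) : ℝ :=
  Real.exp (-2 * ρ - ψ x) *
    (coeffA G x * deriv (fun s => φ s ρ) x ^ 2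
      + 2 * coeffB G x * deriv (fun s => φ s ρ) x * deriv (φ x) ρ
      + coeffC G x * deriv (φ x) ρ ^ 2)

/-- The energy `u^a u^b T_ab = (u^c ∂_c φ)² + ½ g^{cd} ∂_c φ ∂_d φ` of the multipole field. -/
def fieldEnergy (G ψ : ℝ → ℝ) (φ : ℝ → ℝ → ℝ) (x ρ ux ur : ℝ) : ℝ :=
  fieldFlux φ x ρ ux ur ^ 2 + 1 / 2 * gradSq G ψ φ x ρ

end

open MeasureTheory Set Filter Topology
open scoped ContDiff

noncomputable section

/-! Since `αγ = β² - 1`, the wave operator factors along two families of characteristics. With `A =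
∂_ρ + 1 - κ`, `P = α φ̃_x + (β + 1) A φ̃` and `Q = α φ̃_x + (β - 1) A φ̃`, equation (W) becomes the
system `P_x = -τ' A P + W φ̃`, `Q_x = x⁻¹ A Q + W φ̃`, `φ̃_x = -½ (τ' P + x⁻¹ Q)` with `τ' = G / (1
- xG)` and `W = ℓ(ℓ+1) e^ψ - 2xG'` (`CharSystem`, `IsBackground.charSystem`). The operator `∂_ρ`
generates the translations, which are isometries of every Sobolev space, so Duhamel's formula solves
the two transport equations. The only singular coefficient is `τ'`; it is positive by the null
energy condition (`IsBackground.G_pos`), and `τ → ∞` at the horizon.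

Part (a). The field `P` is damped at the rate `c = 1 - κ > 0` in the fast variable `τ`. Integrating
`p' = -c τ' p + m` bounds `∫ τ' ‖P‖` by the data and by `∫ ‖W φ̃‖`, so `φ̃_x` is integrable up to
`xc` (`CharSystem.integral_norm_velocity_le`), and a contraction in an exponentially weighted norm
gives a solution on all of `[xi, xc]` (`CharSystem.exists_field`). The system is solved in `H²`. The
constraint `P - Q = 2 A φ̃` propagates (`CharSystem.constraint`) and exhibits `∂_ρ φ̃` as an element
of `H²`, hence `φ̃ ∈ H³`; as `P → 0` at the horizon (`CharSystem.tendsto_ingoing`), this holds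
continuously up to `xc`. Conversely, a distributional solution satisfies the system in `L²`
(`IsSolution.field_eq`), where solutions are unique (`CharSystem.field_unique`). Point evaluation on
`H¹` (`evalL`) makes the solution classical.

Part (b). The quotient `p = P / (1 - xG)` obeys `p_x = τ' (-(∂ + δ) p + (W/G) φ̃)`, where `δ → d =
-κ - xc² G'(xc)`. If `d > 0`, then `p` relaxes in the time `τ` to the equilibrium `(d + ∂)⁻¹ ((W/G)
φ̃)` at `xc` (`tendsto_inField_div`). So `φ̃_x` converges in `H²`, with a bound by the `H²` norms of
the data, whose squares are the three energies.

Part (c). The momentum conjugate to `ρ` changes at a constant rate because translation in `ρ` is a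
homothety. With the angular momentum and the normalisation, it determines the tangent of the
geodesic, which has a limit because the momentum is negative at the horizon
(`IsTimelikeGeodesic.exists_tendsto_tangent`). Flux and energy are then continuous expressions in
convergent quantities. -/

/-! ### Strongly continuous groups of isometries -/

/-- A strongly continuous one-parameter group of linear isometries. -/
structure IsometryGroup (X : Type*) [NormedAddCommGroup X] [NormedSpace ℝ X] where
  act : ℝ → X →L[ℝ] X
  act_zero : ∀ u, act 0 u = u
  act_add : ∀ s t u, act (s + t) u = act s (act t u)
  norm_act : ∀ s u, ‖act s u‖ = ‖u‖
  continuous_act : Continuous fun p : ℝ × X => act p.1 p.2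

namespace IsometryGroup

variable {X : Type*} [NormedAddCommGroup X] [NormedSpace ℝ X] (T : IsometryGroup X) (c : ℝ)

/-- The rescaled group `exp (c s) T(s)`. -/
def wact (s : ℝ) : X →L[ℝ] X := Real.exp (c * s) • T.act s

lemma wact_apply (s : ℝ) (u : X) : T.wact c s u = Real.exp (c * s) • T.act s u := rfl

lemma wact_zero (u : X) : T.wact c 0 u = u := by
  simp [wact_apply, T.act_zero]

lemma wact_add (s t : ℝ) (u : X) : T.wact c (s + t) u = T.wact c s (T.wact c t u) := by
  simp only [wact_apply, T.act_add, map_smul, smul_smul, mul_add, Real.exp_add, mul_comm]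

lemma wact_neg_cancel (s : ℝ) (u : X) : T.wact c (-s) (T.wact c s u) = u := by
  rw [← wact_add, neg_add_cancel, wact_zero]

lemma wact_cancel_neg (s : ℝ) (u : X) : T.wact c s (T.wact c (-s) u) = u := by
  rw [← wact_add, add_neg_cancel, wact_zero]

lemma norm_wact (s : ℝ) (u : X) : ‖T.wact c s u‖ = Real.exp (c * s) * ‖u‖ := by
  rw [wact_apply, norm_smul, T.norm_act, Real.norm_eq_abs, abs_of_pos (Real.exp_pos _)]

lemma continuous_wact : Continuous fun p : ℝ × X => T.wact c p.1 p.2 :=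
  (Real.continuous_exp.comp (continuous_const.mul continuous_fst)).smul T.continuous_act

lemma _root_.ContinuousOn.wact {T : IsometryGroup X} {c : ℝ} {Y : Type*} [TopologicalSpace Y]
    {s : Set Y} {f : Y → ℝ} {u : Y → X} (hf : ContinuousOn f s) (hu : ContinuousOn u s) :
    ContinuousOn (fun y => T.wact c (f y) (u y)) s :=
  (T.continuous_wact c).comp_continuousOn (hf.prodMk hu)

lemma _root_.Filter.Tendsto.act {T : IsometryGroup X} {Y : Type*} {l : Filter Y}
    {f : Y → ℝ} {u : Y → X} {s₀ : ℝ} {u₀ : X} (hf : Tendsto f l (𝓝 s₀)) (hu : Tendsto u l (𝓝 u₀)) :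
    Tendsto (fun y => T.act (f y) (u y)) l (𝓝 (T.act s₀ u₀)) :=
  (T.continuous_act.tendsto (s₀, u₀)).comp (hf.prodMk_nhds hu)

lemma _root_.Filter.Tendsto.wact {T : IsometryGroup X} {c : ℝ} {Y : Type*} {l : Filter Y}
    {f : Y → ℝ} {u : Y → X} {s₀ : ℝ} {u₀ : X} (hf : Tendsto f l (𝓝 s₀)) (hu : Tendsto u l (𝓝 u₀)) :
    Tendsto (fun y => T.wact c (f y) (u y)) l (𝓝 (T.wact c s₀ u₀)) :=
  Tendsto.smul ((Real.continuous_exp.tendsto _).comp (hf.const_mul c)) (hf.act hu)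

end IsometryGroup

/-- A primitive of a function that is continuous on an open interval. -/
lemma hasDerivAt_primitive {X : Type*} [NormedAddCommGroup X] [NormedSpace ℝ X] [CompleteSpace X]
    {g : ℝ → X} {o a b x : ℝ} (hg : ContinuousOn g (Ioo o b)) (ha : a ∈ Ioo o b)
    (hx : x ∈ Ioo o b) : HasDerivAt (fun z => ∫ y in a..z, g y) (g x) x := by
  have hsub : uIcc a x ⊆ Ioo o b := (convex_Ioo o b).ordConnected.uIcc_subset ha hx
  refine intervalIntegral.integral_hasDerivAt_right ((hg.mono hsub).intervalIntegrable) ?_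
    (hg.continuousAt (Ioo_mem_nhds hx.1 hx.2))
  exact hg.stronglyMeasurableAtFilter isOpen_Ioo x hx

/-! ### Transport systems -/

/-- The coefficients of the characteristic system
`P_x = -τ' A P + W φ`, `Q_x = x⁻¹ A Q + W φ`, `φ_x = -½ (τ' P + x⁻¹ Q)`, `A = ∂ + c`. -/
structure CharSystem where
  a : ℝ
  b : ℝ
  c : ℝ
  τ : ℝ → ℝ
  dτ : ℝ → ℝ
  W : ℝ → ℝ
  a_pos : 0 < a
  a_lt_b : a < b
  c_pos : 0 < c
  hasDerivAt_τ : ∀ x ∈ Ioo 0 b, HasDerivAt τ (dτ x) x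
  continuousOn_dτ : ContinuousOn dτ (Ioo 0 b)
  dτ_nonneg : ∀ x ∈ Ico a b, 0 ≤ dτ x
  τ_a : τ a = 0
  -- `W` is continuous up to `b`, `τ'` only before `b`: the singularity of the system at the horizon
  -- is confined to `τ'`.
  continuousOn_W : ContinuousOn W (Ioc 0 b)

namespace CharSystem

variable {X : Type*} [NormedAddCommGroup X] [NormedSpace ℝ X] (D : CharSystem)
  (T : IsometryGroup X)

/-- `log (x / a)`, the parameter along the second family of characteristics. -/
def lam (x : ℝ) : ℝ := Real.log (x / D.a)

/-- With the integrating factor `exp (c τ) T(τ)` the ingoing equation says that the derivative of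
`T.wact c τ P` is the transported source. This is the primitive of that source; `ingoing` removes
the factor again. -/
def inSource (φ : ℝ → X) (x : ℝ) : X := ∫ y in D.a..x, T.wact D.c (D.τ y) (D.W y • φ y)

def ingoing (P₀ : X) (φ : ℝ → X) (x : ℝ) : X := T.wact D.c (-D.τ x) (P₀ + D.inSource T φ x)

/-- The outgoing field is transported in the opposite direction, with parameter `log (x / a)`. It is
amplified instead of damped, but only by a power of `x / a`, which stays bounded up to `b`. -/
def outSource (φ : ℝ → X) (x : ℝ) : X := ∫ y in D.a..x, T.wact D.c (-D.lam y) (D.W y • φ y)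

def outgoing (Q₀ : X) (φ : ℝ → X) (x : ℝ) : X :=
  T.wact D.c (D.lam x) (Q₀ + D.outSource T φ x)

/-- The velocity `φ_x = -½ (τ' P + x⁻¹ Q)`. -/
def velocity (P₀ Q₀ : X) (φ : ℝ → X) (x : ℝ) : X :=
  (-(1 / 2) : ℝ) • (D.dτ x • D.ingoing T P₀ φ x + x⁻¹ • D.outgoing T Q₀ φ x)

/-- A solution of the system is a fixed point of this map. -/
def field (P₀ Q₀ f : X) (φ : ℝ → X) (x : ℝ) : X := f + ∫ y in D.a..x, D.velocity T P₀ Q₀ φ y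

variable {D}

lemma a_mem : D.a ∈ Ioo 0 D.b := ⟨D.a_pos, D.a_lt_b⟩

lemma lam_a : D.lam D.a = 0 := by simp [lam, D.a_pos.ne']

lemma hasDerivAt_lam {x : ℝ} (hx : 0 < x) : HasDerivAt D.lam x⁻¹ x := by
  have h := ((hasDerivAt_id x).div_const D.a).log (div_pos hx D.a_pos).ne'
  refine h.congr_deriv ?_
  have := D.a_pos.ne'
  simp only [id]
  field_simp

lemma continuousOn_lam : ContinuousOn D.lam (Ioi 0) := fun _ hx =>
  (hasDerivAt_lam hx).continuousAt.continuousWithinAt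

lemma continuousOn_τ : ContinuousOn D.τ (Ioo 0 D.b) := fun x hx =>
  (D.hasDerivAt_τ x hx).continuousAt.continuousWithinAt

lemma lam_nonneg {x : ℝ} (hx : D.a ≤ x) : 0 ≤ D.lam x :=
  Real.log_nonneg ((one_le_div D.a_pos).2 hx)

lemma Icc_subset : Icc D.a D.b ⊆ Ioc 0 D.b := fun _ hx => ⟨D.a_pos.trans_le hx.1, hx.2⟩

variable {T} {P₀ Q₀ f : X} {φ : ℝ → X} (hφ : Continuous φ)

include hφ

lemma continuousOn_inIntegrand :
    ContinuousOn (fun y => T.wact D.c (D.τ y) (D.W y • φ y)) (Ioo 0 D.b) :=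
  continuousOn_τ.wact ((D.continuousOn_W.mono Ioo_subset_Ioc_self).smul hφ.continuousOn)

lemma continuousOn_outIntegrand :
    ContinuousOn (fun y => T.wact D.c (-D.lam y) (D.W y • φ y)) (Ioc 0 D.b) :=
  (continuousOn_lam.mono Ioc_subset_Ioi_self).neg.wact (D.continuousOn_W.smul hφ.continuousOn)

/-- The endpoint `b` is included, so differentiability of the primitive is not at hand. Basing the
primitive at `x / 2` puts `x` in a compact interval `[x / 2, b]` on which the integrand is
integrable; the change of base point adds a constant. -/
lemma continuousOn_outgoing : ContinuousOn (D.outgoing T Q₀ φ) (Ioc 0 D.b) := by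
  refine (continuousOn_lam.mono Ioc_subset_Ioi_self).wact (continuousOn_const.add ?_)
  intro x hx
  have hI : IntegrableOn (fun y => T.wact D.c (-D.lam y) (D.W y • φ y)) (uIcc (x / 2) D.b) := by
    refine ((continuousOn_outIntegrand hφ).mono ?_).integrableOn_compact isCompact_uIcc
    rw [uIcc_of_le (by linarith [hx.1, hx.2])]
    exact fun y hy => ⟨by linarith [hy.1, hx.1], hy.2⟩
  have h1 := intervalIntegral.continuousOn_primitive_interval hI
  have h2 : ContinuousWithinAt
      (fun z => ∫ y in x / 2..z, T.wact D.c (-D.lam y) (D.W y • φ y)) (Ioc 0 D.b) x := by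
    refine (h1 x ?_).mono_of_mem_nhdsWithin ?_
    · rw [uIcc_of_le (by linarith [hx.1, hx.2])]
      exact ⟨by linarith [hx.1], hx.2⟩
    · rw [uIcc_of_le (by linarith [hx.1, hx.2])]
      filter_upwards [self_mem_nhdsWithin,
        mem_nhdsWithin_of_mem_nhds (lt_mem_nhds (half_lt_self hx.1))] with z hz hz'
      exact ⟨le_of_lt hz', hz.2⟩
  have hii : ∀ z ∈ Ioc 0 D.b, ∀ w ∈ Ioc 0 D.b, IntervalIntegrable
      (fun y => T.wact D.c (-D.lam y) (D.W y • φ y)) volume z w := fun z hz w hw =>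
    ((continuousOn_outIntegrand hφ).mono
      ((ordConnected_Ioc).uIcc_subset hz hw)).intervalIntegrable
  refine ((continuousWithinAt_const (b := ∫ y in D.a..x / 2, T.wact D.c (-D.lam y)
    (D.W y • φ y))).add h2).congr_of_mem ?_ hx
  intro z hz
  have ha : D.a ∈ Ioc 0 D.b := ⟨D.a_pos, D.a_lt_b.le⟩
  have hx2 : x / 2 ∈ Ioc 0 D.b := ⟨by linarith [hx.1], by linarith [hx.1, hx.2]⟩
  exact (intervalIntegral.integral_add_adjacent_intervals (hii _ ha _ hx2) (hii _ hx2 _ hz)).symm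

variable [CompleteSpace X]

lemma hasDerivAt_inSource {x : ℝ} (hx : x ∈ Ioo 0 D.b) :
    HasDerivAt (D.inSource T φ) (T.wact D.c (D.τ x) (D.W x • φ x)) x :=
  hasDerivAt_primitive (continuousOn_inIntegrand hφ) a_mem hx

lemma hasDerivAt_outSource {x : ℝ} (hx : x ∈ Ioo 0 D.b) :
    HasDerivAt (D.outSource T φ) (T.wact D.c (-D.lam x) (D.W x • φ x)) x :=
  hasDerivAt_primitive ((continuousOn_outIntegrand hφ).mono Ioo_subset_Ioc_self) a_mem hx

lemma continuousOn_ingoing : ContinuousOn (D.ingoing T P₀ φ) (Ioo 0 D.b) :=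
  continuousOn_τ.neg.wact (continuousOn_const.add fun _ hx =>
    (hasDerivAt_inSource hφ hx).continuousAt.continuousWithinAt)

lemma continuousOn_velocity : ContinuousOn (D.velocity T P₀ Q₀ φ) (Ioo 0 D.b) := by
  refine continuousOn_const.smul ((D.continuousOn_dτ.smul (continuousOn_ingoing hφ)).add
    (ContinuousOn.smul ?_ ((continuousOn_outgoing hφ).mono Ioo_subset_Ioc_self)))
  exact continuousOn_id.inv₀ fun x hx => hx.1.ne'

lemma hasDerivAt_field {x : ℝ} (hx : x ∈ Ioo 0 D.b) :
    HasDerivAt (D.field T P₀ Q₀ f φ) (D.velocity T P₀ Q₀ φ x) x :=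
  (hasDerivAt_primitive (continuousOn_velocity hφ) a_mem hx).const_add f

end CharSystem

/-! ### A priori estimates for the characteristic system -/

namespace CharSystem

variable (D : CharSystem)

/-- The solution of `p' = -c τ' p + m`, `p(a) = p₀`. -/
def majorant (p₀ : ℝ) (m : ℝ → ℝ) (x : ℝ) : ℝ :=
  Real.exp (-(D.c * D.τ x)) * (p₀ + ∫ y in D.a..x, Real.exp (D.c * D.τ y) * m y)

variable {D} {p₀ : ℝ} {m : ℝ → ℝ}

lemma continuousOn_exp_mul (hm : Continuous m) :
    ContinuousOn (fun y => Real.exp (D.c * D.τ y) * m y) (Ioo 0 D.b) :=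
  ((continuousOn_const.mul continuousOn_τ).rexp).mul hm.continuousOn

lemma hasDerivAt_majorant (hm : Continuous m) {x : ℝ} (hx : x ∈ Ioo 0 D.b) :
    HasDerivAt (D.majorant p₀ m) (-(D.c * (D.dτ x * D.majorant p₀ m x)) + m x) x := by
  have h1 := (((D.hasDerivAt_τ x hx).const_mul D.c).neg.exp).mul
    ((hasDerivAt_primitive (continuousOn_exp_mul hm) a_mem hx).const_add p₀)
  refine h1.congr_deriv ?_
  simp only [majorant, Pi.neg_apply]
  have : Real.exp (-(D.c * D.τ x)) * Real.exp (D.c * D.τ x) = 1 := by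
    rw [← Real.exp_add]; simp
  linear_combination m x * this

lemma majorant_nonneg (hp : 0 ≤ p₀) (hm0 : ∀ y ∈ Icc D.a D.b, 0 ≤ m y) {x : ℝ}
    (hx : x ∈ Ico D.a D.b) : 0 ≤ D.majorant p₀ m x := by
  refine mul_nonneg (Real.exp_nonneg _) (add_nonneg hp ?_)
  refine intervalIntegral.integral_nonneg hx.1 fun y hy =>
    mul_nonneg (Real.exp_nonneg _) (hm0 y ⟨hy.1, hy.2.trans hx.2.le⟩)

/-- Integrate `p' = -c τ' p + m`. Together with `majorant_nonneg` this bounds `∫ τ' p` by `(p₀ + ∫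
m) / c` uniformly up to `b`, without any integrability of `τ'` there. -/
lemma integral_dτ_mul_majorant (hm : Continuous m) {x : ℝ} (hx : x ∈ Ico D.a D.b) :
    D.c * ∫ y in D.a..x, D.dτ y * D.majorant p₀ m y
      = p₀ + (∫ y in D.a..x, m y) - D.majorant p₀ m x := by
  have hsub : uIcc D.a x ⊆ Ioo 0 D.b := by
    rw [uIcc_of_le hx.1]; exact fun y hy => ⟨D.a_pos.trans_le hy.1, hy.2.trans_lt hx.2⟩
  have hmaj : ContinuousOn (D.majorant p₀ m) (Ioo 0 D.b) := fun y hy =>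
    (hasDerivAt_majorant hm hy).continuousAt.continuousWithinAt
  have h1 : IntervalIntegrable (fun y => -(D.c * (D.dτ y * D.majorant p₀ m y))) volume D.a x :=
    ((continuousOn_const.mul (D.continuousOn_dτ.mul hmaj)).neg.mono hsub).intervalIntegrable
  have h2 := intervalIntegral.integral_eq_sub_of_hasDerivAt
    (fun y hy => hasDerivAt_majorant (p₀ := p₀) hm (hsub hy))
    (h1.add (hm.intervalIntegrable _ _))
  rw [intervalIntegral.integral_add h1 (hm.intervalIntegrable _ _),
    intervalIntegral.integral_neg, intervalIntegral.integral_const_mul] at h2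
  have h3 : D.majorant p₀ m D.a = p₀ := by simp [majorant, D.τ_a]
  rw [h3] at h2
  linarith

variable {X : Type*} [NormedAddCommGroup X] [NormedSpace ℝ X] {T : IsometryGroup X}
  {P₀ Q₀ f : X} {φ : ℝ → X}

/-- The group acts by isometries, so norms see only the damping factor `exp (-c τ)` and obey the
scalar equation. -/
lemma norm_ingoing_le (hφ : Continuous φ) (hm : Continuous m)
    (hmφ : ∀ y ∈ Icc D.a D.b, ‖D.W y • φ y‖ ≤ m y) {x : ℝ} (hx : x ∈ Ico D.a D.b) :
    ‖D.ingoing T P₀ φ x‖ ≤ D.majorant ‖P₀‖ m x := by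
  have hsub : uIcc D.a x ⊆ Ioo 0 D.b := by
    rw [uIcc_of_le hx.1]; exact fun y hy => ⟨D.a_pos.trans_le hy.1, hy.2.trans_lt hx.2⟩
  rw [ingoing, T.norm_wact, majorant, mul_neg]
  refine mul_le_mul_of_nonneg_left ((norm_add_le _ _).trans ?_) (Real.exp_nonneg _)
  gcongr
  refine (intervalIntegral.norm_integral_le_integral_norm hx.1).trans ?_
  refine intervalIntegral.integral_mono_on hx.1
    ((continuousOn_inIntegrand hφ).norm.mono hsub).intervalIntegrable
    ((continuousOn_exp_mul hm).mono hsub).intervalIntegrable fun y hy => ?_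
  rw [T.norm_wact]
  exact mul_le_mul_of_nonneg_left (hmφ y ⟨hy.1, hy.2.trans hx.2.le⟩) (Real.exp_nonneg _)

variable (D) in
/-- The growth of the outgoing characteristic field. -/
def outBound : ℝ := Real.exp (D.c * D.lam D.b)

lemma outBound_pos : 0 < D.outBound := Real.exp_pos _

lemma norm_outgoing_le (hφ : Continuous φ) (hm : Continuous m)
    (hmφ : ∀ y ∈ Icc D.a D.b, ‖D.W y • φ y‖ ≤ m y) {x : ℝ} (hx : x ∈ Icc D.a D.b) :
    ‖D.outgoing T Q₀ φ x‖ ≤ D.outBound * (‖Q₀‖ + ∫ y in D.a..x, m y) := by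
  have hsub : uIcc D.a x ⊆ Ioc 0 D.b := by
    rw [uIcc_of_le hx.1]; exact fun y hy => ⟨D.a_pos.trans_le hy.1, hy.2.trans hx.2⟩
  rw [outgoing, T.norm_wact, outBound]
  have hlam : D.lam x ≤ D.lam D.b :=
    Real.log_le_log (div_pos (D.a_pos.trans_le hx.1) D.a_pos)
      (div_le_div_of_nonneg_right hx.2 D.a_pos.le)
  refine mul_le_mul (Real.exp_le_exp.2 (mul_le_mul_of_nonneg_left hlam D.c_pos.le))
    ((norm_add_le _ _).trans ?_) (norm_nonneg _) (Real.exp_nonneg _)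
  gcongr
  refine (intervalIntegral.norm_integral_le_integral_norm hx.1).trans ?_
  refine intervalIntegral.integral_mono_on hx.1
    ((continuousOn_outIntegrand hφ).norm.mono hsub).intervalIntegrable
    (hm.intervalIntegrable _ _) fun y hy => ?_
  have hy' : y ∈ Icc D.a D.b := ⟨hy.1, hy.2.trans hx.2⟩
  rw [T.norm_wact]
  refine (mul_le_of_le_one_left (norm_nonneg _) (Real.exp_le_one_iff.2 ?_)).trans (hmφ y hy')
  nlinarith [mul_nonneg D.c_pos.le (lam_nonneg (D := D) hy.1)]

variable (D) in
/-- The constant in the a priori estimate for the field. -/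
def fieldBound : ℝ := 1 + 1 / D.c + (D.b - D.a) / D.a * D.outBound

lemma fieldBound_pos : 0 < D.fieldBound := by
  have h1 := D.c_pos
  have h2 := D.a_pos
  have h3 := sub_pos.2 D.a_lt_b
  have h4 := outBound_pos (D := D)
  unfold fieldBound
  positivity

variable [CompleteSpace X]

/-- The ingoing part `τ' P` costs `1 / c` by `integral_dτ_mul_majorant`. The outgoing part `x⁻¹ Q`
is bounded pointwise and costs `(b - a) / a * outBound`. The bound does not degenerate as `x → b`.
-/
lemma integral_norm_velocity_le (hφ : Continuous φ) (hm : Continuous m)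
    (hmφ : ∀ y ∈ Icc D.a D.b, ‖D.W y • φ y‖ ≤ m y) {x : ℝ} (hx : x ∈ Ico D.a D.b) :
    ∫ y in D.a..x, ‖D.velocity T P₀ Q₀ φ y‖
      ≤ D.fieldBound * (‖P₀‖ + ‖Q₀‖ + ∫ y in D.a..x, m y) := by
  have hm0 : ∀ y ∈ Icc D.a D.b, 0 ≤ m y := fun y hy => (norm_nonneg _).trans (hmφ y hy)
  have hsub : uIcc D.a x ⊆ Ioo 0 D.b := by
    rw [uIcc_of_le hx.1]; exact fun y hy => ⟨D.a_pos.trans_le hy.1, hy.2.trans_lt hx.2⟩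
  have hmaj : ContinuousOn (D.majorant ‖P₀‖ m) (Ioo 0 D.b) := fun y hy =>
    (hasDerivAt_majorant hm hy).continuousAt.continuousWithinAt
  set I := ∫ y in D.a..x, m y with hI
  have hI0 : 0 ≤ I := intervalIntegral.integral_nonneg hx.1 fun y hy =>
    hm0 y ⟨hy.1, hy.2.trans hx.2.le⟩
  have hmono : ∀ y ∈ Icc D.a x, ∫ z in D.a..y, m z ≤ I := by
    intro y hy
    rw [hI, ← intervalIntegral.integral_add_adjacent_intervals (hm.intervalIntegrable D.a y)
      (hm.intervalIntegrable y x)]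
    have := intervalIntegral.integral_nonneg (f := m) (μ := volume) hy.2 fun z hz =>
      hm0 z ⟨hy.1.trans hz.1, hz.2.trans hx.2.le⟩
    linarith
  have hint1 : IntervalIntegrable (fun y => D.dτ y * D.majorant ‖P₀‖ m y) volume D.a x :=
    ((D.continuousOn_dτ.mul hmaj).mono hsub).intervalIntegrable
  have hle : ∫ y in D.a..x, ‖D.velocity T P₀ Q₀ φ y‖ ≤ ∫ y in D.a..x,
      (D.dτ y * D.majorant ‖P₀‖ m y + D.a⁻¹ * (D.outBound * (‖Q₀‖ + I))) := by
    refine intervalIntegral.integral_mono_on hx.1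
      ((continuousOn_velocity hφ).norm.mono hsub).intervalIntegrable
      (hint1.add intervalIntegrable_const) fun y hy => ?_
    have hy' : y ∈ Ico D.a D.b := ⟨hy.1, hy.2.trans_lt hx.2⟩
    have hy0 : 0 < y := D.a_pos.trans_le hy.1
    have e1 : ‖D.dτ y • D.ingoing T P₀ φ y‖ ≤ D.dτ y * D.majorant ‖P₀‖ m y := by
      rw [norm_smul, Real.norm_of_nonneg (D.dτ_nonneg y hy')]
      exact mul_le_mul_of_nonneg_left (norm_ingoing_le hφ hm hmφ hy') (D.dτ_nonneg y hy')
    have e2 : ‖y⁻¹ • D.outgoing T Q₀ φ y‖ ≤ D.a⁻¹ * (D.outBound * (‖Q₀‖ + I)) := by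
      rw [norm_smul, norm_inv, Real.norm_of_nonneg hy0.le]
      refine mul_le_mul (inv_anti₀ D.a_pos hy.1)
        ((norm_outgoing_le hφ hm hmφ ⟨hy.1, hy'.2.le⟩).trans ?_) (norm_nonneg _)
        (inv_nonneg.2 D.a_pos.le)
      exact mul_le_mul_of_nonneg_left (by linarith [hmono y hy]) outBound_pos.le
    have e3 := norm_add_le (D.dτ y • D.ingoing T P₀ φ y) (y⁻¹ • D.outgoing T Q₀ φ y)
    rw [velocity, norm_smul]
    have e4 : ‖(-(1 / 2) : ℝ)‖ = 1 / 2 := by norm_num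
    rw [e4]
    have := norm_nonneg (D.dτ y • D.ingoing T P₀ φ y + y⁻¹ • D.outgoing T Q₀ φ y)
    linarith
  refine hle.trans ?_
  rw [intervalIntegral.integral_add hint1 intervalIntegrable_const,
    intervalIntegral.integral_const, smul_eq_mul]
  have h1 : ∫ y in D.a..x, D.dτ y * D.majorant ‖P₀‖ m y ≤ 1 / D.c * (‖P₀‖ + I) := by
    have e1 := integral_dτ_mul_majorant (p₀ := ‖P₀‖) hm hx
    have e2 := majorant_nonneg (norm_nonneg P₀) hm0 hx
    rw [div_mul_eq_mul_div, one_mul, le_div_iff₀ D.c_pos]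
    linarith
  have h2 : (x - D.a) * (D.a⁻¹ * (D.outBound * (‖Q₀‖ + I)))
      ≤ (D.b - D.a) / D.a * D.outBound * (‖Q₀‖ + I) := by
    have e1 : 0 ≤ D.a⁻¹ * (D.outBound * (‖Q₀‖ + I)) := by
      have := D.a_pos; have := outBound_pos (D := D); positivity
    calc _ ≤ (D.b - D.a) * (D.a⁻¹ * (D.outBound * (‖Q₀‖ + I))) :=
          mul_le_mul_of_nonneg_right (by linarith [hx.2]) e1
      _ = _ := by ring
  have hk1 : (0 : ℝ) ≤ 1 / D.c := by have := D.c_pos; positivity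
  have hk2 : 0 ≤ (D.b - D.a) / D.a * D.outBound := by
    have h2 := D.a_pos
    have h3 := sub_pos.2 D.a_lt_b
    have h4 := outBound_pos (D := D)
    positivity
  have hP := norm_nonneg P₀
  have hQ := norm_nonneg Q₀
  refine (add_le_add h1 h2).trans ?_
  unfold fieldBound
  nlinarith [mul_nonneg hk1 hQ, mul_nonneg hk2 hP]

/-- The integrals of the norm over `[a, x]` are bounded uniformly in `x < b`, so an increasing
sequence of endpoints gives integrability up to `b`. -/
lemma integrableOn_velocity (hφ : Continuous φ) :
    IntegrableOn (D.velocity T P₀ Q₀ φ) (Icc D.a D.b) := by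
  obtain ⟨w, hw⟩ := isCompact_Icc.exists_bound_of_continuousOn
    ((D.continuousOn_W.smul hφ.continuousOn).mono (Icc_subset (D := D)))
  rw [integrableOn_Icc_iff_integrableOn_Ioc]
  obtain ⟨u, -, hu, hlim⟩ := exists_seq_strictMono_tendsto' D.a_lt_b
  have hu' : ∀ n, u n ∈ Ico D.a D.b := fun n => ⟨(hu n).1.le, (hu n).2⟩
  refine integrableOn_Ioc_of_intervalIntegral_norm_bounded_right
    (I := D.fieldBound * (‖P₀‖ + ‖Q₀‖ + (D.b - D.a) * |w|)) (b := u) (l := atTop)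
    (fun n => ?_) hlim (Eventually.of_forall fun n => ?_)
  · refine ((continuousOn_velocity hφ).mono ?_).integrableOn_Icc.mono_set Ioc_subset_Icc_self
    exact fun y hy => ⟨D.a_pos.trans_le hy.1, hy.2.trans_lt (hu' n).2⟩
  · rw [← intervalIntegral.integral_of_le (hu' n).1]
    refine (integral_norm_velocity_le hφ (continuous_const (y := |w|))
      (fun y hy => (hw y hy).trans (le_abs_self w)) (hu' n)).trans ?_
    rw [intervalIntegral.integral_const, smul_eq_mul]
    refine mul_le_mul_of_nonneg_left ?_ fieldBound_pos.le
    have := mul_le_mul_of_nonneg_right (sub_le_sub_right (hu' n).2.le D.a) (abs_nonneg w)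
    linarith

lemma continuousOn_field (hφ : Continuous φ) :
    ContinuousOn (D.field T P₀ Q₀ f φ) (Icc D.a D.b) := by
  have h := intervalIntegral.continuousOn_primitive_interval (a := D.a) (b := D.b)
    (f := D.velocity T P₀ Q₀ φ) (μ := volume)
    (by rw [uIcc_of_le D.a_lt_b.le]; exact integrableOn_velocity hφ)
  rw [uIcc_of_le D.a_lt_b.le] at h
  exact continuousOn_const.add h

lemma norm_field_le (hφ : Continuous φ) (hm : Continuous m)
    (hmφ : ∀ y ∈ Icc D.a D.b, ‖D.W y • φ y‖ ≤ m y) {x : ℝ} (hx : x ∈ Icc D.a D.b) :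
    ‖D.field T P₀ Q₀ f φ x‖ ≤ ‖f‖ + D.fieldBound * (‖P₀‖ + ‖Q₀‖ + ∫ y in D.a..x, m y) := by
  -- The estimate is available for `x < b`; both sides are continuous, so it persists at `b`.
  have hcl : x ∈ closure (Ico D.a D.b) := by rwa [closure_Ico D.a_lt_b.ne]
  refine ContinuousWithinAt.closure_le (s := Ico D.a D.b)
    (f := fun x => ‖D.field T P₀ Q₀ f φ x‖)
    (g := fun x => ‖f‖ + D.fieldBound * (‖P₀‖ + ‖Q₀‖ + ∫ y in D.a..x, m y)) hcl ?_ ?_ ?_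
  · exact ((continuousOn_field hφ).norm x hx).mono Ico_subset_Icc_self
  · exact (continuous_const.add (continuous_const.mul (continuous_const.add
      (intervalIntegral.continuous_primitive hm.intervalIntegrable _)))).continuousWithinAt
  · intro y hy
    refine (norm_add_le _ _).trans (add_le_add_right ?_ _)
    exact (intervalIntegral.norm_integral_le_integral_norm hy.1).trans
      (integral_norm_velocity_le hφ hm hmφ hy)

end CharSystem

/-! ### Linearity, contraction and uniqueness for the characteristic system -/

namespace CharSystem

variable {D : CharSystem} {X : Type*} [NormedAddCommGroup X] [NormedSpace ℝ X]
  {T : IsometryGroup X} {P₀ Q₀ f P₁ Q₁ g : X} {φ φ' : ℝ → X}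

lemma inSource_sub (hφ : Continuous φ) (hφ' : Continuous φ') {x : ℝ} (hx : x ∈ Ioo 0 D.b) :
    D.inSource T (fun y => φ y - φ' y) x = D.inSource T φ x - D.inSource T φ' x := by
  have hsub : uIcc D.a x ⊆ Ioo 0 D.b := (ordConnected_Ioo).uIcc_subset a_mem hx
  rw [inSource, inSource, inSource, ← intervalIntegral.integral_sub
    ((continuousOn_inIntegrand hφ).mono hsub).intervalIntegrable
    ((continuousOn_inIntegrand hφ').mono hsub).intervalIntegrable]
  simp only [smul_sub, map_sub]

lemma outSource_sub (hφ : Continuous φ) (hφ' : Continuous φ') {x : ℝ} (hx : x ∈ Ioc 0 D.b) :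
    D.outSource T (fun y => φ y - φ' y) x = D.outSource T φ x - D.outSource T φ' x := by
  have hsub : uIcc D.a x ⊆ Ioc 0 D.b :=
    (ordConnected_Ioc).uIcc_subset (Ioo_subset_Ioc_self a_mem) hx
  rw [outSource, outSource, outSource, ← intervalIntegral.integral_sub
    ((continuousOn_outIntegrand hφ).mono hsub).intervalIntegrable
    ((continuousOn_outIntegrand hφ').mono hsub).intervalIntegrable]
  simp only [smul_sub, map_sub]

lemma velocity_sub (hφ : Continuous φ) (hφ' : Continuous φ') {x : ℝ} (hx : x ∈ Ioo 0 D.b) :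
    D.velocity T (P₀ - P₁) (Q₀ - Q₁) (fun y => φ y - φ' y) x
      = D.velocity T P₀ Q₀ φ x - D.velocity T P₁ Q₁ φ' x := by
  simp only [velocity, ingoing, outgoing, inSource_sub hφ hφ' hx,
    outSource_sub hφ hφ' (Ioo_subset_Ioc_self hx), map_sub, map_add, smul_sub, smul_add]
  abel

section Map

variable {Y : Type*} [NormedAddCommGroup Y] [NormedSpace ℝ Y] {T' : IsometryGroup Y}
  {ι : X →L[ℝ] Y}

lemma map_wact (h : ∀ s u, ι (T.act s u) = T'.act s (ι u)) (c s : ℝ) (u : X) :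
    ι (T.wact c s u) = T'.wact c s (ι u) := by
  simp only [IsometryGroup.wact_apply, map_smul, h]

end Map

variable [CompleteSpace X]

lemma intervalIntegrable_velocity (hφ : Continuous φ) {x : ℝ} (hx : x ∈ Icc D.a D.b) :
    IntervalIntegrable (D.velocity T P₀ Q₀ φ) volume D.a x := by
  rw [intervalIntegrable_iff_integrableOn_Icc_of_le hx.1]
  exact (integrableOn_velocity hφ).mono_set (Icc_subset_Icc_right hx.2)

/-- Joint linearity in the data and the field. With equal data it reduces contraction and uniqueness
to estimates with zero data. -/
lemma field_sub (hφ : Continuous φ) (hφ' : Continuous φ') {x : ℝ} (hx : x ∈ Icc D.a D.b) :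
    D.field T (P₀ - P₁) (Q₀ - Q₁) (f - g) (fun y => φ y - φ' y) x
      = D.field T P₀ Q₀ f φ x - D.field T P₁ Q₁ g φ' x := by
  have h : ∫ y in D.a..x, D.velocity T (P₀ - P₁) (Q₀ - Q₁) (fun y => φ y - φ' y) y
      = ∫ y in D.a..x, (D.velocity T P₀ Q₀ φ y - D.velocity T P₁ Q₁ φ' y) := by
    exact intervalIntegral.integral_congr_Ioo_of_le hx.1 fun y hy =>
      velocity_sub hφ hφ' ⟨D.a_pos.trans hy.1, hy.2.trans_le hx.2⟩
  rw [field, field, field, h, intervalIntegral.integral_sub (intervalIntegrable_velocity hφ hx)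
    (intervalIntegrable_velocity hφ' hx)]
  abel

/-- The a priori estimate in the norm with weight `exp (-M (x - a))`. -/
lemma norm_field_le_of_weight {w M N : ℝ} (hw : ∀ y ∈ Icc D.a D.b, |D.W y| ≤ w)
    (hM : 2 * D.fieldBound * w ≤ M) (hM0 : 0 < M) (hN : 0 ≤ N) (hφ : Continuous φ)
    (hφN : ∀ y ∈ Icc D.a D.b, ‖φ y‖ ≤ N * Real.exp (M * (y - D.a))) {x : ℝ}
    (hx : x ∈ Icc D.a D.b) :
    ‖D.field T P₀ Q₀ f φ x‖ ≤ ‖f‖ + D.fieldBound * (‖P₀‖ + ‖Q₀‖)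
      + N / 2 * Real.exp (M * (x - D.a)) := by
  have hw0 : 0 ≤ w := (abs_nonneg _).trans (hw D.a (left_mem_Icc.2 D.a_lt_b.le))
  have h1 := norm_field_le (D := D) (T := T) (P₀ := P₀) (Q₀ := Q₀) (f := f) (φ := φ)
    (m := fun y => w * N * Real.exp (M * (y - D.a))) hφ (by fun_prop) (fun y hy => by
      rw [norm_smul, Real.norm_eq_abs, mul_assoc]
      exact mul_le_mul (hw y hy) (hφN y hy) (norm_nonneg _) hw0) hx
  have h2 : ∫ y in D.a..x, w * N * Real.exp (M * (y - D.a))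
      = w * N * ((Real.exp (M * (x - D.a)) - 1) / M) := by
    have h3 : ∀ y ∈ uIcc D.a x, HasDerivAt (fun y => w * N * (Real.exp (M * (y - D.a)) / M))
        (w * N * Real.exp (M * (y - D.a))) y := by
      intro y _
      have := (((((hasDerivAt_id y).sub_const D.a).const_mul M).exp).div_const M).const_mul (w * N)
      refine this.congr_deriv ?_
      simp only [id]
      field_simp
    rw [intervalIntegral.integral_eq_sub_of_hasDerivAt h3
      (Continuous.intervalIntegrable (by fun_prop) _ _)]
    simp only [sub_self, mul_zero, Real.exp_zero]
    ring
  rw [h2] at h1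
  refine h1.trans ?_
  have hE := Real.exp_pos (M * (x - D.a))
  -- Integrating the weight gains a factor `1 / M`, and `2 * fieldBound * w ≤ M` turns the total
  -- factor into `1 / 2`.
  have h4 : D.fieldBound * (w * N * ((Real.exp (M * (x - D.a)) - 1) / M))
      ≤ N / 2 * Real.exp (M * (x - D.a)) := by
    have h5 : D.fieldBound * (w * N * ((Real.exp (M * (x - D.a)) - 1) / M))
        = (2 * D.fieldBound * w) / M * (N / 2 * (Real.exp (M * (x - D.a)) - 1)) := by
      field_simp
    have h6 : 1 ≤ Real.exp (M * (x - D.a)) :=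
      Real.one_le_exp (mul_nonneg hM0.le (sub_nonneg.2 hx.1))
    rw [h5]
    refine (mul_le_of_le_one_left (mul_nonneg (by linarith) (by linarith))
      ((div_le_one hM0).2 hM)).trans ?_
    nlinarith
  rw [mul_add]
  linarith

variable (D) in
lemma exists_weight : ∃ w M : ℝ, (∀ y ∈ Icc D.a D.b, |D.W y| ≤ w) ∧
    2 * D.fieldBound * w ≤ M ∧ 0 < M := by
  obtain ⟨w, hw⟩ := isCompact_Icc.exists_bound_of_continuousOn
    (D.continuousOn_W.mono (Icc_subset (D := D)))
  exact ⟨w, |2 * D.fieldBound * w| + 1, hw, (le_abs_self _).trans (by linarith), by positivity⟩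

variable (D T) in
/-- A priori estimate for solutions of the characteristic system. -/
lemma exists_apriori_bound : ∃ C : ℝ, 0 < C ∧ ∀ (P₀ Q₀ f : X) (φ : ℝ → X), Continuous φ →
    (∀ x ∈ Icc D.a D.b, D.field T P₀ Q₀ f φ x = φ x) →
    ∀ x ∈ Icc D.a D.b, ‖φ x‖ ≤ C * (‖P₀‖ + ‖Q₀‖ + ‖f‖) := by
  obtain ⟨w, M, hw, hM, hM0⟩ := D.exists_weight
  have hK := fieldBound_pos (D := D)
  refine ⟨2 * (1 + D.fieldBound) * Real.exp (M * (D.b - D.a)), by positivity, ?_⟩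
  intro P₀ Q₀ f φ hφ hfix x hx
  -- Let `N` be the maximum of the weighted norm, attained at `z`. The weighted estimate at `z`
  -- reads `N ≤ S + N / 2`, hence `N ≤ 2 S`.
  obtain ⟨z, hz, hmax⟩ := isCompact_Icc.exists_isMaxOn (nonempty_Icc.2 D.a_lt_b.le)
    (f := fun y => Real.exp (-(M * (y - D.a))) * ‖φ y‖) (by fun_prop)
  set N := Real.exp (-(M * (z - D.a))) * ‖φ z‖ with hN
  have hN0 : 0 ≤ N := by positivity
  have hb : ∀ y ∈ Icc D.a D.b, ‖φ y‖ ≤ N * Real.exp (M * (y - D.a)) := by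
    intro y hy
    have h1 : Real.exp (-(M * (y - D.a))) * ‖φ y‖ ≤ N := hmax hy
    have h2 : Real.exp (-(M * (y - D.a))) * Real.exp (M * (y - D.a)) = 1 := by
      rw [← Real.exp_add]; simp
    calc ‖φ y‖ = (Real.exp (-(M * (y - D.a))) * ‖φ y‖) * Real.exp (M * (y - D.a)) := by
          linear_combination -‖φ y‖ * h2
      _ ≤ _ := mul_le_mul_of_nonneg_right h1 (Real.exp_nonneg _)
  have h3 := norm_field_le_of_weight (T := T) (P₀ := P₀) (Q₀ := Q₀) (f := f) hw hM hM0 hN0 hφ hb hz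
  rw [hfix z hz] at h3
  set S := ‖f‖ + D.fieldBound * (‖P₀‖ + ‖Q₀‖) with hS
  have hS0 : 0 ≤ S := by positivity
  have h4 : N ≤ S + N / 2 := by
    have h5 : Real.exp (-(M * (z - D.a))) ≤ 1 :=
      Real.exp_le_one_iff.2 (neg_nonpos.2 (mul_nonneg hM0.le (sub_nonneg.2 hz.1)))
    have h6 : Real.exp (-(M * (z - D.a))) * Real.exp (M * (z - D.a)) = 1 := by
      rw [← Real.exp_add]; simp
    have h7 := mul_le_mul_of_nonneg_left h3 (Real.exp_nonneg (-(M * (z - D.a))))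
    have h8 := mul_le_of_le_one_left hS0 h5
    calc N ≤ _ := h7
      _ = Real.exp (-(M * (z - D.a))) * S + N / 2 := by linear_combination N / 2 * h6
      _ ≤ _ := by linarith
  have h9 : S ≤ (1 + D.fieldBound) * (‖P₀‖ + ‖Q₀‖ + ‖f‖) := by
    have := norm_nonneg P₀; have := norm_nonneg Q₀; have := norm_nonneg f
    rw [hS]; nlinarith
  have h10 : Real.exp (M * (x - D.a)) ≤ Real.exp (M * (D.b - D.a)) :=
    Real.exp_le_exp.2 (mul_le_mul_of_nonneg_left (by linarith [hx.2]) hM0.le)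
  calc ‖φ x‖ ≤ N * Real.exp (M * (x - D.a)) := hb x hx
    _ ≤ (2 * ((1 + D.fieldBound) * (‖P₀‖ + ‖Q₀‖ + ‖f‖))) * Real.exp (M * (D.b - D.a)) :=
        mul_le_mul (by linarith) h10 (Real.exp_nonneg _) (by positivity)
    _ = _ := by ring

lemma field_unique (hφ : Continuous φ) (hφ' : Continuous φ')
    (h : ∀ x ∈ Icc D.a D.b, D.field T P₀ Q₀ f φ x = φ x)
    (h' : ∀ x ∈ Icc D.a D.b, D.field T P₀ Q₀ f φ' x = φ' x) :
    ∀ x ∈ Icc D.a D.b, φ x = φ' x := by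
  intro x hx
  obtain ⟨C, -, hC⟩ := exists_apriori_bound D T
  have := hC 0 0 0 (fun y => φ y - φ' y) (hφ.sub hφ') (fun y hy => by
    have := field_sub (T := T) (P₀ := P₀) (P₁ := P₀) (Q₀ := Q₀) (Q₁ := Q₀) (f := f) (g := f)
      hφ hφ' hy
    rw [sub_self, sub_self, sub_self, h y hy, h' y hy] at this
    exact this) x hx
  simp only [norm_zero, add_zero, mul_zero, norm_le_zero_iff] at this
  exact sub_eq_zero.1 this

variable (D T) in
/-- Existence for the characteristic system, up to and including `x = b`. -/
lemma exists_field (P₀ Q₀ f : X) : ∃ φ : ℝ → X, Continuous φ ∧ (∀ x ≤ D.a, φ x = φ D.a) ∧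
    ∀ x ∈ Icc D.a D.b, D.field T P₀ Q₀ f φ x = φ x := by
  obtain ⟨w, M, hw, hM, hM0⟩ := D.exists_weight
  -- The fixed point is sought for the rescaled unknown `exp (-M (x - a)) φ`, so that the weighted
  -- norm becomes the plain supremum norm of `C([a, b], X)`.
  let ext : C(Icc D.a D.b, X) → ℝ → X := fun ψ y =>
    Real.exp (M * (y - D.a)) • IccExtend D.a_lt_b.le ψ y
  have hext : ∀ ψ, Continuous (ext ψ) := fun ψ =>
    Continuous.smul (by fun_prop) (ψ.continuous.Icc_extend')
  let F : C(Icc D.a D.b, X) → C(Icc D.a D.b, X) := fun ψ =>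
    ⟨fun x => Real.exp (-(M * (x - D.a))) • D.field T P₀ Q₀ f (ext ψ) x,
      Continuous.smul (by fun_prop) (continuousOn_iff_continuous_domRestrict.1
        (continuousOn_field (hext ψ)))⟩
  have hF : ContractingWith (1 / 2) F := by
    refine ⟨by norm_num, LipschitzWith.of_dist_le_mul fun ψ ψ' => ?_⟩
    rw [ContinuousMap.dist_le (by positivity)]
    intro x
    have hN0 : 0 ≤ dist ψ ψ' := dist_nonneg
    have h1 := norm_field_le_of_weight (T := T) (P₀ := P₀ - P₀) (Q₀ := Q₀ - Q₀) (f := f - f)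
      (φ := fun y => ext ψ y - ext ψ' y) hw hM hM0 hN0 ((hext ψ).sub (hext ψ')) (fun y hy => by
        simp only [ext, ← smul_sub, norm_smul, Real.norm_eq_abs, Real.abs_exp]
        rw [mul_comm]
        refine mul_le_mul_of_nonneg_right ?_ (Real.exp_nonneg _)
        rw [IccExtend_of_mem _ _ hy, IccExtend_of_mem _ _ hy, ← dist_eq_norm]
        exact ContinuousMap.dist_apply_le_dist _) x.2
    rw [field_sub (hext ψ) (hext ψ') x.2] at h1
    simp only [sub_self, norm_zero, add_zero, mul_zero, zero_add] at h1
    rw [dist_eq_norm]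
    change ‖Real.exp (-(M * (x - D.a))) • D.field T P₀ Q₀ f (ext ψ) x
      - Real.exp (-(M * (x - D.a))) • D.field T P₀ Q₀ f (ext ψ') x‖ ≤ _
    rw [← smul_sub, norm_smul, Real.norm_eq_abs, Real.abs_exp]
    refine (mul_le_mul_of_nonneg_left h1 (Real.exp_nonneg _)).trans (le_of_eq ?_)
    have h6 : Real.exp (-(M * (x - D.a))) * Real.exp (M * (x - D.a)) = 1 := by
      rw [← Real.exp_add]; simp
    have e : ((1 / 2 : NNReal) : ℝ) = 1 / 2 := by norm_num
    rw [e]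
    linear_combination dist ψ ψ' / 2 * h6
  obtain ⟨ψ, hψ⟩ : ∃ ψ, F ψ = ψ := ⟨_, hF.fixedPoint_isFixedPt⟩
  have hfix : ∀ x (hx : x ∈ Icc D.a D.b), D.field T P₀ Q₀ f (ext ψ) x = ext ψ x := by
    intro x hx
    have h1 := DFunLike.congr_fun hψ ⟨x, hx⟩
    change Real.exp (-(M * (x - D.a))) • D.field T P₀ Q₀ f (ext ψ) x = ψ ⟨x, hx⟩ at h1
    change _ = Real.exp (M * (x - D.a)) • IccExtend D.a_lt_b.le ψ x
    rw [IccExtend_of_mem _ _ hx, ← h1, smul_smul, ← Real.exp_add]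
    simp
  let φ : ℝ → X := fun x => ext ψ (projIcc D.a D.b D.a_lt_b.le x)
  have hφeq : ∀ x ∈ Icc D.a D.b, φ x = ext ψ x := fun x hx => by
    simp only [φ, projIcc_of_mem _ hx]
  refine ⟨φ, (hext ψ).comp (continuous_subtype_val.comp continuous_projIcc), fun x hx => ?_, ?_⟩
  · simp only [φ, projIcc_of_le_left _ hx, projIcc_left]
  intro x hx
  rw [hφeq x hx, ← hfix x hx]
  -- The sources at `y` depend only on values in `[a, y]`, where both extensions agree.
  have hsrc : ∀ y ∈ Icc D.a D.b, D.velocity T P₀ Q₀ φ y = D.velocity T P₀ Q₀ (ext ψ) y := by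
    intro y hy
    have e : ∀ z ∈ uIcc D.a y, φ z = ext ψ z := fun z hz => by
      rw [uIcc_of_le hy.1] at hz
      exact hφeq z ⟨hz.1, hz.2.trans hy.2⟩
    have e1 : D.inSource T φ y = D.inSource T (ext ψ) y :=
      intervalIntegral.integral_congr fun z hz => by simp only [e z hz]
    have e2 : D.outSource T φ y = D.outSource T (ext ψ) y :=
      intervalIntegral.integral_congr fun z hz => by simp only [e z hz]
    simp only [velocity, ingoing, outgoing, e1, e2]
  rw [field, field]
  congr 1
  refine intervalIntegral.integral_congr fun y hy => ?_
  rw [uIcc_of_le hx.1] at hy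
  exact hsrc y ⟨hy.1, hy.2.trans hx.2⟩

/-! ### Maps that commute with the groups -/

section Map

variable {Y : Type*} [NormedAddCommGroup Y] [NormedSpace ℝ Y] [CompleteSpace Y]
  {T' : IsometryGroup Y} {ι : X →L[ℝ] Y}

lemma map_ingoing (h : ∀ s u, ι (T.act s u) = T'.act s (ι u)) (hφ : Continuous φ) {x : ℝ}
    (hx : x ∈ Ioo 0 D.b) :
    ι (D.ingoing T P₀ φ x) = D.ingoing T' (ι P₀) (fun y => ι (φ y)) x := by
  have hsub : uIcc D.a x ⊆ Ioo 0 D.b := (ordConnected_Ioo).uIcc_subset a_mem hx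
  rw [ingoing, map_wact h, map_add, inSource, ← ι.intervalIntegral_comp_comm
    ((continuousOn_inIntegrand hφ).mono hsub).intervalIntegrable]
  simp only [map_wact h, map_smul, ingoing, inSource]

lemma map_outgoing (h : ∀ s u, ι (T.act s u) = T'.act s (ι u)) (hφ : Continuous φ) {x : ℝ}
    (hx : x ∈ Ioc 0 D.b) :
    ι (D.outgoing T Q₀ φ x) = D.outgoing T' (ι Q₀) (fun y => ι (φ y)) x := by
  have hsub : uIcc D.a x ⊆ Ioc 0 D.b :=
    (ordConnected_Ioc).uIcc_subset (Ioo_subset_Ioc_self a_mem) hx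
  rw [outgoing, map_wact h, map_add, outSource, ← ι.intervalIntegral_comp_comm
    ((continuousOn_outIntegrand hφ).mono hsub).intervalIntegrable]
  simp only [map_wact h, map_smul, outgoing, outSource]

lemma map_velocity (h : ∀ s u, ι (T.act s u) = T'.act s (ι u)) (hφ : Continuous φ) {x : ℝ}
    (hx : x ∈ Ioo 0 D.b) :
    ι (D.velocity T P₀ Q₀ φ x) = D.velocity T' (ι P₀) (ι Q₀) (fun y => ι (φ y)) x := by
  simp only [velocity, map_smul, map_add, map_ingoing h hφ hx,
    map_outgoing h hφ (Ioo_subset_Ioc_self hx)]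

/-- This carries a solution in `H²` to one in `L²`, where it can be compared with distributional
solutions. -/
lemma map_field (h : ∀ s u, ι (T.act s u) = T'.act s (ι u)) (hφ : Continuous φ) {x : ℝ}
    (hx : x ∈ Icc D.a D.b) :
    ι (D.field T P₀ Q₀ f φ x) = D.field T' (ι P₀) (ι Q₀) (ι f) (fun y => ι (φ y)) x := by
  rw [field, field, map_add, ← ι.intervalIntegral_comp_comm (intervalIntegrable_velocity hφ hx)]
  congr 1
  exact intervalIntegral.integral_congr_Ioo_of_le hx.1 fun y hy =>
    map_velocity h hφ ⟨D.a_pos.trans hy.1, hy.2.trans_le hx.2⟩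

end Map

end CharSystem

/-! ### Translations on `L²(ℝ)` and on the Sobolev spaces -/

lemma integral_mul_eq_inner (u : RealL2) {θ : ℝ → ℝ} (hθ : MemLp θ 2 volume) :
    ∫ s, u s * θ s = inner ℝ (hθ.toLp θ) u := by
  rw [L2.inner_def]
  refine integral_congr_ae ?_
  filter_upwards [hθ.coeFn_toLp] with s hs
  simp [hs, mul_comm]

lemma memLp_test {η : ℝ → ℝ} (hη : ContDiff ℝ ∞ η) (hc : HasCompactSupport η) :
    MemLp η 2 volume := hη.continuous.memLp_of_hasCompactSupport hc

lemma memLp_deriv_test {η : ℝ → ℝ} (hη : ContDiff ℝ ∞ η) (hc : HasCompactSupport η) :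
    MemLp (deriv η) 2 volume :=
  (hη.continuous_deriv (by simp)).memLp_of_hasCompactSupport hc.deriv

lemma contDiff_deriv_test {η : ℝ → ℝ} (hη : ContDiff ℝ ∞ η) : ContDiff ℝ ∞ (deriv η) :=
  (contDiff_infty_iff_deriv.1 hη).2

/-- Test functions separate the points of `L²(ℝ)`. -/
lemma RealL2.eq_zero_of_test {u : RealL2}
    (h : ∀ (η : ℝ → ℝ) (hη : ContDiff ℝ ∞ η) (hc : HasCompactSupport η),
      inner ℝ ((memLp_test hη hc).toLp η) u = (0 : ℝ)) : u = 0 := by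
  have h1 : ∀ᵐ s, u s = 0 := by
    refine ae_eq_zero_of_integral_contDiff_smul_eq_zero
      ((Lp.memLp u).locallyIntegrable (by norm_num)) fun η hη hc => ?_
    rw [← h η hη hc, ← integral_mul_eq_inner]
    simp only [smul_eq_mul, mul_comm]
  exact (Lp.eq_zero_iff_ae_eq_zero).2 h1

lemma RealL2.ext_test {u v : RealL2}
    (h : ∀ (η : ℝ → ℝ) (hη : ContDiff ℝ ∞ η) (hc : HasCompactSupport η),
      inner ℝ ((memLp_test hη hc).toLp η) u = (inner ℝ ((memLp_test hη hc).toLp η) v : ℝ)) :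
    u = v := by
  refine sub_eq_zero.1 (RealL2.eq_zero_of_test fun η hη hc => ?_)
  rw [inner_sub_right, h η hη hc, sub_self]

lemma isWeakDeriv_iff_inner {u v : RealL2} : IsWeakDeriv u v ↔
    ∀ (η : ℝ → ℝ) (hη : ContDiff ℝ ∞ η) (hc : HasCompactSupport η),
      (inner ℝ ((memLp_deriv_test hη hc).toLp (deriv η)) u : ℝ)
        = -inner ℝ ((memLp_test hη hc).toLp η) v := by
  simp only [← integral_mul_eq_inner]
  rfl

lemma IsWeakDeriv.unique {u v v' : RealL2} (h : IsWeakDeriv u v) (h' : IsWeakDeriv u v') :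
    v = v' := by
  rw [isWeakDeriv_iff_inner] at h h'
  refine RealL2.ext_test fun η hη hc => ?_
  have := (h η hη hc).symm.trans (h' η hη hc)
  linarith

/-- Translation `u ↦ u (· + s)` on `L²(ℝ)`. -/
def shiftL2 (s : ℝ) : RealL2 →ₗᵢ[ℝ] RealL2 :=
  Lp.compMeasurePreservingₗᵢ ℝ (fun r => r + s) (measurePreserving_add_right volume s)

lemma shiftL2_coeFn (s : ℝ) (u : RealL2) : shiftL2 s u =ᵐ[volume] fun r => u (r + s) :=
  Lp.coeFn_compMeasurePreserving u (measurePreserving_add_right volume s)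

lemma continuous_shiftL2 : Continuous fun p : ℝ × RealL2 => shiftL2 p.1 p.2 :=
  Continuous.compMeasurePreservingLp (f := fun p : ℝ × RealL2 => p.2)
    (g := fun p : ℝ × RealL2 => ContinuousMap.mk (fun r => r + p.1) (by fun_prop))
    continuous_snd
    ((ContinuousMap.curry ⟨fun q : (ℝ × RealL2) × ℝ => q.2 + q.1.1, by fun_prop⟩).continuous)
    (fun p => measurePreserving_add_right volume p.1) (by norm_num)

/-- The translation group on `L²(ℝ)`. -/
def translationL2 : IsometryGroup RealL2 where
  act s := (shiftL2 s).toContinuousLinearMap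
  act_zero u := by
    refine Lp.ext ?_
    filter_upwards [shiftL2_coeFn 0 u] with r hr
    simpa using hr
  act_add s t u := by
    refine Lp.ext ?_
    have h1 := (measurePreserving_add_right (volume : Measure ℝ) s).quasiMeasurePreserving.ae
      (shiftL2_coeFn t u)
    filter_upwards [shiftL2_coeFn (s + t) u, shiftL2_coeFn s (shiftL2 t u), h1]
      with r h2 h3 h4
    simp only [LinearIsometry.coe_toContinuousLinearMap] at *
    rw [h2, h3, h4, add_assoc]
  norm_act s u := (shiftL2 s).norm_map u
  continuous_act := continuous_shiftL2

lemma integral_act_mul (s : ℝ) (u : RealL2) (θ : ℝ → ℝ) :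
    ∫ r, translationL2.act s u r * θ r = ∫ r, u r * θ (r - s) := by
  rw [← integral_add_right_eq_self (fun r => u r * θ (r - s)) s]
  refine integral_congr_ae ?_
  filter_upwards [shiftL2_coeFn s u] with r hr
  change shiftL2 s u r * θ r = _
  rw [hr, add_sub_cancel_right]

lemma contDiff_shift {η : ℝ → ℝ} (hη : ContDiff ℝ ∞ η) (s : ℝ) :
    ContDiff ℝ ∞ fun r => η (r - s) := hη.comp (contDiff_id.sub contDiff_const)

lemma hasCompactSupport_shift {η : ℝ → ℝ} (hc : HasCompactSupport η) (s : ℝ) :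
    HasCompactSupport fun r => η (r - s) := by
  have := hc.comp_homeomorph (Homeomorph.subRight s)
  exact this

lemma deriv_shift (η : ℝ → ℝ) (s : ℝ) :
    deriv (fun r => η (r - s)) = fun r => deriv η (r - s) := by
  funext r
  exact deriv_comp_sub_const (f := η) s r

lemma IsWeakDeriv.act {u v : RealL2} (h : IsWeakDeriv u v) (s : ℝ) :
    IsWeakDeriv (translationL2.act s u) (translationL2.act s v) := by
  intro η hη hc
  rw [integral_act_mul, integral_act_mul]
  have := h _ (contDiff_shift hη s) (hasCompactSupport_shift hc s)
  rwa [deriv_shift] at this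

/-- The translation group is generated by the weak derivative. -/
lemma IsWeakDeriv.act_eq_add_integral {u v : RealL2} (h : IsWeakDeriv u v) (s : ℝ) :
    translationL2.act s u = u + ∫ r in (0 : ℝ)..s, translationL2.act r v := by
  have hcont : Continuous fun r => translationL2.act r v :=
    translationL2.continuous_act.comp (by fun_prop : Continuous fun r : ℝ => (r, v))
  rw [← sub_eq_zero]
  refine RealL2.eq_zero_of_test fun η hη hc => ?_
  set e := (memLp_test hη hc).toLp η with he
  have hpair : ∀ (w : RealL2) (r : ℝ), inner ℝ e (translationL2.act r w)
      = ∫ t, w t * η (t - r) := fun w r => by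
    rw [he, ← integral_mul_eq_inner, integral_act_mul]
  -- The pairing is the convolution of `u` with `η(-·)`, so it is differentiable in `r`. The
  -- derivative falls on `η` and the definition of the weak derivative moves it to `v`.
  have hderiv : ∀ r, HasDerivAt (fun r => (inner ℝ e (translationL2.act r u) : ℝ))
      (inner ℝ e (translationL2.act r v)) r := by
    intro r
    have hg : ContDiff ℝ 1 fun x => η (-x) := (hη.comp contDiff_neg).of_le (by simp)
    have hcg : HasCompactSupport fun x => η (-x) := hc.comp_homeomorph (Homeomorph.neg ℝ)
    have h1 := hcg.hasDerivAt_convolution_right (μ := volume) (ContinuousLinearMap.mul ℝ ℝ)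
      ((Lp.memLp u).locallyIntegrable (by norm_num)) hg r
    have e1 : (fun r => (inner ℝ e (translationL2.act r u) : ℝ))
        = convolution u (fun x => η (-x)) (ContinuousLinearMap.mul ℝ ℝ) volume := by
      funext r
      rw [hpair, convolution_def]
      simp
    have e2 : convolution u (deriv fun x => η (-x)) (ContinuousLinearMap.mul ℝ ℝ) volume r
        = inner ℝ e (translationL2.act r v) := by
      rw [hpair, convolution_def]
      have h2 := h _ (contDiff_shift hη r) (hasCompactSupport_shift hc r)
      rw [deriv_shift] at h2
      have h3 : ∀ x, deriv (fun x => η (-x)) x = -deriv η (-x) := fun x => deriv_comp_neg η x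
      simp only [ContinuousLinearMap.mul_apply', h3, neg_sub, mul_neg, integral_neg]
      linarith
    rw [e1, ← e2]
    exact h1
  have hint := intervalIntegral.integral_eq_sub_of_hasDerivAt (a := 0) (b := s)
    (fun r _ => hderiv r) ((continuous_const.inner hcont).intervalIntegrable _ _)
  have hcomm := (innerSL ℝ e).intervalIntegral_comp_comm (μ := volume) (hcont.intervalIntegrable 0 s)
  simp only [innerSL_apply_apply] at hcomm
  rw [inner_sub_right, inner_add_right, ← hcomm, hint, translationL2.act_zero]
  ring

/-! #### Sobolev spaces -/

/-- For a fixed test function, being a weak derivative is a closed linear condition. The resulting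
completeness is needed for vector-valued integrals and for the fixed point. -/
lemma isClosed_sobolevSpace (m : ℕ) :
    IsClosed (SobolevSpace m : Set (PiLp 2 (fun _ : Fin (m + 1) => RealL2))) := by
  have : (SobolevSpace m : Set (PiLp 2 (fun _ : Fin (m + 1) => RealL2)))
      = ⋂ i : Fin m, {u | IsWeakDeriv (u i.castSucc) (u i.succ)} := by
    ext u; simp only [mem_iInter]; exact Iff.rfl
  rw [this]
  refine isClosed_iInter fun i => ?_
  simp only [isWeakDeriv_iff_inner, ofPred_forall]
  refine isClosed_iInter fun η => isClosed_iInter fun hη => isClosed_iInter fun hc => ?_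
  exact isClosed_eq (by fun_prop) (by fun_prop)

instance (m : ℕ) : CompleteSpace (SobolevSpace m) := (isClosed_sobolevSpace m).completeSpace_coe

/-- `weakD · j` as a continuous linear map. -/
def weakDL (m : ℕ) (j : Fin (m + 1)) : SobolevSpace m →L[ℝ] RealL2 :=
  (PiLp.proj 2 (fun _ : Fin (m + 1) => RealL2) j).comp (SobolevSpace m).subtypeL

lemma weakDL_apply {m : ℕ} (j : Fin (m + 1)) (u : SobolevSpace m) : weakDL m j u = weakD u j :=
  rfl

lemma SobolevSpace.ext_weakD {m : ℕ} {u v : SobolevSpace m} (h : ∀ j, weakD u j = weakD v j) :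
    u = v := Subtype.ext (PiLp.ext h)

lemma isWeakDeriv_weakD {m : ℕ} (u : SobolevSpace m) (i : Fin m) :
    IsWeakDeriv (weakD u i.castSucc) (weakD u i.succ) := u.2 i

/-- Weak derivatives are unique, so the lowest entry determines all others; equalities in `H²` or
`H³` can be tested in `L²`. -/
lemma SobolevSpace.ext_zero {m : ℕ} {u v : SobolevSpace m} (h : weakD u 0 = weakD v 0) :
    u = v := by
  refine SobolevSpace.ext_weakD fun j => ?_
  induction j using Fin.induction with
  | zero => exact h
  | succ i hi =>
    have h1 := isWeakDeriv_weakD u i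
    rw [hi] at h1
    exact h1.unique (isWeakDeriv_weakD v i)

/-- The tuple `w`, of which each entry is the weak derivative of the preceding one. -/
def SobolevSpace.mk {m : ℕ} (w : Fin (m + 1) → RealL2)
    (h : ∀ i : Fin m, IsWeakDeriv (w i.castSucc) (w i.succ)) : SobolevSpace m :=
  ⟨WithLp.toLp 2 w, h⟩

lemma SobolevSpace.continuous_iff {m : ℕ} {Y : Type*} [TopologicalSpace Y]
    {u : Y → SobolevSpace m} : Continuous u ↔ ∀ j, Continuous fun y => weakD (u y) j := by
  refine ⟨fun h j => (weakDL m j).continuous.comp h, fun h => ?_⟩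
  refine Continuous.subtype_mk (f := fun y => (u y).1)
    ((PiLp.continuous_toLp 2 _).comp (continuous_pi h)) fun y => (u y).2

/-- The `k`-th derivative, as a map between Sobolev spaces. -/
def sobolevD (m n k : ℕ) (h : n + k ≤ m) : SobolevSpace m →L[ℝ] SobolevSpace n where
  toFun u := SobolevSpace.mk (fun j => weakD u ⟨j + k, by omega⟩) fun i => by
    have := isWeakDeriv_weakD u ⟨i + k, by omega⟩
    have e : (⟨(i.succ : Fin (n + 1)) + k, by omega⟩ : Fin (m + 1))
        = (⟨i + k, by omega⟩ : Fin m).succ := Fin.ext (by simp only [Fin.val_succ]; omega)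
    rw [e]
    exact this
  map_add' _ _ := rfl
  map_smul' _ _ := rfl
  cont := SobolevSpace.continuous_iff.2 fun j => (weakDL m ⟨j + k, by omega⟩).continuous

lemma SobolevSpace.norm_sq {m : ℕ} (u : SobolevSpace m) : ‖u‖ ^ 2 = ∑ j, ‖weakD u j‖ ^ 2 :=
  PiLp.norm_sq_eq_of_L2 _ u.1

/-- The translation group on a Sobolev space. -/
def translation (m : ℕ) : IsometryGroup (SobolevSpace m) where
  act s :=
    { toFun := fun u => SobolevSpace.mk (fun j => translationL2.act s (weakD u j))
        fun i => (isWeakDeriv_weakD u i).act s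
      map_add' := fun u v => SobolevSpace.ext_weakD fun j =>
        map_add (translationL2.act s) (weakD u j) (weakD v j)
      map_smul' := fun c u => SobolevSpace.ext_weakD fun j =>
        map_smul (translationL2.act s) c (weakD u j)
      cont := SobolevSpace.continuous_iff.2 fun j =>
        (translationL2.act s).continuous.comp (weakDL m j).continuous }
  act_zero u := SobolevSpace.ext_weakD fun j => translationL2.act_zero _
  act_add s t u := SobolevSpace.ext_weakD fun j => translationL2.act_add s t _
  norm_act s u := by
    rw [← sq_eq_sq₀ (norm_nonneg _) (norm_nonneg _), SobolevSpace.norm_sq, SobolevSpace.norm_sq]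
    exact Finset.sum_congr rfl fun j _ => congrArg (· ^ 2) (translationL2.norm_act s _)
  continuous_act := SobolevSpace.continuous_iff.2 fun j =>
    translationL2.continuous_act.comp
      (continuous_fst.prodMk ((weakDL m j).continuous.comp continuous_snd))

@[simp]
lemma weakD_act {m : ℕ} (s : ℝ) (u : SobolevSpace m) (j : Fin (m + 1)) :
    weakD ((translation m).act s u) j = translationL2.act s (weakD u j) := rfl

lemma sobolevD_act (m n k : ℕ) (h : n + k ≤ m) (s : ℝ) (u : SobolevSpace m) :
    sobolevD m n k h ((translation m).act s u) = (translation n).act s (sobolevD m n k h u) := rfl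

/-! #### Generators -/

/-- `δ` acts as the derivative at `0` of the group `T`, on the image of `ι`. -/
structure IsGenerator {X Y : Type*} [NormedAddCommGroup X] [NormedSpace ℝ X]
    [NormedAddCommGroup Y] [NormedSpace ℝ Y] (T : IsometryGroup Y) (ι δ : X →L[ℝ] Y) : Prop where
  hasDerivAt : ∀ u s, HasDerivAt (fun s => T.act s (ι u)) (T.act s (δ u)) s

lemma IsometryGroup.continuous_act_left {X : Type*} [NormedAddCommGroup X] [NormedSpace ℝ X]
    (T : IsometryGroup X) (u : X) : Continuous fun s => T.act s u :=
  T.continuous_act.comp (by fun_prop : Continuous fun r : ℝ => (r, u))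

lemma IsometryGroup.hasDerivAt_of_eq_add_integral {X : Type*} [NormedAddCommGroup X]
    [NormedSpace ℝ X] [CompleteSpace X] (T : IsometryGroup X) {u v : X}
    (h : ∀ s, T.act s u = u + ∫ r in (0 : ℝ)..s, T.act r v) (s : ℝ) :
    HasDerivAt (fun s => T.act s u) (T.act s v) s := by
  have h1 := ((T.continuous_act_left v).integral_hasStrictDerivAt 0 s).hasDerivAt.const_add u
  exact h1.congr_of_eventuallyEq (Eventually.of_forall h)

lemma IsWeakDeriv.hasDerivAt_act {u v : RealL2} (h : IsWeakDeriv u v) (s : ℝ) :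
    HasDerivAt (fun s => translationL2.act s u) (translationL2.act s v) s :=
  translationL2.hasDerivAt_of_eq_add_integral h.act_eq_add_integral s

lemma isGenerator_weakDL (m : ℕ) (i : Fin m) :
    IsGenerator translationL2 (weakDL m i.castSucc) (weakDL m i.succ) :=
  ⟨fun u s => (isWeakDeriv_weakD u i).hasDerivAt_act s⟩

/-- For `k = 0` this is the pair of inclusion and derivative from `H²` to `H¹`: the curves `P` and
`Q` are continuous in `H²` but differentiated in `x` only after the loss of one derivative. -/
lemma isGenerator_sobolevD (m n k : ℕ) (h : n + (k + 1) ≤ m) :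
    IsGenerator (translation n) (sobolevD m n k (by omega)) (sobolevD m n (k + 1) h) := by
  refine ⟨fun u s => (translation n).hasDerivAt_of_eq_add_integral (fun s => ?_) s⟩
  refine SobolevSpace.ext_weakD fun j => ?_
  rw [weakD_act, ← weakDL_apply, ← weakDL_apply, map_add, ← (weakDL n j).intervalIntegral_comp_comm
    (((translation n).continuous_act_left _).intervalIntegrable _ _)]
  have h1 := isWeakDeriv_weakD u ⟨j + k, by omega⟩
  exact h1.act_eq_add_integral s

/-- A product rule for a group that is only strongly continuous. Split `u y` into `u x` and `u y - u
x`: the generator differentiates the orbit of the fixed vector, and joint continuity of the action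
handles the slopes of the remainder. -/
lemma IsGenerator.hasDerivAt_act_comp {X Y : Type*} [NormedAddCommGroup X] [NormedSpace ℝ X]
    [NormedAddCommGroup Y] [NormedSpace ℝ Y] {T : IsometryGroup Y} {ι δ : X →L[ℝ] Y}
    (h : IsGenerator T ι δ) {θ : ℝ → ℝ} {θ' x : ℝ} {u : ℝ → X} {u' : X}
    (hθ : HasDerivAt θ θ' x) (hu : HasDerivAt u u' x) :
    HasDerivAt (fun y => T.act (θ y) (ι (u y)))
      (θ' • T.act (θ x) (δ (u x)) + T.act (θ x) (ι u')) x := by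
  have h1 : HasDerivAt (fun y => T.act (θ y) (ι (u x))) (θ' • T.act (θ x) (δ (u x))) x :=
    (h.hasDerivAt (u x) (θ x)).scomp x hθ
  have h2 : HasDerivAt (fun y => T.act (θ y) (ι (u y - u x))) (T.act (θ x) (ι u')) x := by
    rw [hasDerivAt_iff_tendsto_slope] at hu ⊢
    have h3 : Tendsto (fun y => T.act (θ y) (ι (slope u x y))) (𝓝[≠] x)
        (𝓝 (T.act (θ x) (ι u'))) :=
      ((hθ.continuousAt.tendsto.mono_left nhdsWithin_le_nhds)).act
        ((ι.continuous.tendsto u').comp hu)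
    refine h3.congr fun y => ?_
    simp [slope, map_smul]
  refine (h1.add h2).congr_of_eventuallyEq (Eventually.of_forall fun y => ?_)
  simp [map_sub]

lemma IsGenerator.hasDerivAt_wact_comp {X Y : Type*} [NormedAddCommGroup X] [NormedSpace ℝ X]
    [NormedAddCommGroup Y] [NormedSpace ℝ Y] {T : IsometryGroup Y} {ι δ : X →L[ℝ] Y}
    (h : IsGenerator T ι δ) {c : ℝ} {θ : ℝ → ℝ} {θ' x : ℝ} {u : ℝ → X} {u' : X}
    (hθ : HasDerivAt θ θ' x) (hu : HasDerivAt u u' x) :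
    HasDerivAt (fun y => T.wact c (θ y) (ι (u y)))
      (θ' • T.wact c (θ x) (δ (u x) + c • ι (u x)) + T.wact c (θ x) (ι u')) x := by
  have h1 := ((hθ.const_mul c).exp).smul (h.hasDerivAt_act_comp hθ hu)
  refine h1.congr_deriv ?_
  simp only [IsometryGroup.wact_apply, map_add, map_smul, smul_add, smul_smul]
  module

/-! ### Continuous representatives of Sobolev functions -/

/-- The function `exp s` for `s ≤ 0`, extended by zero: the kernel of `(1 + ∂)⁻¹`. -/
def expKernel : ℝ → ℝ := (Iic 0).indicator Real.exp

lemma memLp_expKernel : MemLp expKernel 2 volume := by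
  have hmeas : AEStronglyMeasurable expKernel volume :=
    (Real.measurable_exp.indicator measurableSet_Iic).aestronglyMeasurable
  rw [memLp_two_iff_integrable_sq hmeas]
  have h1 : (fun s => expKernel s ^ 2) = (Iic 0).indicator fun s => Real.exp (2 * s) := by
    funext s
    simp only [expKernel, indicator]
    split_ifs
    · rw [← Real.exp_nat_mul]; norm_num
    · simp
  rw [h1, integrable_indicator_iff measurableSet_Iic]
  exact integrableOn_exp_mul_Iic (by norm_num) 0

def expKernelL2 : RealL2 := memLp_expKernel.toLp expKernel

/-- Evaluation at `ρ` of the continuous representative of `u ∈ H¹(ℝ)`. -/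
def evalL (ρ : ℝ) : SobolevSpace 1 →L[ℝ] ℝ :=
  -- From `u = (1 + ∂)⁻¹ (u + u')`, that is `u(ρ) = ∫ e^s (u + u')(ρ + s) ds` over `s ≤ 0`. This is
  -- an `L²` pairing, hence continuous in `u` and in `ρ`.
  (innerSL ℝ expKernelL2).comp ((translationL2.act ρ).comp (weakDL 1 0 + weakDL 1 1))

lemma evalL_apply (ρ : ℝ) (u : SobolevSpace 1) :
    evalL ρ u = inner ℝ expKernelL2 (translationL2.act ρ (weakD u 0 + weakD u 1)) := rfl

lemma continuous_evalL : Continuous fun p : ℝ × SobolevSpace 1 => evalL p.1 p.2 := by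
  refine (innerSL ℝ expKernelL2).continuous.comp (translationL2.continuous_act.comp
    (continuous_fst.prodMk ?_))
  exact (weakDL 1 0 + weakDL 1 1).continuous.comp continuous_snd

lemma norm_weakD_le {m : ℕ} (u : SobolevSpace m) (j : Fin (m + 1)) : ‖weakD u j‖ ≤ ‖u‖ :=
  PiLp.norm_apply_le u.1 j

lemma abs_evalL_le (ρ : ℝ) (u : SobolevSpace 1) : |evalL ρ u| ≤ 2 * ‖expKernelL2‖ * ‖u‖ := by
  rw [evalL_apply]
  refine (abs_real_inner_le_norm _ _).trans ?_
  rw [translationL2.norm_act, mul_comm 2, mul_assoc]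
  refine mul_le_mul_of_nonneg_left ((norm_add_le _ _).trans ?_) (norm_nonneg _)
  have h0 := norm_weakD_le u 0
  have h1 := norm_weakD_le u 1
  linarith

lemma hasDerivAt_evalL (u : SobolevSpace 2) (ρ : ℝ) :
    HasDerivAt (fun ρ => evalL ρ (sobolevD 2 1 0 (by norm_num) u))
      (evalL ρ (sobolevD 2 1 1 (by norm_num) u)) ρ := by
  have h := (isWeakDeriv_weakD u 0).add (isWeakDeriv_weakD u 1)
  exact ((innerSL ℝ expKernelL2).hasFDerivAt (x := translationL2.act ρ
    (weakD u (0 : Fin 2).castSucc + weakD u (1 : Fin 2).castSucc))).comp_hasDerivAt ρ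
    (h.hasDerivAt_act ρ)

lemma evalL_eq_integral (ρ : ℝ) (u : SobolevSpace 1) :
    evalL ρ u = ∫ s in Iic (0 : ℝ), Real.exp s * (weakD u 0 + weakD u 1 : RealL2) (ρ + s) := by
  rw [evalL_apply, expKernelL2, ← integral_mul_eq_inner, integral_act_mul,
    ← integral_add_right_eq_self _ ρ, ← integral_indicator measurableSet_Iic]
  refine integral_congr_ae (Eventually.of_forall fun s => ?_)
  simp only [add_sub_cancel_right, expKernel, indicator, add_comm ρ s]
  split_ifs
  · ring
  · simp

/-- Integrability for Fubini's theorem: `|η v| ≤ η² + v²`, and the shear `(s, r) ↦ (s, s + r)`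
preserves the product measure. -/
lemma integrable_exp_mul_shift (v : RealL2) {η : ℝ → ℝ} (hη : ContDiff ℝ ∞ η)
    (hc : HasCompactSupport η) :
    Integrable (fun z : ℝ × ℝ => Real.exp z.1 * (η z.2 * v (z.1 + z.2)))
      ((volume.restrict (Iic (0 : ℝ))).prod volume) := by
  have hexp : Integrable Real.exp (volume.restrict (Iic (0 : ℝ))) := integrableOn_exp_Iic 0
  have h1 : Integrable (fun z : ℝ × ℝ => Real.exp z.1 * η z.2 ^ 2)
      ((volume.restrict (Iic (0 : ℝ))).prod volume) :=
    hexp.mul_prod (memLp_test hη hc).integrable_sq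
  have h2 : Integrable (fun z : ℝ × ℝ => Real.exp z.1 * v z.2 ^ 2)
      ((volume.restrict (Iic (0 : ℝ))).prod volume) := hexp.mul_prod (Lp.memLp v).integrable_sq
  have h3 := (measurePreserving_prod_add (volume.restrict (Iic (0 : ℝ)))
    (volume : Measure ℝ)).integrable_comp_of_integrable h2
  refine (h1.add h3).mono' ?_ (Eventually.of_forall fun z => ?_)
  · have hv : Measurable v := (Lp.stronglyMeasurable v).measurable
    exact ((Real.measurable_exp.comp measurable_fst).mul ((hη.continuous.measurable.comp
      measurable_snd).mul (hv.comp (measurable_fst.add measurable_snd)))).aestronglyMeasurable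
  · simp only [Pi.add_apply, Function.comp, Real.norm_eq_abs, abs_mul, Real.abs_exp, ← mul_add]
    refine mul_le_mul_of_nonneg_left ?_ (Real.exp_nonneg _)
    nlinarith [sq_abs (η z.2), sq_abs (v (z.1 + z.2)), abs_nonneg (η z.2),
      abs_nonneg (v (z.1 + z.2)), sq_nonneg (|η z.2| - |v (z.1 + z.2)|)]

lemma inner_act_eq_integral (η : ℝ → ℝ) (hη : MemLp η 2 volume) (s : ℝ) (v : RealL2) :
    inner ℝ (hη.toLp η) (translationL2.act s v) = ∫ r, η r * v (s + r) := by
  rw [← integral_mul_eq_inner]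
  refine integral_congr_ae ?_
  filter_upwards [shiftL2_coeFn s v] with r hr
  change shiftL2 s v r * η r = _
  rw [hr, mul_comm, add_comm r s]

/-- `evalL · u` represents `u`. -/
lemma evalL_ae_eq (u : SobolevSpace 1) : (fun ρ => evalL ρ u) =ᵐ[volume] weakD u 0 := by
  set v : RealL2 := weakD u 0 + weakD u 1 with hv
  refine ae_eq_of_integral_contDiff_smul_eq ?_
    ((Lp.memLp (weakD u 0)).locallyIntegrable (by norm_num)) fun η hη hc => ?_
  · exact (continuous_evalL.comp (by fun_prop : Continuous fun ρ : ℝ => (ρ, u))).locallyIntegrable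
  have hF := integrable_exp_mul_shift v hη hc
  have h1 : ∫ ρ, η ρ • evalL ρ u
      = ∫ s in Iic (0 : ℝ), ∫ ρ, Real.exp s * (η ρ * v (s + ρ)) := by
    rw [integral_integral_swap hF]
    refine integral_congr_ae (Eventually.of_forall fun ρ => ?_)
    simp only [evalL_eq_integral, smul_eq_mul]
    rw [← integral_const_mul]
    refine integral_congr_ae (Eventually.of_forall fun s => ?_)
    simp only [← hv, add_comm ρ s]
    ring
  rw [h1]
  set e := (memLp_test hη hc).toLp η with he
  have h2 : ∀ s, ∫ ρ, Real.exp s * (η ρ * v (s + ρ))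
      = Real.exp s * inner ℝ e (translationL2.act s v) := fun s => by
    rw [integral_const_mul, he, inner_act_eq_integral]
  have hint : IntegrableOn (fun s => Real.exp s * (inner ℝ e (translationL2.act s v) : ℝ))
      (Iic 0) := by
    have := hF.integral_prod_left
    simp only [h2] at this
    exact this
  simp only [h2]
  -- After Fubini the integrand is the total derivative of `e^s ⟨η, T(s) u⟩`, which vanishes at
  -- `-∞`; only the boundary term at `s = 0` is left.
  have hder : ∀ s ∈ Iic (0 : ℝ), HasDerivAt
      (fun s => Real.exp s * (inner ℝ e (translationL2.act s (weakD u 0)) : ℝ))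
      (Real.exp s * inner ℝ e (translationL2.act s v)) s := by
    intro s _
    have h3 := ((innerSL ℝ e).hasFDerivAt (x := translationL2.act s (weakD u 0))).comp_hasDerivAt s
      ((isWeakDeriv_weakD u 0).hasDerivAt_act s)
    refine ((Real.hasDerivAt_exp s).mul h3).congr_deriv ?_
    rw [hv, map_add, inner_add_right, mul_add]
    rfl
  have hlim : Tendsto (fun s => Real.exp s * (inner ℝ e (translationL2.act s (weakD u 0)) : ℝ))
      atBot (𝓝 0) := by
    refine squeeze_zero_norm (a := fun s => Real.exp s * (‖e‖ * ‖weakD u 0‖)) (fun s => ?_) ?_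
    · rw [norm_mul, Real.norm_of_nonneg (Real.exp_nonneg s)]
      refine mul_le_mul_of_nonneg_left ((norm_inner_le_norm _ _).trans ?_) (Real.exp_nonneg _)
      rw [translationL2.norm_act]
    · simpa using Real.tendsto_exp_atBot.mul_const (‖e‖ * ‖weakD u 0‖)
  rw [integral_Iic_of_hasDerivAt_of_tendsto' hder hint hlim, translationL2.act_zero, Real.exp_zero,
    he, ← integral_mul_eq_inner]
  simp [mul_comm]

attribute [irreducible] evalL

/-! ### Second order equations in the sense of distributions -/

/-- A test function with prescribed second derivative on an interval. -/
lemma exists_test_deriv_deriv_eq {a b : ℝ} {ζ : ℝ → ℝ} (hζ : ContDiff ℝ ∞ ζ)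
    (hc : HasCompactSupport ζ) (hsupp : tsupport ζ ⊆ Ioo a b) :
    ∃ χ : ℝ → ℝ, ContDiff ℝ ∞ χ ∧ HasCompactSupport χ ∧ tsupport χ ⊆ Iio b ∧
      ∀ x, a ≤ x → deriv (deriv χ) x = ζ x := by
  obtain ⟨b', hb', hζb⟩ : ∃ b' < b, ∀ x, b' ≤ x → ζ x = 0 := by
    by_cases hne : (tsupport ζ).Nonempty
    · obtain ⟨m, hm, hmax⟩ := hc.exists_isMaxOn hne continuousOn_id
      have hmb := (hsupp hm).2
      refine ⟨(m + b) / 2, by linarith, fun x hx => ?_⟩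
      by_contra hx0
      have : x ≤ m := hmax (subset_tsupport ζ hx0)
      linarith
    · refine ⟨b - 1, by linarith, fun x _ => ?_⟩
      by_contra hx0
      exact hne ⟨x, subset_tsupport ζ hx0⟩
  have prim : ∀ g : ℝ → ℝ, ContDiff ℝ ∞ g → (∀ x, HasDerivAt (fun z => ∫ y in b'..z, g y) (g x) x)
      ∧ ContDiff ℝ ∞ fun z => ∫ y in b'..z, g y := by
    intro g hg
    have h1 : ∀ x, HasDerivAt (fun z => ∫ y in b'..z, g y) (g x) x := fun x =>
      (hg.continuous.integral_hasStrictDerivAt b' x).hasDerivAt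
    refine ⟨h1, contDiff_infty_iff_deriv.2 ⟨fun x => (h1 x).differentiableAt, ?_⟩⟩
    rwa [funext fun x => (h1 x).deriv]
  have vanish : ∀ g : ℝ → ℝ, (∀ x, b' ≤ x → g x = 0) → ∀ x, b' ≤ x → ∫ y in b'..x, g y = 0 := by
    intro g hg x hx
    refine (intervalIntegral.integral_congr fun y hy => ?_).trans intervalIntegral.integral_zero
    rw [uIcc_of_le hx] at hy
    exact hg y hy.1
  obtain ⟨d1, s1⟩ := prim ζ hζ
  obtain ⟨d2, s2⟩ := prim _ s1
  have v2 := vanish _ (vanish ζ hζb)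
  set Z₂ : ℝ → ℝ := fun z => ∫ y in b'..z, ∫ t in b'..y, ζ t with hZ₂
  -- The double primitive based at `b'` vanishes to the right of `b'`. The cutoff is `0` left of `a
  -- - 2` and `1` right of `a - 1`, so it makes the support compact and changes nothing near `[a,
  -- ∞)`.
  set χ : ℝ → ℝ := fun x => Real.smoothTransition (x - (a - 2)) * Z₂ x with hχ
  have hsub : Function.support χ ⊆ Icc (a - 2) b' := by
    intro x hx
    refine ⟨?_, ?_⟩
    · by_contra h
      exact hx (by simp [hχ, Real.smoothTransition.zero_of_nonpos (by linarith : x - (a - 2) ≤ 0)])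
    · by_contra h
      have hz : Z₂ x = 0 := v2 x (by linarith)
      exact hx (by simp [hχ, hz])
  refine ⟨χ, ?_, HasCompactSupport.of_support_subset_isCompact isCompact_Icc hsub, ?_, ?_⟩
  · exact (Real.smoothTransition.contDiff.comp (contDiff_id.sub contDiff_const)).mul s2
  · exact (closure_minimal hsub isClosed_Icc).trans fun x hx => hx.2.trans_lt hb'
  · intro x hx
    have e1 : ∀ y, a - 1 < y → χ =ᶠ[𝓝 y] Z₂ := fun y hy => by
      filter_upwards [lt_mem_nhds hy] with z hz
      simp [hχ, Real.smoothTransition.one_of_one_le (by linarith : 1 ≤ z - (a - 2))]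
    have e2 : deriv χ =ᶠ[𝓝 x] fun z => ∫ t in b'..z, ζ t := by
      filter_upwards [lt_mem_nhds (by linarith : a - 1 < x)] with y hy
      rw [(e1 y hy).deriv_eq]
      exact (d2 y).deriv
    rw [e2.deriv_eq]
    exact (d1 x).deriv

/-- Second order equation in the sense of distributions, with continuous coefficients. -/
lemma eq_integral_of_weak {E : Type*} [NormedAddCommGroup E] [NormedSpace ℝ E] [CompleteSpace E]
    {a b : ℝ} (hab : a < b) {U₀ U₁ U₂ : ℝ → E} (h₀ : Continuous U₀) (h₁ : Continuous U₁)
    (h₂ : Continuous U₂) {k₀ k₁ : E}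
    (h : ∀ χ : ℝ → ℝ, ContDiff ℝ ∞ χ → HasCompactSupport χ → tsupport χ ⊆ Iio b →
      ∫ x in a..b, (deriv (deriv χ) x • U₀ x + deriv χ x • U₁ x + χ x • U₂ x)
        = χ a • k₁ - deriv χ a • k₀) :
    ∀ x ∈ Icc a b, U₀ x = k₀ + ∫ y in a..x, (U₁ y + (k₁ - ∫ z in a..y, U₂ z)) := by
  -- Formally `U₀'' - U₁' + U₂ = 0`. Then `V = U₀' - U₁` satisfies `V' = -U₂`, and `Y` below is the
  -- classical solution with the same data. By the fundamental theorem `Y` fulfils the same weak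
  -- identity, so `U₀ - Y` is orthogonal to every `χ''`, and these exhaust the test functions on
  -- `(a, b)`.
  set V : ℝ → E := fun x => k₁ - ∫ z in a..x, U₂ z with hV
  have dV : ∀ x, HasDerivAt V (-U₂ x) x := fun x =>
    (h₂.integral_hasStrictDerivAt a x).hasDerivAt.const_sub k₁
  have cV : Continuous V := continuous_iff_continuousAt.2 fun x => (dV x).continuousAt
  set Y : ℝ → E := fun x => k₀ + ∫ y in a..x, (U₁ y + V y) with hY
  have dY : ∀ x, HasDerivAt Y (U₁ x + V x) x := fun x =>
    ((h₁.add cV).integral_hasStrictDerivAt a x).hasDerivAt.const_add k₀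
  have cY : Continuous Y := continuous_iff_continuousAt.2 fun x => (dY x).continuousAt
  have key : ∀ᵐ x, x ∈ Ioo a b → U₀ x - Y x = 0 := by
    refine isOpen_Ioo.ae_eq_zero_of_integral_contDiff_smul_eq_zero
      ((h₀.sub cY).locallyIntegrable.locallyIntegrableOn _) fun ζ hζ hcζ hsζ => ?_
    obtain ⟨χ, hχ, hcχ, hsχ, hχζ⟩ := exists_test_deriv_deriv_eq hζ hcζ hsζ
    have hχ' := contDiff_deriv_test hχ
    have hχ'' := contDiff_deriv_test hχ'
    have hd : ∀ x, HasDerivAt χ (deriv χ x) x := fun x =>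
      (hχ.differentiable (by simp) x).hasDerivAt
    have hd' : ∀ x, HasDerivAt (deriv χ) (deriv (deriv χ) x) x := fun x =>
      (hχ'.differentiable (by simp) x).hasDerivAt
    have hχb : χ b = 0 := image_eq_zero_of_notMem_tsupport fun hb => lt_irrefl b (hsχ hb)
    have hχb' : deriv χ b = 0 := by
      refine image_eq_zero_of_notMem_tsupport fun hb => lt_irrefl b (hsχ ?_)
      exact tsupport_deriv_subset hb
    have hc0 := hχ.continuous
    have hc1 := hχ'.continuous
    have hc2 := hχ''.continuous
    have hY0 : Y a = k₀ := by simp [hY]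
    have hV0 : V a = k₁ := by simp [hV]
    have hFTC := intervalIntegral.integral_eq_sub_of_hasDerivAt (a := a) (b := b)
      (f := fun x => deriv χ x • Y x - χ x • V x)
      (f' := fun x => deriv (deriv χ) x • Y x + deriv χ x • U₁ x + χ x • U₂ x)
      (fun x _ => (((hd' x).smul (dY x)).sub ((hd x).smul (dV x))).congr_deriv (by module))
      (Continuous.intervalIntegrable (by fun_prop) _ _)
    rw [hχb, hχb', hY0, hV0] at hFTC
    have h1 := h χ hχ hcχ hsχ
    have h2 : ∫ x in a..b, deriv (deriv χ) x • (U₀ x - Y x) = 0 := by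
      have e : ∀ x, deriv (deriv χ) x • (U₀ x - Y x)
          = (deriv (deriv χ) x • U₀ x + deriv χ x • U₁ x + χ x • U₂ x)
            - (deriv (deriv χ) x • Y x + deriv χ x • U₁ x + χ x • U₂ x) := fun x => by module
      simp only [e]
      rw [intervalIntegral.integral_sub (Continuous.intervalIntegrable (by fun_prop) _ _)
        (Continuous.intervalIntegrable (by fun_prop) _ _), h1, hFTC]
      module
    have h3 : ∫ x, ζ x • (U₀ x - Y x) = ∫ x in a..b, ζ x • (U₀ x - Y x) := by
      symm
      refine intervalIntegral.integral_eq_integral_of_support_subset fun x hx => ?_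
      have hx' : ζ x ≠ 0 := fun h0 => hx (by simp [h0])
      exact Ioo_subset_Ioc_self (hsζ (subset_tsupport ζ hx'))
    rw [h3, ← h2]
    refine intervalIntegral.integral_congr fun x hx => ?_
    rw [uIcc_of_le hab.le] at hx
    simp only [hχζ x hx.1]
  have heq : EqOn (fun x => U₀ x - Y x) 0 (Icc a b) := by
    refine Measure.eqOn_Icc_of_ae_eq volume hab.ne ?_ (h₀.sub cY).continuousOn continuousOn_const
    rw [← restrict_Ioo_eq_restrict_Icc]
    exact (ae_restrict_iff' measurableSet_Ioo).2 key
  exact fun x hx => sub_eq_zero.1 (heq hx)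

/-! ### Weak solutions of transport equations are mild solutions -/

lemma translationL2_act_toLp {η : ℝ → ℝ} (hη : ContDiff ℝ ∞ η) (hc : HasCompactSupport η) (s : ℝ) :
    translationL2.act (-s) ((memLp_test hη hc).toLp η)
      = (memLp_test (contDiff_shift hη s) (hasCompactSupport_shift hc s)).toLp _ := by
  refine Lp.ext ?_
  filter_upwards [shiftL2_coeFn (-s) ((memLp_test hη hc).toLp η),
    (memLp_test (contDiff_shift hη s) (hasCompactSupport_shift hc s)).coeFn_toLp,
    (measurePreserving_add_right (volume : Measure ℝ) (-s)).quasiMeasurePreserving.ae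
      (memLp_test hη hc).coeFn_toLp] with r h1 h2 h3
  change shiftL2 (-s) _ r = _
  rw [h1, h2, h3, sub_eq_add_neg]

lemma isWeakDeriv_toLp {η : ℝ → ℝ} (hη : ContDiff ℝ ∞ η) (hc : HasCompactSupport η) :
    IsWeakDeriv ((memLp_test hη hc).toLp η) ((memLp_deriv_test hη hc).toLp (deriv η)) := by
  intro θ hθ hcθ
  have e1 : ∀ {f g : ℝ → ℝ} (hf : MemLp f 2 volume), ∫ s, hf.toLp f s * g s = ∫ s, f s * g s := by
    intro f g hf
    refine integral_congr_ae ?_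
    filter_upwards [hf.coeFn_toLp] with s hs
    rw [hs]
  rw [e1, e1]
  have hη1 := contDiff_deriv_test hη
  have hθ1 := contDiff_deriv_test hθ
  exact integral_mul_deriv_eq_deriv_mul_of_integrable
    (fun x _ => (hη.differentiable (by simp) x).hasDerivAt)
    (fun x _ => (hθ.differentiable (by simp) x).hasDerivAt)
    ((hη.continuous.mul hθ1.continuous).integrable_of_hasCompactSupport hc.mul_right)
    ((hη1.continuous.mul hθ.continuous).integrable_of_hasCompactSupport hc.deriv.mul_right)
    ((hη.continuous.mul hθ.continuous).integrable_of_hasCompactSupport hc.mul_right)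

lemma inner_act_left (s : ℝ) (u v : RealL2) :
    (inner ℝ u (translationL2.act s v) : ℝ) = inner ℝ (translationL2.act (-s) u) v := by
  have h : inner ℝ (shiftL2 s (translationL2.act (-s) u)) (shiftL2 s v)
      = (inner ℝ (translationL2.act (-s) u) v : ℝ) := LinearIsometry.inner_map_map _ _ _
  rw [← h]
  change _ = (inner ℝ (translationL2.act s (translationL2.act (-s) u)) (translationL2.act s v) : ℝ)
  rw [← translationL2.act_add, add_neg_cancel, translationL2.act_zero]

/-- Weak solutions of `R_x = -σ' (∂ + c) R + F` satisfy Duhamel's formula. -/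
lemma wact_eq_add_integral_of_weak {a b c : ℝ} {σ σ' : ℝ → ℝ} {R F : ℝ → RealL2}
    (hσ : ∀ x ∈ Ico a b, HasDerivAt σ (σ' x) x) (hR : ContinuousOn R (Ico a b))
    (hF : ContinuousOn F (Ico a b))
    (h : ∀ (η : ℝ → ℝ) (hη : ContDiff ℝ ∞ η) (hc : HasCompactSupport η), ∀ x ∈ Ioo a b,
      HasDerivAt (fun y => (inner ℝ ((memLp_test hη hc).toLp η) (R y) : ℝ))
        (σ' x * (inner ℝ ((memLp_deriv_test hη hc).toLp (deriv η)) (R x)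
          - c * inner ℝ ((memLp_test hη hc).toLp η) (R x))
          + inner ℝ ((memLp_test hη hc).toLp η) (F x)) x) :
    ∀ x ∈ Ico a b, translationL2.wact c (σ x) (R x)
      = translationL2.wact c (σ a) (R a) + ∫ y in a..x, translationL2.wact c (σ y) (F y) := by
  have cσ : ContinuousOn σ (Ico a b) := fun x hx => (hσ x hx).continuousAt.continuousWithinAt
  intro x hx
  have hsub : Icc a x ⊆ Ico a b := fun y hy => ⟨hy.1, hy.2.trans_lt hx.2⟩
  have hint : ContinuousOn (fun y => translationL2.wact c (σ y) (F y)) (Icc a x) :=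
    (cσ.wact hF).mono hsub
  refine RealL2.ext_test fun η hη hc => ?_
  set e := (memLp_test hη hc).toLp η with he
  have hcomm := (innerSL ℝ e).intervalIntegral_comp_comm (μ := volume)
    (hint.intervalIntegrable_of_Icc hx.1)
  simp only [innerSL_apply_apply] at hcomm
  rw [inner_add_right, ← hcomm]
  have hFTC := intervalIntegral.integral_eq_sub_of_hasDerivAt_of_le hx.1
    (f := fun y => (inner ℝ e (translationL2.wact c (σ y) (R y)) : ℝ))
    (f' := fun y => (inner ℝ e (translationL2.wact c (σ y) (F y)) : ℝ))
    (continuousOn_const.inner ((cσ.wact hR).mono hsub)) (fun y hy => ?_)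
    ((continuousOn_const.inner hint).intervalIntegrable_of_Icc hx.1)
  · rw [hFTC]; ring
  have hy' : y ∈ Ioo a b := ⟨hy.1, hy.2.trans hx.2⟩
  have hyc : y ∈ Ico a b := ⟨hy.1.le, hy'.2⟩
  -- The weak equation needs a test function independent of `x`, so the translate is frozen at the
  -- shift `s = σ y`; the variation of the translate is a separate term.
  set s := σ y with hs
  have hη1 := contDiff_shift hη s
  have hc1 := hasCompactSupport_shift hc s
  have hRc : ContinuousAt R y := hR.continuousAt (Ico_mem_nhds hy'.1 hy'.2)
  have h1 := h _ hη1 hc1 y hy'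
  have hE := isWeakDeriv_toLp hη hc
  have h2 : HasDerivAt (fun z => translationL2.act (-σ z) e)
      (-σ' y • translationL2.act (-s) ((memLp_deriv_test hη hc).toLp (deriv η))) y :=
    HasDerivAt.scomp (g₁ := fun t => translationL2.act t e) (h := fun z => -σ z) y
      (hE.hasDerivAt_act (-s)) (hσ y hyc).fun_neg
  -- The curve `R` is only continuous in norm, but the left factor vanishes at `y`, so continuity of
  -- `R` suffices for a derivative of the pairing there.
  have h3 : HasDerivAt (fun z =>
      (inner ℝ (translationL2.act (-σ z) e - translationL2.act (-s) e) (R z) : ℝ))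
      (inner ℝ (-σ' y • translationL2.act (-s) ((memLp_deriv_test hη hc).toLp (deriv η)))
        (R y)) y := by
    rw [hasDerivAt_iff_tendsto_slope] at h2 ⊢
    refine (h2.inner (hRc.tendsto.mono_left nhdsWithin_le_nhds)).congr fun z => ?_
    simp only [slope, vsub_eq_sub, ← hs, sub_self, inner_zero_left, sub_zero, inner_smul_left,
      smul_eq_mul]
    simp
  have e1 : translationL2.act (-s) e = (memLp_test hη1 hc1).toLp _ :=
    translationL2_act_toLp hη hc s
  have e2 : translationL2.act (-s) ((memLp_deriv_test hη hc).toLp (deriv η))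
      = (memLp_deriv_test hη1 hc1).toLp (deriv fun r => η (r - s)) := by
    have := translationL2_act_toLp (contDiff_deriv_test hη) hc.deriv s
    simp only [deriv_shift]
    exact this
  have h4 := (((hσ y hyc).const_mul c).exp).mul (h1.add h3)
  have hwact : ∀ (s : ℝ) (v : RealL2), (inner ℝ e (translationL2.wact c s v) : ℝ)
      = Real.exp (c * s) * inner ℝ (translationL2.act (-s) e) v := by
    intro s v
    rw [translationL2.wact_apply, inner_smul_right, inner_act_left]
  refine (h4.congr_of_eventuallyEq (Eventually.of_forall fun z => ?_)).congr_deriv ?_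
  · rw [hwact, ← e1]
    simp only [Pi.mul_apply, Pi.add_apply]
    rw [inner_sub_left]
    ring
  · rw [hwact, e2, ← e1]
    simp only [Pi.add_apply, ← hs, sub_self, inner_zero_left, inner_smul_left, conj_trivial]
    ring

/-! ### Consequences of the assumptions on the background -/

namespace IsBackground

variable {G ψ : ℝ → ℝ} {xc : ℝ}

lemma analyticAt_G (h : IsBackground G ψ xc) {x : ℝ} (hx : x ≤ xc) : AnalyticAt ℝ G x :=
  h.analytic_G x hx

lemma hasDerivAt_G (h : IsBackground G ψ xc) {x : ℝ} (hx : x ≤ xc) :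
    HasDerivAt G (deriv G x) x := (h.analyticAt_G hx).differentiableAt.hasDerivAt

lemma continuousOn_G (h : IsBackground G ψ xc) : ContinuousOn G (Iic xc) :=
  h.analytic_G.continuousOn

lemma continuousOn_deriv_G (h : IsBackground G ψ xc) : ContinuousOn (deriv G) (Iic xc) :=
  h.analytic_G.deriv.continuousOn

lemma hasDerivAt_lapse (h : IsBackground G ψ xc) {x : ℝ} (hx : x ≤ xc) :
    HasDerivAt (fun x => 1 - x * G x) (-(G x + x * deriv G x)) x := by
  refine (((hasDerivAt_id x).mul (h.hasDerivAt_G hx)).const_sub 1).congr_deriv ?_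
  simp only [id]; ring

lemma continuousOn_lapse (h : IsBackground G ψ xc) : ContinuousOn (fun x => 1 - x * G x) (Iic xc) :=
  fun _ hx => (h.hasDerivAt_lapse hx).continuousAt.continuousWithinAt

/-- The lapse equals `1` at `x = 0`; a nonpositive value before `xc` would force a root of `xG = 1`
smaller than `xc`. -/
lemma lapse_pos (h : IsBackground G ψ xc) {x : ℝ} (hx : x ∈ Ioo 0 xc) : 0 < 1 - x * G x := by
  by_contra! hn
  have hivt := intermediate_value_Icc' hx.1.le (f := fun x => 1 - x * G x)
    (h.continuousOn_lapse.mono fun y hy => hy.2.trans hx.2.le)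
  obtain ⟨y, hy, hy0⟩ := hivt (show (0 : ℝ) ∈ Icc _ _ from ⟨hn, by simp⟩)
  have hy1 : y ≠ 0 := by rintro rfl; simp at hy0
  exact h.horizon_first y (lt_of_le_of_ne hy.1 hy1.symm) (hy.2.trans_lt hx.2)
    (by simp only at hy0; linarith)

lemma G_horizon (h : IsBackground G ψ xc) : G xc = xc⁻¹ :=
  eq_inv_of_mul_eq_one_right h.horizon_root

/-- Let `z` be the last point with `G ≤ 0`. Beyond `z` one has `G > 0`, so the null energy
conditions give `G' ≤ ψ' (1 - xG) G ≤ 0`, and therefore `G z ≥ G xc = 1 / xc > 0`, a contradiction.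
-/
lemma G_pos (h : IsBackground G ψ xc) {x : ℝ} (hx : x ∈ Ioc 0 xc) : 0 < G x := by
  have hxc := h.horizon_pos
  have hGc : 0 < G xc := by rw [h.G_horizon]; positivity
  by_contra! hn
  have hcont : ContinuousOn G (Icc x xc) := h.continuousOn_G.mono Icc_subset_Iic_self
  have hK : IsCompact (Icc x xc ∩ G ⁻¹' Iic 0) :=
    isCompact_Icc.of_isClosed_subset (hcont.preimage_isClosed_of_isClosed isClosed_Icc isClosed_Iic)
      inter_subset_left
  obtain ⟨z, ⟨hz, hz0⟩, hmax⟩ := hK.exists_isGreatest ⟨x, left_mem_Icc.2 hx.2, hn⟩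
  have hpos : ∀ y, z < y → y ≤ xc → 0 < G y := fun y hy hyc => by
    by_contra! hy0
    exact absurd (hmax ⟨⟨hz.1.trans hy.le, hyc⟩, hy0⟩) (not_le.2 hy)
  have hanti : AntitoneOn G (Icc z xc) := by
    refine antitoneOn_of_deriv_nonpos (convex_Icc z xc)
      (h.continuousOn_G.mono Icc_subset_Iic_self)
      (fun y hy => ?_) fun y hy => ?_
    · rw [interior_Icc] at hy
      exact (h.hasDerivAt_G hy.2.le).differentiableAt.differentiableWithinAt
    · rw [interior_Icc] at hy
      have hy0 : 0 < y := hx.1.trans_le (hz.1.trans hy.1.le)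
      have h1 := h.null_energy_two y hy.2.le
      have h2 := h.null_energy_one y hy.2.le
      have h3 := h.lapse_pos ⟨hy0, hy.2⟩
      have h4 := hpos y hy.1 hy.2.le
      have h5 : deriv ψ y ≤ 0 := by
        by_contra! h6
        have := mul_pos hy0 h6
        linarith
      have h7 := mul_nonpos_of_nonpos_of_nonneg h5 (mul_pos h3 h4).le
      linarith [mul_assoc (deriv ψ y) (1 - y * G y) (G y)]
  have := hanti (left_mem_Icc.2 hz.2) (right_mem_Icc.2 hz.2) hz.2
  have hz0' : G z ≤ 0 := hz0
  linarith

lemma analyticOnNhd_coeffA (h : IsBackground G ψ xc) : AnalyticOnNhd ℝ (coeffA G) (Iic xc) :=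
  (analyticOnNhd_const.mul analyticOnNhd_id).mul
    (analyticOnNhd_const.sub (analyticOnNhd_id.mul h.analytic_G))

lemma analyticOnNhd_coeffB (h : IsBackground G ψ xc) : AnalyticOnNhd ℝ (coeffB G) (Iic xc) :=
  analyticOnNhd_const.sub ((analyticOnNhd_const.mul analyticOnNhd_id).mul h.analytic_G)

lemma analyticOnNhd_coeffC (h : IsBackground G ψ xc) : AnalyticOnNhd ℝ (coeffC G) (Iic xc) :=
  analyticOnNhd_const.mul h.analytic_G

lemma analyticOnNhd_coeffX (h : IsBackground G ψ xc) (κ : ℝ) :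
    AnalyticOnNhd ℝ (coeffX G κ) (Iic xc) :=
  h.analyticOnNhd_coeffA.deriv.add (analyticOnNhd_const.mul h.analyticOnNhd_coeffB)

lemma analyticOnNhd_coeffR (h : IsBackground G ψ xc) (κ : ℝ) :
    AnalyticOnNhd ℝ (coeffR G κ) (Iic xc) :=
  h.analyticOnNhd_coeffB.deriv.add (analyticOnNhd_const.mul h.analyticOnNhd_coeffC)

lemma analyticOnNhd_coeffZ (h : IsBackground G ψ xc) (ℓ : ℕ) (κ : ℝ) :
    AnalyticOnNhd ℝ (coeffZ G ψ ℓ κ) (Iic xc) :=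
  ((analyticOnNhd_const.mul h.analyticOnNhd_coeffC).sub
    (analyticOnNhd_const.mul h.analyticOnNhd_coeffB.deriv)).sub
    (analyticOnNhd_const.mul h.analytic_psi.rexp)

lemma deriv_coeffB (h : IsBackground G ψ xc) {x : ℝ} (hx : x ≤ xc) :
    deriv (coeffB G) x = -2 * (G x + x * deriv G x) := by
  have h1 := ((((hasDerivAt_id x).const_mul 2).mul (h.hasDerivAt_G hx)).const_sub 1)
  refine HasDerivAt.deriv (h1.congr_deriv ?_)
  simp only [id]; ring

lemma deriv_coeffX (h : IsBackground G ψ xc) (κ : ℝ) {x : ℝ} (hx : x ≤ xc) :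
    deriv (coeffX G κ) x = deriv (deriv (coeffA G)) x + 2 * (1 - κ) * deriv (coeffB G) x :=
  (((h.analyticOnNhd_coeffA.deriv x hx).differentiableAt.hasDerivAt).add
    ((h.analyticOnNhd_coeffB x hx).differentiableAt.hasDerivAt.const_mul _)).deriv

lemma coeffA_ne_zero (h : IsBackground G ψ xc) {x : ℝ} (hx : x ∈ Ioo 0 xc) : coeffA G x ≠ 0 :=
  mul_ne_zero (mul_ne_zero (by norm_num) hx.1.ne') (h.lapse_pos hx).ne'

lemma continuousOn_dτ (h : IsBackground G ψ xc) :
    ContinuousOn (fun x => G x / (1 - x * G x)) (Ioo 0 xc) :=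
  (h.continuousOn_G.mono fun _ hy => hy.2.le).div (h.continuousOn_lapse.mono fun _ hy => hy.2.le)
    fun _ hy => (h.lapse_pos hy).ne'

/-- The characteristic system of the rescaled wave equation. -/
def charSystem (h : IsBackground G ψ xc) (ℓ : ℕ) {κ xi : ℝ} (hκ : κ < 1) (hxi : xi ∈ Ioo 0 xc) :
    CharSystem where
  a := xi
  b := xc
  c := 1 - κ
  τ x := ∫ y in xi..x, G y / (1 - y * G y)
  dτ x := G x / (1 - x * G x)
  W x := (ℓ : ℝ) * ((ℓ : ℝ) + 1) * Real.exp (ψ x) - 2 * x * deriv G x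
  a_pos := hxi.1
  a_lt_b := hxi.2
  c_pos := sub_pos.2 hκ
  hasDerivAt_τ _ hx := hasDerivAt_primitive h.continuousOn_dτ hxi hx
  continuousOn_dτ := h.continuousOn_dτ
  dτ_nonneg _ hx := div_nonneg (h.G_pos ⟨hxi.1.trans_le hx.1, hx.2.le⟩).le
    (h.lapse_pos ⟨hxi.1.trans_le hx.1, hx.2⟩).le
  τ_a := intervalIntegral.integral_same
  continuousOn_W := ((continuousOn_const.mul h.analytic_psi.rexp.continuousOn).sub
    ((continuousOn_const.mul continuousOn_id).mul h.continuousOn_deriv_G)).mono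
    Ioc_subset_Iic_self

end IsBackground

/-- The data `α φ̃_x + (β + 1) (∂ + 1 - κ) φ̃` of the ingoing characteristic field. -/
def inData (G : ℝ → ℝ) (κ xi : ℝ) (f : SobolevSpace 3) (g : SobolevSpace 2) : SobolevSpace 2 :=
  coeffA G xi • g + (coeffB G xi + 1) • (sobolevD 3 2 1 (by norm_num) f
    + (1 - κ) • sobolevD 3 2 0 (by norm_num) f)

/-- The data `α φ̃_x + (β - 1) (∂ + 1 - κ) φ̃` of the outgoing characteristic field. -/
def outData (G : ℝ → ℝ) (κ xi : ℝ) (f : SobolevSpace 3) (g : SobolevSpace 2) : SobolevSpace 2 :=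
  coeffA G xi • g + (coeffB G xi - 1) • (sobolevD 3 2 1 (by norm_num) f
    + (1 - κ) • sobolevD 3 2 0 (by norm_num) f)

/-! ### Solutions in the sense of distributions solve the characteristic system -/

/-- A solution curve, and its weak derivatives, as functions on the line. -/
def curveD {xi xc : ℝ} (h : xi ≤ xc) (Φ : C(Icc xi xc, SobolevSpace 3)) (j : Fin 4) (x : ℝ) :
    RealL2 := weakD (IccExtend h Φ x) j

lemma continuous_curveD {xi xc : ℝ} (h : xi ≤ xc) (Φ : C(Icc xi xc, SobolevSpace 3)) (j : Fin 4) :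
    Continuous (curveD h Φ j) := (weakDL 3 j).continuous.comp Φ.continuous.Icc_extend'

lemma isWeakDeriv_curveD {xi xc : ℝ} (h : xi ≤ xc) (Φ : C(Icc xi xc, SobolevSpace 3)) (i : Fin 3)
    (x : ℝ) : IsWeakDeriv (curveD h Φ i.castSucc x) (curveD h Φ i.succ x) :=
  isWeakDeriv_weakD (IccExtend h Φ x) i

lemma deriv_mul_test {A χ : ℝ → ℝ} {x : ℝ} (hA : AnalyticAt ℝ A x) (hχ : ContDiff ℝ ∞ χ) :
    deriv (fun s => A s * χ s) x = deriv A x * χ x + A x * deriv χ x :=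
  (hA.differentiableAt.hasDerivAt.mul (hχ.differentiable (by simp) x).hasDerivAt).deriv

lemma deriv_deriv_mul_test {A χ : ℝ → ℝ} {x : ℝ} (hA : AnalyticAt ℝ A x) (hχ : ContDiff ℝ ∞ χ) :
    iteratedDeriv 2 (fun s => A s * χ s) x
      = deriv (deriv A) x * χ x + 2 * deriv A x * deriv χ x + A x * deriv (deriv χ) x := by
  rw [iteratedDeriv_succ, iteratedDeriv_one]
  have h1 : deriv (fun s => A s * χ s) =ᶠ[𝓝 x] fun s => deriv A s * χ s + A s * deriv χ s := by
    filter_upwards [hA.eventually_analyticAt] with y hy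
    exact deriv_mul_test hy hχ
  rw [h1.deriv_eq]
  have hχ' := contDiff_deriv_test hχ
  have h2 := (hA.deriv.differentiableAt.hasDerivAt.mul
    (hχ.differentiable (by simp) x).hasDerivAt).add
    (hA.differentiableAt.hasDerivAt.mul (hχ'.differentiable (by simp) x).hasDerivAt)
  refine (h2.deriv).trans ?_
  ring

/-- The nearest point of the interval `[xi, xc]`. -/
def clamp (xi xc x : ℝ) : ℝ := max xi (min x xc)

lemma clamp_of_mem {xi xc x : ℝ} (hx : x ∈ Icc xi xc) : clamp xi xc x = x := by
  rw [clamp, min_eq_left hx.2, max_eq_right hx.1]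

/-- The coefficients are controlled only up to `xc`. Clamping the argument gives continuous
functions on the line, unchanged on `[xi, xc]`, so that primitives can be differentiated everywhere.
-/
lemma continuous_comp_clamp {xi xc : ℝ} (h : xi ≤ xc) {A : ℝ → ℝ} (hA : ContinuousOn A (Iic xc)) :
    Continuous fun x => A (clamp xi xc x) :=
  hA.comp_continuous (by unfold clamp; fun_prop) fun _ => max_le h (min_le_right _ _)

section

variable {G ψ : ℝ → ℝ} {xc : ℝ} (hbg : IsBackground G ψ xc) (ℓ : ℕ) {xi : ℝ} (hxi : xi ∈ Ioo 0 xc)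
  {κ : ℝ} {Φ : C(Icc xi xc, SobolevSpace 3)}

/-- The zeroth order part of the weak equation. -/
def weakSource (G ψ : ℝ → ℝ) (ℓ : ℕ) (κ : ℝ) (x : ℝ) (u₀ u₁ u₂ : RealL2) : RealL2 :=
  deriv (deriv (coeffA G)) x • u₀ - (2 * deriv (coeffB G) x) • u₁ + coeffC G x • u₂
    - deriv (coeffX G κ) x • u₀ + coeffR G κ x • u₁ + coeffZ G ψ ℓ κ x • u₀

/-- The boundary term of first order, at `x = xi`. -/
def weakData (G : ℝ → ℝ) (κ xi : ℝ) (f : SobolevSpace 3) (g : SobolevSpace 2) : RealL2 :=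
  coeffA G xi • weakD g 0 - deriv (coeffA G) xi • weakD f 0 + (2 * coeffB G xi) • weakD f 1
    + coeffX G κ xi • weakD f 0

/-- The source with clamped coefficients, a continuous curve on the whole line. -/
def sourceCurve (G ψ : ℝ → ℝ) (ℓ : ℕ) (κ : ℝ) {xi xc : ℝ} (h : xi ≤ xc)
    (Φ : C(Icc xi xc, SobolevSpace 3)) (x : ℝ) : RealL2 :=
  weakSource G ψ ℓ κ (clamp xi xc x) (curveD h Φ 0 x) (curveD h Φ 1 x) (curveD h Φ 2 x)

/-- The momentum `α φ̃_x + 2 β (∂ + 1 - κ) φ̃`, in integrated form. -/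
def momentum (G ψ : ℝ → ℝ) (ℓ : ℕ) (κ : ℝ) {xi xc : ℝ} (h : xi ≤ xc)
    (Φ : C(Icc xi xc, SobolevSpace 3)) (f : SobolevSpace 3) (g : SobolevSpace 2) (x : ℝ) : RealL2 :=
  weakData G κ xi f g - ∫ y in xi..x, sourceCurve G ψ ℓ κ h Φ y

/-- The first order part of the weak equation, with clamped coefficients. -/
def fluxCurve (G : ℝ → ℝ) (κ : ℝ) {xi xc : ℝ} (h : xi ≤ xc)
    (Φ : C(Icc xi xc, SobolevSpace 3)) (x : ℝ) : RealL2 :=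
  (2 * deriv (coeffA G) (clamp xi xc x) - coeffX G κ (clamp xi xc x)) • curveD h Φ 0 x
    - (2 * coeffB G (clamp xi xc x)) • curveD h Φ 1 x

variable {f : SobolevSpace 3} {g : SobolevSpace 2}

include hbg

lemma continuous_sourceCurve : Continuous (sourceCurve G ψ ℓ κ hxi.2.le Φ) := by
  have c0 := continuous_curveD hxi.2.le Φ 0
  have c1 := continuous_curveD hxi.2.le Φ 1
  have c2 := continuous_curveD hxi.2.le Φ 2
  have hA := continuous_comp_clamp hxi.2.le hbg.analyticOnNhd_coeffA.deriv.deriv.continuousOn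
  have hB := continuous_comp_clamp hxi.2.le hbg.analyticOnNhd_coeffB.deriv.continuousOn
  have hC := continuous_comp_clamp hxi.2.le hbg.analyticOnNhd_coeffC.continuousOn
  have hX := continuous_comp_clamp hxi.2.le (hbg.analyticOnNhd_coeffX κ).deriv.continuousOn
  have hR := continuous_comp_clamp hxi.2.le (hbg.analyticOnNhd_coeffR κ).continuousOn
  have hZ := continuous_comp_clamp hxi.2.le (hbg.analyticOnNhd_coeffZ ℓ κ).continuousOn
  unfold sourceCurve weakSource
  fun_prop

lemma continuous_fluxCurve : Continuous (fluxCurve G κ hxi.2.le Φ) := by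
  have c0 := continuous_curveD hxi.2.le Φ 0
  have c1 := continuous_curveD hxi.2.le Φ 1
  have hA := continuous_comp_clamp hxi.2.le hbg.analyticOnNhd_coeffA.deriv.continuousOn
  have hB := continuous_comp_clamp hxi.2.le hbg.analyticOnNhd_coeffB.continuousOn
  have hX := continuous_comp_clamp hxi.2.le (hbg.analyticOnNhd_coeffX κ).continuousOn
  unfold fluxCurve
  fun_prop

lemma hasDerivAt_momentum (x : ℝ) : HasDerivAt (momentum G ψ ℓ κ hxi.2.le Φ f g)
    (-sourceCurve G ψ ℓ κ hxi.2.le Φ x) x :=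
  ((continuous_sourceCurve hbg ℓ hxi).integral_hasStrictDerivAt xi x).hasDerivAt.const_sub _

lemma continuous_momentum : Continuous (momentum G ψ ℓ κ hxi.2.le Φ f g) :=
  continuous_iff_continuousAt.2 fun x => (hasDerivAt_momentum hbg ℓ hxi x).continuousAt

/-- Leibniz' rule, sorted by derivatives of `χ`, gives the form required by `eq_integral_of_weak`.
-/
lemma weak_integrand_eq {χ : ℝ → ℝ} (hχ : ContDiff ℝ ∞ χ) {y : ℝ} (hy : y ∈ Icc xi xc) :
    iteratedDeriv 2 (fun s => coeffA G s * χ s) y • weakD (IccExtend hxi.2.le Φ y) 0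
        - (2 * deriv (fun s => coeffB G s * χ s) y) • weakD (IccExtend hxi.2.le Φ y) 1
        + (coeffC G y * χ y) • weakD (IccExtend hxi.2.le Φ y) 2
        - deriv (fun s => coeffX G κ s * χ s) y • weakD (IccExtend hxi.2.le Φ y) 0
        + (coeffR G κ y * χ y) • weakD (IccExtend hxi.2.le Φ y) 1
        + (coeffZ G ψ ℓ κ y * χ y) • weakD (IccExtend hxi.2.le Φ y) 0
      = deriv (deriv χ) y • (coeffA G (clamp xi xc y) • curveD hxi.2.le Φ 0 y)
        + deriv χ y • fluxCurve G κ hxi.2.le Φ y + χ y • sourceCurve G ψ ℓ κ hxi.2.le Φ y := by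
  simp only [fluxCurve, sourceCurve, weakSource, clamp_of_mem hy]
  rw [deriv_mul_test (hbg.analyticOnNhd_coeffB y hy.2) hχ,
    deriv_mul_test (hbg.analyticOnNhd_coeffX κ y hy.2) hχ,
    deriv_deriv_mul_test (hbg.analyticOnNhd_coeffA y hy.2) hχ]
  simp only [curveD]
  module

lemma IsSolution.eq_integral (hΦ : IsSolution G ψ ℓ κ hxi.2.le Φ f g) {x : ℝ}
    (hx : x ∈ Icc xi xc) :
    coeffA G x • curveD hxi.2.le Φ 0 x = coeffA G xi • weakD f 0
      + ∫ y in xi..x, (fluxCurve G κ hxi.2.le Φ y + momentum G ψ ℓ κ hxi.2.le Φ f g y) := by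
  have c0 := continuous_curveD hxi.2.le Φ 0
  have hA := continuous_comp_clamp hxi.2.le hbg.analyticOnNhd_coeffA.continuousOn
  have key := eq_integral_of_weak hxi.2
    (U₀ := fun x => coeffA G (clamp xi xc x) • curveD hxi.2.le Φ 0 x) (hA.smul c0)
    (continuous_fluxCurve hbg hxi (κ := κ) (Φ := Φ)) (continuous_sourceCurve hbg ℓ hxi (κ := κ) (Φ := Φ))
    (k₀ := coeffA G xi • weakD f 0) (k₁ := weakData G κ xi f g) (fun χ hχ hcχ hsχ => ?_) x hx
  · rw [clamp_of_mem hx] at key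
    exact key
  have h1 := hΦ χ hχ hcχ hsχ
  have hxi' : xi ≤ xc := hxi.2.le
  rw [deriv_mul_test (hbg.analyticOnNhd_coeffA xi hxi') hχ] at h1
  have h2 : χ xi • weakData G κ xi f g - deriv χ xi • coeffA G xi • weakD f 0
      = (coeffA G xi * χ xi) • weakD g 0
        - (deriv (coeffA G) xi * χ xi + coeffA G xi * deriv χ xi) • weakD f 0
        + (2 * coeffB G xi * χ xi) • weakD f 1
        + (coeffX G κ xi * χ xi) • weakD f 0 := by
    unfold weakData
    module
  rw [h2, ← h1]
  refine intervalIntegral.integral_congr fun y hy => ?_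
  rw [uIcc_of_le hxi.2.le] at hy
  exact (weak_integrand_eq hbg ℓ hxi hχ hy).symm

/-- The integrated equation at `xi` has no integral term, and `α(xi) ≠ 0`. -/
lemma IsSolution.initial (hΦ : IsSolution G ψ ℓ κ hxi.2.le Φ f g) :
    curveD hxi.2.le Φ 0 xi = weakD f 0 := by
  have h := hΦ.eq_integral hbg ℓ hxi (left_mem_Icc.2 hxi.2.le)
  rw [intervalIntegral.integral_same, add_zero] at h
  exact smul_right_injective _ (hbg.coeffA_ne_zero hxi) h

lemma IsSolution.initial_one (hΦ : IsSolution G ψ ℓ κ hxi.2.le Φ f g) :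
    curveD hxi.2.le Φ 1 xi = weakD f 1 := by
  have h1 := isWeakDeriv_curveD hxi.2.le Φ 0 xi
  have h2 : curveD hxi.2.le Φ (0 : Fin 3).castSucc xi = weakD f (0 : Fin 3).castSucc :=
    hΦ.initial hbg ℓ hxi
  rw [h2] at h1
  exact h1.unique (isWeakDeriv_weakD f 0)

/-- The `x`-derivative of a solution in terms of its momentum. -/
def velocityCurve (G ψ : ℝ → ℝ) (ℓ : ℕ) (κ : ℝ) {xi xc : ℝ} (h : xi ≤ xc)
    (Φ : C(Icc xi xc, SobolevSpace 3)) (f : SobolevSpace 3) (g : SobolevSpace 2) (x : ℝ) : RealL2 :=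
  (coeffA G x)⁻¹ • (momentum G ψ ℓ κ h Φ f g x
    - (2 * coeffB G x) • (curveD h Φ 1 x + (1 - κ) • curveD h Φ 0 x))

/-- The integrated equation can be divided by `α` before the horizon; this yields differentiability
in the norm of `L²`, although the equation was only assumed in the sense of distributions. -/
lemma IsSolution.hasDerivAt (hΦ : IsSolution G ψ ℓ κ hxi.2.le Φ f g) {x : ℝ}
    (hx : x ∈ Ioo xi xc) : HasDerivAt (curveD hxi.2.le Φ 0)
      (velocityCurve G ψ ℓ κ hxi.2.le Φ f g x) x := by
  have hx0 : x ∈ Ioo 0 xc := ⟨hxi.1.trans hx.1, hx.2⟩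
  have hA0 := hbg.coeffA_ne_zero hx0
  have hA := (hbg.analyticOnNhd_coeffA x hx.2.le).differentiableAt.hasDerivAt
  have hY : HasDerivAt (fun x => coeffA G xi • weakD f 0
      + ∫ y in xi..x, (fluxCurve G κ hxi.2.le Φ y + momentum G ψ ℓ κ hxi.2.le Φ f g y))
      (fluxCurve G κ hxi.2.le Φ x + momentum G ψ ℓ κ hxi.2.le Φ f g x) x :=
    ((((continuous_fluxCurve hbg hxi).add (continuous_momentum hbg ℓ hxi)).integral_hasStrictDerivAt
      xi x).hasDerivAt).const_add _
  have h1 := (hA.inv hA0).smul hY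
  refine (h1.congr_of_eventuallyEq ?_).congr_deriv ?_
  · filter_upwards [Ioo_mem_nhds hx.1 hx.2] with y hy
    have hy0 := hbg.coeffA_ne_zero ⟨hxi.1.trans hy.1, hy.2⟩
    simp only [Pi.smul_apply', Pi.inv_apply]
    rw [← hΦ.eq_integral hbg ℓ hxi (Ioo_subset_Icc_self hy), inv_smul_smul₀ hy0]
  · rw [← hΦ.eq_integral hbg ℓ hxi (Ioo_subset_Icc_self hx)]
    simp only [fluxCurve, clamp_of_mem (Ioo_subset_Icc_self hx), velocityCurve, coeffX,
      Pi.inv_apply]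
    match_scalars <;> field_simp
    ring

end

/-! ### The characteristic fields of a distributional solution -/

section

variable {G ψ : ℝ → ℝ} {xc : ℝ} (hbg : IsBackground G ψ xc) (ℓ : ℕ) {xi : ℝ} (hxi : xi ∈ Ioo 0 xc)
  {κ : ℝ} {Φ : C(Icc xi xc, SobolevSpace 3)} {f : SobolevSpace 3} {g : SobolevSpace 2}

/-- The characteristic fields of a solution: `s = 1` gives the ingoing, `s = -1` the outgoing
one. -/
def charCurve (G ψ : ℝ → ℝ) (ℓ : ℕ) (κ s : ℝ) {xi xc : ℝ} (h : xi ≤ xc)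
    (Φ : C(Icc xi xc, SobolevSpace 3)) (f : SobolevSpace 3) (g : SobolevSpace 2) (x : ℝ) : RealL2 :=
  momentum G ψ ℓ κ h Φ f g x
    - (coeffB G x - s) • (curveD h Φ 1 x + (1 - κ) • curveD h Φ 0 x)

include hbg

lemma continuousOn_charCurve (s : ℝ) :
    ContinuousOn (charCurve G ψ ℓ κ s hxi.2.le Φ f g) (Ico xi xc) := by
  have c0 := continuous_curveD hxi.2.le Φ 0
  have c1 := continuous_curveD hxi.2.le Φ 1
  refine (continuous_momentum hbg ℓ hxi).continuousOn.sub (ContinuousOn.smul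
    ((hbg.analyticOnNhd_coeffB.continuousOn.mono ?_).sub continuousOn_const)
    (by fun_prop : Continuous fun x =>
      curveD hxi.2.le Φ 1 x + (1 - κ) • curveD hxi.2.le Φ 0 x).continuousOn)
  exact fun y hy => hy.2.le

/-- The identity `αγ = β² - s²` factors the principal part, and `(β - s) / α` is the speed of the
field. All `ρ`-derivatives beyond those available in `L²` are moved to `η`; the lower order terms
assemble to `∂ + 1 - κ` and leave only the source `W φ̃`. -/
lemma hasDerivAt_inner_charCurve (hΦ : IsSolution G ψ ℓ κ hxi.2.le Φ f g) {s : ℝ}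
    (hs : s ^ 2 = 1) (η : ℝ → ℝ) (hη : ContDiff ℝ ∞ η) (hc : HasCompactSupport η) {x : ℝ}
    (hx : x ∈ Ioo xi xc) :
    HasDerivAt (fun y => (inner ℝ ((memLp_test hη hc).toLp η)
        (charCurve G ψ ℓ κ s hxi.2.le Φ f g y) : ℝ))
      ((coeffB G x - s) / coeffA G x
        * (inner ℝ ((memLp_deriv_test hη hc).toLp (deriv η)) (charCurve G ψ ℓ κ s hxi.2.le Φ f g x)
          - (1 - κ) * inner ℝ ((memLp_test hη hc).toLp η) (charCurve G ψ ℓ κ s hxi.2.le Φ f g x))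
        + inner ℝ ((memLp_test hη hc).toLp η)
          (((ℓ : ℝ) * ((ℓ : ℝ) + 1) * Real.exp (ψ x) - 2 * x * deriv G x)
            • curveD hxi.2.le Φ 0 x)) x := by
  have hx0 : x ∈ Ioo 0 xc := ⟨hxi.1.trans hx.1, hx.2⟩
  have hA0 := hbg.coeffA_ne_zero hx0
  set e := (memLp_test hη hc).toLp η with he
  set e' := (memLp_deriv_test hη hc).toLp (deriv η) with he'
  set u₀ := curveD hxi.2.le Φ 0 with hu₀
  set u₁ := curveD hxi.2.le Φ 1 with hu₁
  set u₂ := curveD hxi.2.le Φ 2 with hu₂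
  set V := momentum G ψ ℓ κ hxi.2.le Φ f g with hV
  set w := velocityCurve G ψ ℓ κ hxi.2.le Φ f g x with hw
  have w1 : ∀ y, (inner ℝ e (u₁ y) : ℝ) = -inner ℝ e' (u₀ y) := fun y => by
    have := isWeakDeriv_iff_inner.1 (isWeakDeriv_curveD hxi.2.le Φ 0 y) η hη hc
    exact (neg_eq_iff_eq_neg.2 this).symm
  have w2 : ∀ y, (inner ℝ e' (u₁ y) : ℝ) = -inner ℝ e (u₂ y) := fun y =>
    isWeakDeriv_iff_inner.1 (isWeakDeriv_curveD hxi.2.le Φ 1 y) η hη hc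
  have dinner : ∀ (e : RealL2) {p : ℝ → RealL2} {p' : RealL2}, HasDerivAt p p' x →
      HasDerivAt (fun y => (inner ℝ e (p y) : ℝ)) (inner ℝ e p') x := fun e p p' hp =>
    ((innerSL ℝ e).hasFDerivAt (x := p x)).comp_hasDerivAt x hp
  have du : HasDerivAt u₀ w x := hΦ.hasDerivAt hbg ℓ hxi hx
  have dV : HasDerivAt V _ x := hasDerivAt_momentum hbg ℓ hxi x
  have dB := (hbg.analyticOnNhd_coeffB x hx.2.le).differentiableAt.hasDerivAt
  have h1 := (dinner e dV).sub ((dB.sub_const s).mul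
    ((dinner e' du).neg.add ((dinner e du).const_mul (1 - κ))))
  have expand : ∀ (e : RealL2) (y : ℝ), (inner ℝ e (charCurve G ψ ℓ κ s hxi.2.le Φ f g y) : ℝ)
      = inner ℝ e (V y) - (coeffB G y - s) * (inner ℝ e (u₁ y) + (1 - κ) * inner ℝ e (u₀ y)) := by
    intro e y
    rw [charCurve, inner_sub_right, inner_smul_right, inner_add_right, inner_smul_right]
  refine (h1.congr_of_eventuallyEq (Eventually.of_forall fun y => ?_)).congr_deriv ?_
  · simp only [expand, w1]
    rfl
  have hwi : ∀ e : RealL2, (inner ℝ e w : ℝ) = (coeffA G x)⁻¹ * (inner ℝ e (V x)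
      - 2 * coeffB G x * (inner ℝ e (u₁ x) + (1 - κ) * inner ℝ e (u₀ x))) := by
    intro e
    rw [hw, velocityCurve, inner_smul_right, inner_sub_right, inner_smul_right, inner_add_right,
      inner_smul_right]
  have hsrc : (inner ℝ e (sourceCurve G ψ ℓ κ hxi.2.le Φ x) : ℝ)
      = deriv (deriv (coeffA G)) x * inner ℝ e (u₀ x) - 2 * deriv (coeffB G) x * inner ℝ e (u₁ x)
        + coeffC G x * inner ℝ e (u₂ x) - deriv (coeffX G κ) x * inner ℝ e (u₀ x)
        + coeffR G κ x * inner ℝ e (u₁ x) + coeffZ G ψ ℓ κ x * inner ℝ e (u₀ x) := by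
    simp only [sourceCurve, weakSource, clamp_of_mem (Ioo_subset_Icc_self hx), inner_add_right,
      inner_sub_right, inner_smul_right, hu₀, hu₁, hu₂]
  simp only [inner_neg_right, hsrc, expand, hwi, w1, w2, inner_smul_right,
    hbg.deriv_coeffX κ hx.2.le, coeffR, coeffZ, hbg.deriv_coeffB hx.2.le, Pi.add_apply,
    Pi.neg_apply]
  have hAB : coeffA G x * coeffC G x = coeffB G x ^ 2 - s ^ 2 := by
    rw [hs]; simp only [coeffA, coeffB, coeffC]; ring
  have hC : coeffC G x = (coeffB G x ^ 2 - s ^ 2) / coeffA G x := by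
    rw [← hAB]; field_simp
  have hG : 2 * G x = coeffC G x := rfl
  generalize coeffA G x = A at *
  generalize hBv : coeffB G x = B at *
  generalize coeffC G x = C at *
  have hG' : G x = C / 2 := by linarith
  rw [hG', hC]
  field_simp
  ring

lemma charCurve_initial (hΦ : IsSolution G ψ ℓ κ hxi.2.le Φ f g) (s : ℝ) :
    charCurve G ψ ℓ κ s hxi.2.le Φ f g xi = coeffA G xi • weakD g 0
      + (coeffB G xi + s) • (weakD f 1 + (1 - κ) • weakD f 0) := by
  rw [charCurve, hΦ.initial hbg ℓ hxi, hΦ.initial_one hbg ℓ hxi, momentum,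
    intervalIntegral.integral_same, weakData, coeffX]
  module

/-- Duhamel's formula `wact_eq_add_integral_of_weak` applies with parameter `τ`, because `(β - 1) /
α = τ'`. For the outgoing field the parameter is `-log (x / xi)`, because `(β + 1) / α = -1 / x`. -/
lemma ingoing_eq_charCurve (hΦ : IsSolution G ψ ℓ κ hxi.2.le Φ f g) (hκ : κ < 1) {x : ℝ}
    (hx : x ∈ Ico xi xc) :
    (hbg.charSystem ℓ hκ hxi).ingoing translationL2 (weakDL 2 0 (inData G κ xi f g))
      (curveD hxi.2.le Φ 0) x = charCurve G ψ ℓ κ 1 hxi.2.le Φ f g x := by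
  set D := hbg.charSystem ℓ hκ hxi with hD
  have h0 : ∀ y ∈ Ico xi xc, y ∈ Ioo 0 xc := fun y hy => ⟨hxi.1.trans_le hy.1, hy.2⟩
  have hF : ContinuousOn (fun y => D.W y • curveD hxi.2.le Φ 0 y) (Ico xi xc) :=
    (D.continuousOn_W.mono fun y hy => Ioo_subset_Ioc_self (h0 y hy)).smul
      (continuous_curveD hxi.2.le Φ 0).continuousOn
  have key := wact_eq_add_integral_of_weak (c := 1 - κ) (σ := D.τ) (σ' := D.dτ)
    (fun y hy => D.hasDerivAt_τ y (h0 y hy))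
    (continuousOn_charCurve hbg ℓ hxi 1 (f := f) (g := g) (κ := κ) (Φ := Φ)) hF
    (fun η hη hc y hy => ?_) x hx
  · have e : weakDL 2 0 (inData G κ xi f g) = charCurve G ψ ℓ κ 1 hxi.2.le Φ f g xi :=
      (charCurve_initial hbg ℓ hxi hΦ 1).symm
    have eτ : D.τ xi = 0 := D.τ_a
    rw [eτ, translationL2.wact_zero] at key
    have : D.inSource translationL2 (curveD hxi.2.le Φ 0) x
        = ∫ y in xi..x, translationL2.wact (1 - κ) (D.τ y) (D.W y • curveD hxi.2.le Φ 0 y) := rfl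
    rw [CharSystem.ingoing, e, this, ← key]
    exact translationL2.wact_neg_cancel _ _ _
  · refine (hasDerivAt_inner_charCurve hbg ℓ hxi hΦ (s := 1) (by norm_num) η hη hc hy).congr_deriv ?_
    have e : (coeffB G y - 1) / coeffA G y = D.dτ y := by
      have hy0 := h0 y ⟨hy.1.le, hy.2⟩
      have h1 := (hbg.lapse_pos hy0).ne'
      have h2 := hy0.1.ne'
      change _ = G y / (1 - y * G y)
      simp only [coeffA, coeffB]
      field_simp
      ring
    rw [e]
    rfl

lemma outgoing_eq_charCurve (hΦ : IsSolution G ψ ℓ κ hxi.2.le Φ f g) (hκ : κ < 1) {x : ℝ}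
    (hx : x ∈ Ico xi xc) :
    (hbg.charSystem ℓ hκ hxi).outgoing translationL2 (weakDL 2 0 (outData G κ xi f g))
      (curveD hxi.2.le Φ 0) x = charCurve G ψ ℓ κ (-1) hxi.2.le Φ f g x := by
  set D := hbg.charSystem ℓ hκ hxi with hD
  have h0 : ∀ y ∈ Ico xi xc, y ∈ Ioo 0 xc := fun y hy => ⟨hxi.1.trans_le hy.1, hy.2⟩
  have hF : ContinuousOn (fun y => D.W y • curveD hxi.2.le Φ 0 y) (Ico xi xc) :=
    (D.continuousOn_W.mono fun y hy => Ioo_subset_Ioc_self (h0 y hy)).smul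
      (continuous_curveD hxi.2.le Φ 0).continuousOn
  have key := wact_eq_add_integral_of_weak (c := 1 - κ) (σ := fun y => -D.lam y)
    (σ' := fun y => -y⁻¹) (fun y hy => (CharSystem.hasDerivAt_lam (h0 y hy).1).fun_neg)
    (continuousOn_charCurve hbg ℓ hxi (-1) (f := f) (g := g) (κ := κ) (Φ := Φ)) hF
    (fun η hη hc y hy => ?_) x hx
  · have e : weakDL 2 0 (outData G κ xi f g) = charCurve G ψ ℓ κ (-1) hxi.2.le Φ f g xi :=
      (charCurve_initial hbg ℓ hxi hΦ (-1)).symm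
    have el : D.lam xi = 0 := CharSystem.lam_a
    rw [el, neg_zero, translationL2.wact_zero] at key
    have : D.outSource translationL2 (curveD hxi.2.le Φ 0) x
        = ∫ y in xi..x, translationL2.wact (1 - κ) (-D.lam y) (D.W y • curveD hxi.2.le Φ 0 y) := rfl
    rw [CharSystem.outgoing, e, this, ← key]
    exact translationL2.wact_cancel_neg _ _ _
  · refine (hasDerivAt_inner_charCurve hbg ℓ hxi hΦ (s := -1) (by norm_num) η hη hc hy).congr_deriv
      ?_
    have e : (coeffB G y - -1) / coeffA G y = -y⁻¹ := by
      have hy0 := h0 y ⟨hy.1.le, hy.2⟩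
      have h1 := (hbg.lapse_pos hy0).ne'
      have h2 := hy0.1.ne'
      simp only [coeffA, coeffB]
      field_simp
      ring
    rw [e]
    rfl

/-- A solution in the sense of distributions solves the characteristic system in `L²(ℝ)`. -/
lemma IsSolution.field_eq (hΦ : IsSolution G ψ ℓ κ hxi.2.le Φ f g) (hκ : κ < 1) {x : ℝ}
    (hx : x ∈ Icc xi xc) :
    (hbg.charSystem ℓ hκ hxi).field translationL2 (weakDL 2 0 (inData G κ xi f g))
      (weakDL 2 0 (outData G κ xi f g)) (weakD f 0) (curveD hxi.2.le Φ 0) x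
      = curveD hxi.2.le Φ 0 x := by
  set D := hbg.charSystem ℓ hκ hxi with hD
  have cu := continuous_curveD hxi.2.le Φ 0
  -- The derivative exists only before the horizon; continuity of `Φ` at `xc` and integrability of
  -- the velocity, from the a priori estimate, carry the identity to `x = xc`.
  have hFTC := intervalIntegral.integral_eq_sub_of_hasDerivAt_of_le hx.1
    (f := curveD hxi.2.le Φ 0)
    (f' := D.velocity translationL2 (weakDL 2 0 (inData G κ xi f g))
      (weakDL 2 0 (outData G κ xi f g)) (curveD hxi.2.le Φ 0)) cu.continuousOn (fun y hy => ?_)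
    (CharSystem.intervalIntegrable_velocity (D := D) cu hx)
  · rw [hΦ.initial hbg ℓ hxi] at hFTC
    change weakD f 0 + ∫ y in xi..x, _ = _
    rw [hFTC]
    abel
  · have hy' : y ∈ Ioo xi xc := ⟨hy.1, hy.2.trans_le hx.2⟩
    refine (hΦ.hasDerivAt hbg ℓ hxi hy').congr_deriv ?_
    rw [CharSystem.velocity, ingoing_eq_charCurve hbg ℓ hxi hΦ hκ (Ioo_subset_Ico_self hy'),
      outgoing_eq_charCurve hbg ℓ hxi hΦ hκ (Ioo_subset_Ico_self hy'), velocityCurve, charCurve,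
      charCurve]
    have hy0 : y ∈ Ioo 0 xc := ⟨hxi.1.trans hy'.1, hy'.2⟩
    have h1 := (hbg.lapse_pos hy0).ne'
    have h2 := hy0.1.ne'
    change _ = (-(1 / 2) : ℝ) • ((G y / (1 - y * G y)) • _ + _)
    simp only [coeffA, coeffB]
    match_scalars <;> field_simp <;> ring

end

namespace CharSystem

/-! ### Differentiability of mild solutions -/

section Initial

variable {D : CharSystem} {X : Type*} [NormedAddCommGroup X] [NormedSpace ℝ X]
  {T : IsometryGroup X} {P₀ Q₀ f : X} {φ : ℝ → X}

lemma ingoing_a : D.ingoing T P₀ φ D.a = P₀ := by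
  simp [ingoing, inSource, D.τ_a, T.wact_zero]

lemma outgoing_a : D.outgoing T Q₀ φ D.a = Q₀ := by
  simp [outgoing, outSource, lam_a, T.wact_zero]

lemma field_a : D.field T P₀ Q₀ f φ D.a = f := by simp [field]

end Initial

section Generator

variable {D : CharSystem} {X Y : Type*} [NormedAddCommGroup X] [NormedSpace ℝ X] [CompleteSpace X]
  [NormedAddCommGroup Y] [NormedSpace ℝ Y] {T : IsometryGroup X} {T' : IsometryGroup Y}
  {ι δ : X →L[ℝ] Y} {P₀ Q₀ f : X} {φ : ℝ → X}

lemma hasDerivAt_ingoing (hgen : IsGenerator T' ι δ) (hι : ∀ s u, ι (T.act s u) = T'.act s (ι u))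
    (hδ : ∀ s u, δ (T.act s u) = T'.act s (δ u)) (hφ : Continuous φ) {x : ℝ}
    (hx : x ∈ Ioo 0 D.b) :
    HasDerivAt (fun y => ι (D.ingoing T P₀ φ y))
      (-D.dτ x • (δ (D.ingoing T P₀ φ x) + D.c • ι (D.ingoing T P₀ φ x)) + D.W x • ι (φ x)) x := by
  have h := hgen.hasDerivAt_wact_comp (c := D.c) (D.hasDerivAt_τ x hx).fun_neg
    ((hasDerivAt_inSource (T := T) hφ hx).const_add P₀)
  refine (h.congr_of_eventuallyEq (Eventually.of_forall fun y => ?_)).congr_deriv ?_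
  · exact map_wact hι _ _ _
  · rw [map_wact hι, T'.wact_neg_cancel, map_smul, ingoing, map_wact hι, map_wact hδ,
      map_add (T'.wact D.c (-D.τ x)), map_smul (T'.wact D.c (-D.τ x))]

lemma hasDerivAt_outgoing (hgen : IsGenerator T' ι δ) (hι : ∀ s u, ι (T.act s u) = T'.act s (ι u))
    (hδ : ∀ s u, δ (T.act s u) = T'.act s (δ u)) (hφ : Continuous φ) {x : ℝ}
    (hx : x ∈ Ioo 0 D.b) :
    HasDerivAt (fun y => ι (D.outgoing T Q₀ φ y))
      (x⁻¹ • (δ (D.outgoing T Q₀ φ x) + D.c • ι (D.outgoing T Q₀ φ x)) + D.W x • ι (φ x)) x := by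
  have h := hgen.hasDerivAt_wact_comp (c := D.c) (hasDerivAt_lam (D := D) hx.1)
    ((hasDerivAt_outSource (T := T) hφ hx).const_add Q₀)
  refine (h.congr_of_eventuallyEq (Eventually.of_forall fun y => ?_)).congr_deriv ?_
  · exact map_wact hι _ _ _
  · rw [map_wact hι, T'.wact_cancel_neg, map_smul, outgoing, map_wact hι, map_wact hδ,
      map_add (T'.wact D.c (D.lam x)), map_smul (T'.wact D.c (D.lam x))]

/-- The constraint `P - Q = 2 (∂ + c) φ` propagates. -/
lemma constraint (hgen : IsGenerator T' ι δ) (hι : ∀ s u, ι (T.act s u) = T'.act s (ι u))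
    (hδ : ∀ s u, δ (T.act s u) = T'.act s (δ u)) (hφ : Continuous φ)
    (h0 : ι (P₀ - Q₀) = (2 : ℝ) • (δ f + D.c • ι f)) {x : ℝ} (hx : x ∈ Ioo 0 D.b) :
    ι (D.ingoing T P₀ φ x) - ι (D.outgoing T Q₀ φ x)
      = (2 : ℝ) • (δ (D.field T P₀ Q₀ f φ x) + D.c • ι (D.field T P₀ Q₀ f φ x)) := by
  set z : ℝ → Y := fun x => ι (D.ingoing T P₀ φ x) - ι (D.outgoing T Q₀ φ x)
    - (2 : ℝ) • (δ (D.field T P₀ Q₀ f φ x) + D.c • ι (D.field T P₀ Q₀ f φ x)) with hz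
  -- The sources `W φ` cancel in `P - Q`, and what remains, `-τ' A P - x⁻¹ A Q`, is `2 A φ_x`.
  have hd : ∀ y ∈ Ioo 0 D.b, HasDerivAt z 0 y := by
    intro y hy
    have hf := hasDerivAt_field (T := T) (P₀ := P₀) (Q₀ := Q₀) (f := f) hφ hy
    have h1 := δ.hasFDerivAt.comp_hasDerivAt y hf
    have h2 := ι.hasFDerivAt.comp_hasDerivAt y hf
    have h3 := ((hasDerivAt_ingoing (P₀ := P₀) hgen hι hδ hφ hy).sub
      (hasDerivAt_outgoing (Q₀ := Q₀) hgen hι hδ hφ hy)).sub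
      ((h1.add (h2.const_smul D.c)).const_smul (2 : ℝ))
    refine h3.congr_deriv ?_
    simp only [velocity, map_smul, map_add]
    module
  obtain ⟨k, hk⟩ := isOpen_Ioo.exists_is_const_of_deriv_eq_zero isPreconnected_Ioo
    (fun y hy => (hd y hy).differentiableAt.differentiableWithinAt) (fun y hy => (hd y hy).deriv)
  have ha : z D.a = 0 := by
    simp only [hz, ingoing_a, outgoing_a, field_a, ← map_sub, h0, sub_self]
  have : z x = 0 := by rw [hk x hx, ← hk D.a a_mem, ha]
  exact sub_eq_zero.1 this

end Generator

end CharSystem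

/-! ### Relaxation -/

/-- If `(e^θ y)' = O(τ' e^θ ε)` with `ε → 0` and `θ' ~ δ₀ τ'`, then `y → 0`. -/
lemma tendsto_exp_neg_mul_norm {X : Type*} [NormedAddCommGroup X] [NormedSpace ℝ X] {a b δ₀ : ℝ}
    (hab : a < b) (hδ₀ : 0 < δ₀) {θ dτ δ ε : ℝ → ℝ} {Y F : ℝ → X}
    (hθ : ∀ x ∈ Ioo a b, HasDerivAt θ (dτ x * δ x) x) (hdτ : ∀ x ∈ Ioo a b, 0 ≤ dτ x)
    (hY : ∀ x ∈ Ioo a b, HasDerivAt Y (F x) x)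
    (hF : ∀ x ∈ Ioo a b, ‖F x‖ ≤ dτ x * Real.exp (θ x) * ε x)
    (hδ : Tendsto δ (𝓝[<] b) (𝓝 δ₀)) (hε : Tendsto ε (𝓝[<] b) (𝓝 0))
    (hθb : Tendsto θ (𝓝[<] b) atTop) :
    Tendsto (fun x => Real.exp (-θ x) * ‖Y x‖) (𝓝[<] b) (𝓝 0) := by
  rw [Metric.tendsto_nhds]
  intro e he
  have h1 : ∀ᶠ x in 𝓝[<] b, δ₀ / 2 < δ x ∧ ε x < e / 2 * (δ₀ / 2) :=
    (hδ.eventually (lt_mem_nhds (half_lt_self hδ₀))).and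
      (hε.eventually (gt_mem_nhds (by positivity)))
  obtain ⟨x₀, hx₀, hx₀'⟩ := (mem_nhdsLT_iff_exists_Ioo_subset' hab).1 h1
  obtain ⟨x₁, hx₁, hx₁b⟩ := exists_between (max_lt hx₀ hab)
  have hx₁0 : x₀ < x₁ := (le_max_left _ _).trans_lt hx₁
  have hx₁a : a < x₁ := (le_max_right _ _).trans_lt hx₁
  -- Compare `‖Y‖` with a multiple of `e^θ`: the derivative of `(e / 2) e^θ` is `(e / 2) τ' δ e^θ`,
  -- which dominates `τ' e^θ ε` once `ε < (e / 2) (δ₀ / 2)` and `δ₀ / 2 < δ`.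
  have hbound : ∀ x ∈ Ico x₁ b, ‖Y x‖ ≤ ‖Y x₁‖ + e / 2 * (Real.exp (θ x) - Real.exp (θ x₁)) := by
    intro x hx
    have hin : ∀ y ∈ Icc x₁ x, y ∈ Ioo a b := fun y hy =>
      ⟨hx₁a.trans_le hy.1, hy.2.trans_lt hx.2⟩
    have hB : ∀ y ∈ Icc x₁ x, HasDerivAt
        (fun y => ‖Y x₁‖ + e / 2 * (Real.exp (θ y) - Real.exp (θ x₁)))
        (e / 2 * (Real.exp (θ y) * (dτ y * δ y))) y := fun y hy =>
      ((((hθ y (hin y hy)).exp).sub_const _).const_mul _).const_add _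
    refine image_norm_le_of_norm_deriv_right_le_deriv_boundary'
      (fun y hy => (hY y (hin y hy)).continuousAt.continuousWithinAt)
      (fun y hy => (hY y (hin y (Ico_subset_Icc_self hy))).hasDerivWithinAt) (by simp)
      (fun y hy => (hB y hy).continuousAt.continuousWithinAt)
      (fun y hy => (hB y (Ico_subset_Icc_self hy)).hasDerivWithinAt) (fun y hy => ?_)
      (right_mem_Icc.2 hx.1)
    have hy' := hin y (Ico_subset_Icc_self hy)
    obtain ⟨e1, e2⟩ := hx₀' ⟨hx₁0.trans_le hy.1, hy'.2⟩
    refine (hF y hy').trans ?_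
    have hn : 0 ≤ dτ y * Real.exp (θ y) := mul_nonneg (hdτ y hy') (Real.exp_nonneg _)
    have e3 : ε y ≤ e / 2 * δ y := e2.le.trans (mul_le_mul_of_nonneg_left e1.le (by positivity))
    calc _ ≤ dτ y * Real.exp (θ y) * (e / 2 * δ y) := mul_le_mul_of_nonneg_left e3 hn
      _ = _ := by ring
  have h2 : Tendsto (fun x => Real.exp (-θ x) * ‖Y x₁‖) (𝓝[<] b) (𝓝 0) := by
    simpa using ((Real.tendsto_exp_atBot.comp (tendsto_neg_atTop_atBot.comp hθb)).mul_const ‖Y x₁‖)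
  filter_upwards [h2.eventually (gt_mem_nhds (half_pos he)), Ico_mem_nhdsLT hx₁b] with x h3 hx
  rw [dist_zero_right, Real.norm_of_nonneg (by positivity)]
  have h4 := mul_le_mul_of_nonneg_left (hbound x hx) (Real.exp_nonneg (-θ x))
  have h5 : Real.exp (-θ x) * Real.exp (θ x) = 1 := by rw [← Real.exp_add]; simp
  have h6 : 0 < Real.exp (-θ x) * Real.exp (θ x₁) := by positivity
  nlinarith

/-- The ingoing field decays at the horizon. -/
lemma CharSystem.tendsto_ingoing {D : CharSystem} {X : Type*} [NormedAddCommGroup X]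
    [NormedSpace ℝ X] [CompleteSpace X] {T : IsometryGroup X} {P₀ : X} {φ : ℝ → X}
    (hφ : Continuous φ) (hτ : Tendsto D.τ (𝓝[<] D.b) atTop)
    (hdτ : Tendsto D.dτ (𝓝[<] D.b) atTop) (hpos : ∀ x ∈ Ioo D.a D.b, 0 < D.dτ x) :
    Tendsto (D.ingoing T P₀ φ) (𝓝[<] D.b) (𝓝 0) := by
  have hin : ∀ x ∈ Ioo D.a D.b, x ∈ Ioo 0 D.b := fun x hx => ⟨D.a_pos.trans hx.1, hx.2⟩
  have hW : Tendsto (fun x => ‖D.W x • φ x‖) (𝓝[<] D.b) (𝓝 ‖D.W D.b • φ D.b‖) := by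
    have hb : D.b ∈ Ioc 0 D.b := ⟨D.a_pos.trans D.a_lt_b, le_rfl⟩
    refine ((D.continuousOn_W.smul hφ.continuousOn).norm D.b hb).mono_left ?_
    rw [← nhdsWithin_Ioo_eq_nhdsLT hb.1]
    exact nhdsWithin_mono _ Ioo_subset_Ioc_self
  -- The rate is the constant `c`, and the source relative to `τ'` is `‖W φ‖ / τ'`, which tends to
  -- zero because `τ' → ∞`.
  have h := tendsto_exp_neg_mul_norm (θ := fun x => D.c * D.τ x) (dτ := D.dτ) (δ := fun _ => D.c)
    (ε := fun x => ‖D.W x • φ x‖ * (D.dτ x)⁻¹) (Y := fun x => P₀ + D.inSource T φ x)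
    (F := fun x => T.wact D.c (D.τ x) (D.W x • φ x)) D.a_lt_b D.c_pos
    (fun x hx => ((D.hasDerivAt_τ x (hin x hx)).const_mul D.c).congr_deriv (mul_comm _ _))
    (fun x hx => (hpos x hx).le)
    (fun x hx => (hasDerivAt_inSource hφ (hin x hx)).const_add P₀)
    (fun x hx => by
      rw [T.norm_wact]
      have := (hpos x hx).ne'
      refine le_of_eq ?_
      field_simp)
    tendsto_const_nhds (by simpa using hW.mul (tendsto_inv_atTop_zero.comp hdτ))
    (hτ.const_mul_atTop D.c_pos)
  refine tendsto_zero_iff_norm_tendsto_zero.2 (h.congr fun x => ?_)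
  rw [ingoing, T.norm_wact, mul_neg]

/-! ### Behaviour of the background at the horizon -/

/-- Comparison of derivatives: a function that eventually grows faster than one that tends to
infinity tends to infinity. -/
lemma tendsto_atTop_of_deriv_le {a b : ℝ} (hab : a < b) {F H F' H' : ℝ → ℝ}
    (hF : ∀ x ∈ Ioo a b, HasDerivAt F (F' x) x) (hH : ∀ x ∈ Ioo a b, HasDerivAt H (H' x) x)
    (hle : ∀ᶠ x in 𝓝[<] b, H' x ≤ F' x) (hHb : Tendsto H (𝓝[<] b) atTop) :
    Tendsto F (𝓝[<] b) atTop := by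
  obtain ⟨x₀, hx₀, hx₀'⟩ := (mem_nhdsLT_iff_exists_Ioo_subset' hab).1 hle
  obtain ⟨x₁, hx₁, hx₁b⟩ := exists_between (max_lt hx₀ hab)
  have hin : ∀ y ∈ Ico x₁ b, y ∈ Ioo a b := fun y hy =>
    ⟨((le_max_right _ _).trans_lt hx₁).trans_le hy.1, hy.2⟩
  have hd : ∀ y ∈ Ico x₁ b, HasDerivAt (fun x => F x - H x) (F' y - H' y) y := fun y hy =>
    (hF y (hin y hy)).sub (hH y (hin y hy))
  have hmono : MonotoneOn (fun x => F x - H x) (Ico x₁ b) := by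
    refine monotoneOn_of_deriv_nonneg (convex_Ico _ _)
      (fun y hy => (hd y hy).continuousAt.continuousWithinAt) (fun y hy => ?_) fun y hy => ?_
    · exact (hd y (interior_subset hy)).differentiableAt.differentiableWithinAt
    · rw [interior_Ico] at hy
      rw [(hd y (Ioo_subset_Ico_self hy)).deriv, sub_nonneg]
      exact hx₀' ⟨((le_max_left _ _).trans_lt hx₁).trans hy.1, hy.2⟩
  refine tendsto_atTop_mono' _ ?_ (tendsto_atTop_add_const_left _ (F x₁ - H x₁) hHb)
  filter_upwards [Ico_mem_nhdsLT hx₁b] with x hx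
  have := hmono (left_mem_Ico.2 hx₁b) hx hx.1
  simp only at this
  linarith

namespace IsBackground

variable {G ψ : ℝ → ℝ} {xc : ℝ}

lemma tendsto_of_continuousOn {f : ℝ → ℝ} (hf : ContinuousOn f (Iic xc)) :
    Tendsto f (𝓝[<] xc) (𝓝 (f xc)) :=
  (hf xc self_mem_Iic).mono_left (nhdsWithin_mono _ Iio_subset_Iic_self)

lemma tendsto_lapse (h : IsBackground G ψ xc) :
    Tendsto (fun x => 1 - x * G x) (𝓝[<] xc) (𝓝[>] 0) := by
  refine tendsto_nhdsWithin_iff.2 ⟨?_, ?_⟩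
  · have := tendsto_of_continuousOn h.continuousOn_lapse
    rwa [h.horizon_root, sub_self] at this
  · filter_upwards [Ioo_mem_nhdsLT h.horizon_pos] with x hx
    exact h.lapse_pos hx

lemma tendsto_dτ (h : IsBackground G ψ xc) :
    Tendsto (fun x => G x / (1 - x * G x)) (𝓝[<] xc) atTop :=
  Tendsto.pos_mul_atTop (h.G_pos ⟨h.horizon_pos, le_rfl⟩) (tendsto_of_continuousOn h.continuousOn_G)
    (tendsto_inv_nhdsGT_zero.comp h.tendsto_lapse)

lemma dτ_pos (h : IsBackground G ψ xc) {x : ℝ} (hx : x ∈ Ioo 0 xc) : 0 < G x / (1 - x * G x) :=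
  div_pos (h.G_pos (Ioo_subset_Ioc_self hx)) (h.lapse_pos hx)

/-- The limit is minus the slope of the lapse at `xc` and is positive by `horizon_slope`: the lapse
has a simple zero at the horizon. -/
lemma tendsto_lapse_deriv (h : IsBackground G ψ xc) :
    Tendsto (fun x => G x + x * deriv G x) (𝓝[<] xc) (𝓝 ((1 + xc ^ 2 * deriv G xc) / xc)) := by
  have := tendsto_of_continuousOn (h.continuousOn_G.add (continuousOn_id.mul h.continuousOn_deriv_G))
  change Tendsto (fun x => G x + x * deriv G x) _ (𝓝 (G xc + xc * deriv G xc)) at this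
  rw [h.G_horizon] at this
  convert this using 2
  have := h.horizon_pos.ne'
  field_simp

/-- Comparison with `-k log (1 - xG)`. The choice of `k` makes `k (G + xG')` tend to `1 / (2 xc)`,
half of `G xc`, so the derivative of the comparison function is eventually smaller than `τ'`. -/
lemma tendsto_τ (h : IsBackground G ψ xc) {xi : ℝ} (hxi : xi ∈ Ioo 0 xc) :
    Tendsto (fun x => ∫ y in xi..x, G y / (1 - y * G y)) (𝓝[<] xc) atTop := by
  have hxc := h.horizon_pos
  set s := (1 + xc ^ 2 * deriv G xc) / xc with hs
  have hs0 : 0 < s := div_pos h.horizon_slope hxc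
  set k := (2 * (xc * s))⁻¹ with hk
  have hk0 : 0 < k := by positivity
  refine tendsto_atTop_of_deriv_le h.horizon_pos
    (H := fun x => k * -Real.log (1 - x * G x))
    (H' := fun x => k * ((G x + x * deriv G x) / (1 - x * G x)))
    (fun x hx => hasDerivAt_primitive h.continuousOn_dτ hxi hx)
    (fun x hx => ?_) ?_ ?_
  · refine (((h.hasDerivAt_lapse hx.2.le).log (h.lapse_pos hx).ne').neg.const_mul k).congr_deriv ?_
    ring
  · have h1 : Tendsto (fun x => G x - k * (G x + x * deriv G x)) (𝓝[<] xc)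
        (𝓝 (G xc - k * s)) :=
      (tendsto_of_continuousOn h.continuousOn_G).sub (h.tendsto_lapse_deriv.const_mul k)
    have h2 : 0 < G xc - k * s := by
      have : G xc - k * s = 1 / (2 * xc) := by
        rw [h.G_horizon, hk]; field_simp; norm_num
      rw [this]; positivity
    filter_upwards [h1.eventually (lt_mem_nhds h2), Ioo_mem_nhdsLT hxc] with x hx hx'
    rw [← mul_div_assoc]
    exact div_le_div_of_nonneg_right (by linarith) (h.lapse_pos hx').le
  · refine Tendsto.const_mul_atTop hk0 (tendsto_neg_atBot_atTop.comp ?_)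
    exact Real.tendsto_log_nhdsGT_zero.comp h.tendsto_lapse

end IsBackground

/-! ### Joining two Sobolev functions -/

/-- The element of `H^{m+2}` with function `u` and derivative `v`. -/
def SobolevSpace.join {m : ℕ} (u : RealL2) (v : SobolevSpace m) (h : IsWeakDeriv u (weakD v 0)) :
    SobolevSpace (m + 1) :=
  SobolevSpace.mk (Fin.cons u (weakD v)) fun i => by
    induction i using Fin.cases with
    | zero => exact h
    | succ j => exact isWeakDeriv_weakD v j

/-! ### Solutions of the characteristic system, and their `ρ`-derivative -/

section

variable {G ψ : ℝ → ℝ} {xc : ℝ} (hbg : IsBackground G ψ xc) (ℓ : ℕ) {xi : ℝ} (hxi : xi ∈ Ioo 0 xc)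
  {κ : ℝ} (hκ : κ < 1) (f : SobolevSpace 3) (g : SobolevSpace 2) {φ : ℝ → SobolevSpace 2}

/-- The ingoing characteristic field `α φ̃_x + (β + 1) (∂ + 1 - κ) φ̃`, as a curve in `H²`. -/
def inField (φ : ℝ → SobolevSpace 2) (x : ℝ) : SobolevSpace 2 :=
  (hbg.charSystem ℓ hκ hxi).ingoing (translation 2) (inData G κ xi f g) φ x

/-- The outgoing characteristic field `α φ̃_x + (β - 1) (∂ + 1 - κ) φ̃`, as a curve in `H²`. -/
def outField (φ : ℝ → SobolevSpace 2) (x : ℝ) : SobolevSpace 2 :=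
  (hbg.charSystem ℓ hκ hxi).outgoing (translation 2) (outData G κ xi f g) φ x

/-- The field reconstructed from its velocity. -/
def waveField (φ : ℝ → SobolevSpace 2) (x : ℝ) : SobolevSpace 2 :=
  (hbg.charSystem ℓ hκ hxi).field (translation 2) (inData G κ xi f g) (outData G κ xi f g)
    (sobolevD 3 2 0 (by norm_num) f) φ x

/-- The derivative of the field with respect to `x`. -/
def waveVelocity (φ : ℝ → SobolevSpace 2) (x : ℝ) : SobolevSpace 2 :=
  (hbg.charSystem ℓ hκ hxi).velocity (translation 2) (inData G κ xi f g) (outData G κ xi f g) φ x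

/-- The derivative of the field with respect to `ρ`, up to the horizon, where the ingoing field
vanishes. -/
def waveSlope (φ : ℝ → SobolevSpace 2) (x : ℝ) : SobolevSpace 2 :=
  (1 / 2 : ℝ) • ((Iio xc).indicator (inField hbg ℓ hxi hκ f g φ) x
    - outField hbg ℓ hxi hκ f g φ x) - (1 - κ) • waveField hbg ℓ hxi hκ f g φ x

variable {f g}

variable (hφ : Continuous φ)
include hφ

lemma tendsto_inField : Tendsto (inField hbg ℓ hxi hκ f g φ) (𝓝[<] xc) (𝓝 0) :=
  CharSystem.tendsto_ingoing (D := hbg.charSystem ℓ hκ hxi) hφ (hbg.tendsto_τ hxi) hbg.tendsto_dτ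
    fun _ hx => hbg.dτ_pos ⟨hxi.1.trans hx.1, hx.2⟩

lemma continuousOn_inField : ContinuousOn (inField hbg ℓ hxi hκ f g φ) (Ioo 0 xc) :=
  CharSystem.continuousOn_ingoing (D := hbg.charSystem ℓ hκ hxi) hφ

lemma continuousOn_outField : ContinuousOn (outField hbg ℓ hxi hκ f g φ) (Ioc 0 xc) :=
  CharSystem.continuousOn_outgoing (D := hbg.charSystem ℓ hκ hxi) hφ

/-- The formula for `inField` is meaningful only before `xc`; the indicator puts the limit `0`
there, which makes the slope continuous up to the horizon. -/
lemma continuousOn_inField_indicator :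
    ContinuousOn ((Iio xc).indicator (inField hbg ℓ hxi hκ f g φ)) (Ioc 0 xc) := by
  intro x hx
  rcases hx.2.lt_or_eq with h | rfl
  · refine (((continuousOn_inField hbg ℓ hxi hκ hφ (f := f) (g := g)).continuousAt
      (Ioo_mem_nhds hx.1 h)).congr ?_).continuousWithinAt
    filter_upwards [Iio_mem_nhds h] with y hy
    exact (indicator_of_mem (f := inField hbg ℓ hxi hκ f g φ) (s := Iio xc) hy).symm
  · have h1 : Tendsto ((Iio x).indicator (inField hbg ℓ hxi hκ f g φ)) (𝓝[<] x) (𝓝 0) :=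
      (tendsto_inField hbg ℓ hxi hκ hφ).congr' (by
        filter_upwards [self_mem_nhdsWithin] with y hy
        exact (indicator_of_mem (f := inField hbg ℓ hxi hκ f g φ) (s := Iio x) hy).symm)
    have h2 : (Iio x).indicator (inField hbg ℓ hxi hκ f g φ) x = 0 :=
      indicator_of_notMem (by simp) _
    rw [← h2] at h1
    have h3 : ContinuousWithinAt ((Iio x).indicator (inField hbg ℓ hxi hκ f g φ)) (Iio x) x := h1
    exact (continuousWithinAt_Iio_iff_Iic.1 h3).mono Ioc_subset_Iic_self

lemma hasDerivAt_waveField {x : ℝ} (hx : x ∈ Ioo 0 xc) :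
    HasDerivAt (waveField hbg ℓ hxi hκ f g φ) (waveVelocity hbg ℓ hxi hκ f g φ x) x :=
  CharSystem.hasDerivAt_field (D := hbg.charSystem ℓ hκ hxi) hφ hx

lemma continuousOn_waveField : ContinuousOn (waveField hbg ℓ hxi hκ f g φ) (Ioc 0 xc) := by
  intro x hx
  rcases hx.2.lt_or_eq with h | rfl
  · exact (hasDerivAt_waveField hbg ℓ hxi hκ hφ ⟨hx.1, h⟩).continuousAt.continuousWithinAt
  · refine (CharSystem.continuousOn_field (D := hbg.charSystem ℓ hκ hxi) hφ x
      (right_mem_Icc.2 hxi.2.le)).mono_of_mem_nhdsWithin ?_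
    filter_upwards [self_mem_nhdsWithin, mem_nhdsWithin_of_mem_nhds (Ioi_mem_nhds hxi.2)]
      with y hy hy'
    exact ⟨le_of_lt hy', hy.2⟩

lemma continuousOn_waveSlope : ContinuousOn (waveSlope hbg ℓ hxi hκ f g φ) (Ioc 0 xc) := by
  have h1 := continuousOn_inField_indicator hbg ℓ hxi hκ hφ (f := f) (g := g)
  have h2 := continuousOn_outField hbg ℓ hxi hκ hφ (f := f) (g := g)
  have h3 := continuousOn_waveField hbg ℓ hxi hκ hφ (f := f) (g := g)
  unfold waveSlope
  fun_prop

omit hφ in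
lemma inField_sub_outField {x : ℝ} (hx : x ∈ Ioo 0 xc) :
    inField hbg ℓ hxi hκ f g φ x - outField hbg ℓ hxi hκ f g φ x
      = (2 : ℝ) • (waveSlope hbg ℓ hxi hκ f g φ x
        + (1 - κ) • waveField hbg ℓ hxi hκ f g φ x) := by
  rw [waveSlope, indicator_of_mem (s := Iio xc) hx.2]
  module

/-- `waveSlope` is the derivative of `waveField` with respect to `ρ`. -/
lemma sobolevD_waveSlope {x : ℝ} (hx : x ∈ Ioc 0 xc) :
    sobolevD 2 1 0 (by norm_num) (waveSlope hbg ℓ hxi hκ f g φ x)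
      = sobolevD 2 1 1 (by norm_num) (waveField hbg ℓ hxi hκ f g φ x) := by
  have h1 : EqOn (fun x => sobolevD 2 1 0 (by norm_num) (waveSlope hbg ℓ hxi hκ f g φ x))
      (fun x => sobolevD 2 1 1 (by norm_num) (waveField hbg ℓ hxi hκ f g φ x)) (Ioo 0 xc) := by
    intro y hy
    have := CharSystem.constraint (D := hbg.charSystem ℓ hκ hxi) (P₀ := inData G κ xi f g)
      (Q₀ := outData G κ xi f g) (f := sobolevD 3 2 0 (by norm_num) f)
      (isGenerator_sobolevD 2 1 0 (by norm_num)) (sobolevD_act 2 1 0 (by norm_num))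
      (sobolevD_act 2 1 1 (by norm_num)) hφ (by
        have e : inData G κ xi f g - outData G κ xi f g = (2 : ℝ) • (sobolevD 3 2 1 (by norm_num) f
            + (1 - κ) • sobolevD 3 2 0 (by norm_num) f) := by
          unfold inData outData; module
        rw [e, map_smul, map_add, map_smul]
        rfl) hy
    rw [← map_sub] at this
    have e := inField_sub_outField hbg ℓ hxi hκ (f := f) (g := g) (φ := φ) hy
    change sobolevD 2 1 0 _ (inField hbg ℓ hxi hκ f g φ y - outField hbg ℓ hxi hκ f g φ y)
      = (2 : ℝ) • (sobolevD 2 1 1 _ (waveField hbg ℓ hxi hκ f g φ y)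
        + (1 - κ) • sobolevD 2 1 0 _ (waveField hbg ℓ hxi hκ f g φ y)) at this
    rw [e, map_smul, map_add, map_smul] at this
    exact add_right_cancel (smul_right_injective _ (two_ne_zero' ℝ) this)
  -- Both sides are continuous on `(0, xc]`, so the identity passes to the horizon.
  refine EqOn.of_subset_closure h1
    ((sobolevD 2 1 0 _).continuous.comp_continuousOn (continuousOn_waveSlope hbg ℓ hxi hκ hφ))
    ((sobolevD 2 1 1 _).continuous.comp_continuousOn (continuousOn_waveField hbg ℓ hxi hκ hφ))
    Ioo_subset_Ioc_self ?_ hx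
  rw [closure_Ioo hbg.horizon_pos.ne]
  exact Ioc_subset_Icc_self

lemma isWeakDeriv_waveSlope {x : ℝ} (hx : x ∈ Ioc 0 xc) :
    IsWeakDeriv (weakD (waveField hbg ℓ hxi hκ f g φ x) 0)
      (weakD (waveSlope hbg ℓ hxi hκ f g φ x) 0) := by
  have h := isWeakDeriv_weakD (waveField hbg ℓ hxi hκ f g φ x) 0
  have e := congrArg (fun u => weakD u 0) (sobolevD_waveSlope hbg ℓ hxi hκ hφ (f := f) (g := g) hx)
  have e' : weakD (waveSlope hbg ℓ hxi hκ f g φ x) 0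
      = weakD (waveField hbg ℓ hxi hκ f g φ x) (0 : Fin 2).succ := e
  rw [e']
  exact h

lemma weakD_waveSlope_one {x : ℝ} (hx : x ∈ Ioc 0 xc) :
    weakD (waveSlope hbg ℓ hxi hκ f g φ x) 0 = weakD (waveField hbg ℓ hxi hκ f g φ x) 1 ∧
    weakD (waveSlope hbg ℓ hxi hκ f g φ x) 1 = weakD (waveField hbg ℓ hxi hκ f g φ x) 2 :=
  have e := sobolevD_waveSlope hbg ℓ hxi hκ hφ (f := f) (g := g) hx
  ⟨congrArg (fun u => weakD u 0) e, congrArg (fun u => weakD u 1) e⟩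

/-- The reconstructed field is a continuous curve in `H³`. -/
def solutionCurve : C(Icc xi xc, SobolevSpace 3) where
  toFun x := SobolevSpace.join (weakD (waveField hbg ℓ hxi hκ f g φ x) 0)
    (waveSlope hbg ℓ hxi hκ f g φ x)
    (isWeakDeriv_waveSlope hbg ℓ hxi hκ hφ ⟨hxi.1.trans_le x.2.1, x.2.2⟩)
  continuous_toFun := by
    have hsub : ∀ x : Icc xi xc, (x : ℝ) ∈ Ioc 0 xc := fun x => ⟨hxi.1.trans_le x.2.1, x.2.2⟩
    refine SobolevSpace.continuous_iff.2 fun j => ?_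
    induction j using Fin.cases with
    | zero =>
      exact (weakDL 2 0).continuous.comp
        ((continuousOn_waveField hbg ℓ hxi hκ hφ).comp_continuous continuous_subtype_val hsub)
    | succ j =>
      exact (weakDL 2 j).continuous.comp
        ((continuousOn_waveSlope hbg ℓ hxi hκ hφ).comp_continuous continuous_subtype_val hsub)

end

/-! ### From the characteristic system back to the wave equation -/

section

variable {G ψ : ℝ → ℝ} {xc : ℝ} (hbg : IsBackground G ψ xc) (ℓ : ℕ) {xi : ℝ} (hxi : xi ∈ Ioo 0 xc)
  {κ : ℝ} (hκ : κ < 1) {f : SobolevSpace 3} {g : SobolevSpace 2} {φ : ℝ → SobolevSpace 2}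

/-- The factor `α` cancels the singularity of `τ'`: the momentum is `(1 - xG) P + xG Q`, by `2 A φ̃
= P - Q`. In this form it can be differentiated with the transport equations. -/
lemma coeffA_smul_waveVelocity {x : ℝ} (hx : x ∈ Ioo 0 xc) :
    coeffA G x • waveVelocity hbg ℓ hxi hκ f g φ x
      + (2 * coeffB G x) • (waveSlope hbg ℓ hxi hκ f g φ x
        + (1 - κ) • waveField hbg ℓ hxi hκ f g φ x)
      = (1 - x * G x) • inField hbg ℓ hxi hκ f g φ x
        + (x * G x) • outField hbg ℓ hxi hκ f g φ x := by
  have h1 := (hbg.lapse_pos hx).ne'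
  have h2 := hx.1.ne'
  have e : waveVelocity hbg ℓ hxi hκ f g φ x = (-(1 / 2) : ℝ) • ((G x / (1 - x * G x)) •
    inField hbg ℓ hxi hκ f g φ x + x⁻¹ • outField hbg ℓ hxi hκ f g φ x) := rfl
  rw [mul_comm 2, mul_smul, ← inField_sub_outField hbg ℓ hxi hκ hx, e]
  simp only [coeffA, coeffB]
  match_scalars <;> field_simp <;> ring

section Generator

variable {Y : Type*} [NormedAddCommGroup Y] [NormedSpace ℝ Y] {T' : IsometryGroup Y}
  {ι δ : SobolevSpace 2 →L[ℝ] Y}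

lemma hasDerivAt_inField (hgen : IsGenerator T' ι δ)
    (hι : ∀ s u, ι ((translation 2).act s u) = T'.act s (ι u))
    (hδ : ∀ s u, δ ((translation 2).act s u) = T'.act s (δ u)) (hφ : Continuous φ) {x : ℝ}
    (hx : x ∈ Ioo 0 xc) :
    HasDerivAt (fun y => ι (inField hbg ℓ hxi hκ f g φ y))
      (-(G x / (1 - x * G x)) • (δ (inField hbg ℓ hxi hκ f g φ x)
        + (1 - κ) • ι (inField hbg ℓ hxi hκ f g φ x))
        + ((ℓ : ℝ) * ((ℓ : ℝ) + 1) * Real.exp (ψ x) - 2 * x * deriv G x) • ι (φ x)) x :=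
  CharSystem.hasDerivAt_ingoing (D := hbg.charSystem ℓ hκ hxi) hgen hι hδ hφ hx

lemma hasDerivAt_outField (hgen : IsGenerator T' ι δ)
    (hι : ∀ s u, ι ((translation 2).act s u) = T'.act s (ι u))
    (hδ : ∀ s u, δ ((translation 2).act s u) = T'.act s (δ u)) (hφ : Continuous φ) {x : ℝ}
    (hx : x ∈ Ioo 0 xc) :
    HasDerivAt (fun y => ι (outField hbg ℓ hxi hκ f g φ y))
      (x⁻¹ • (δ (outField hbg ℓ hxi hκ f g φ x)
        + (1 - κ) • ι (outField hbg ℓ hxi hκ f g φ x))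
        + ((ℓ : ℝ) * ((ℓ : ℝ) + 1) * Real.exp (ψ x) - 2 * x * deriv G x) • ι (φ x)) x :=
  CharSystem.hasDerivAt_outgoing (D := hbg.charSystem ℓ hκ hxi) hgen hι hδ hφ hx

/-- The evolution of the momentum `α φ̃_x + 2 β (∂ + 1 - κ) φ̃`. -/
lemma hasDerivAt_momentumField (hgen : IsGenerator T' ι δ)
    (hι : ∀ s u, ι ((translation 2).act s u) = T'.act s (ι u))
    (hδ : ∀ s u, δ ((translation 2).act s u) = T'.act s (δ u)) (hφ : Continuous φ) {x : ℝ}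
    (hx : x ∈ Ioo 0 xc) (hφx : waveField hbg ℓ hxi hκ f g φ x = φ x)
    (hσ : ι (waveSlope hbg ℓ hxi hκ f g φ x) = δ (waveField hbg ℓ hxi hκ f g φ x)) :
    HasDerivAt (fun y => (1 - y * G y) • ι (inField hbg ℓ hxi hκ f g φ y)
        + (y * G y) • ι (outField hbg ℓ hxi hκ f g φ y))
      (-(coeffC G x • δ (waveSlope hbg ℓ hxi hκ f g φ x)
        + (coeffR G κ x - 2 * deriv (coeffB G) x) • ι (waveSlope hbg ℓ hxi hκ f g φ x)
        + (coeffZ G ψ ℓ κ x - 2 * (1 - κ) * deriv (coeffB G) x)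
          • ι (waveField hbg ℓ hxi hκ f g φ x))) x := by
  have hN := hbg.hasDerivAt_lapse hx.2.le
  have hN' := ((hasDerivAt_id x).mul (hbg.hasDerivAt_G hx.2.le))
  have h := (hN.smul (hasDerivAt_inField hbg ℓ hxi hκ hgen hι hδ hφ hx (f := f) (g := g))).add
    (hN'.smul (hasDerivAt_outField hbg ℓ hxi hκ hgen hι hδ hφ hx (f := f) (g := g)))
  refine h.congr_deriv ?_
  -- Once `P` is expressed by `Q` and the slope, the terms with `δ Q` cancel, because `-(1 - xG) τ'
  -- + xG x⁻¹ = 0`.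
  have e : inField hbg ℓ hxi hκ f g φ x = outField hbg ℓ hxi hκ f g φ x
      + (2 : ℝ) • (waveSlope hbg ℓ hxi hκ f g φ x
        + (1 - κ) • waveField hbg ℓ hxi hκ f g φ x) := by
    rw [← inField_sub_outField hbg ℓ hxi hκ hx]; abel
  have h1 := (hbg.lapse_pos hx).ne'
  have h2 := hx.1.ne'
  rw [e, ← hφx]
  simp only [map_add, map_smul, ← hσ, hbg.deriv_coeffB hx.2.le, coeffR, coeffZ, coeffC, id,
    Pi.mul_apply]
  match_scalars <;> field_simp <;> ring

end Generator

/-- The reconstructed field solves the wave equation in the sense of distributions. -/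
lemma isSolution_solutionCurve (hφ : Continuous φ)
    (hfix : ∀ x ∈ Icc xi xc, waveField hbg ℓ hxi hκ f g φ x = φ x) :
    IsSolution G ψ ℓ κ hxi.2.le (solutionCurve hbg ℓ hxi hκ hφ (f := f) (g := g)) f g := by
  set Φ := solutionCurve hbg ℓ hxi hκ hφ (f := f) (g := g) with hΦ
  set u := waveField hbg ℓ hxi hκ f g φ with hu
  set σ := waveSlope hbg ℓ hxi hκ f g φ with hσ
  set v := waveVelocity hbg ℓ hxi hκ f g φ with hv
  intro χ hχ hcχ hsχ
  have hin : ∀ x ∈ Icc xi xc, x ∈ Ioc 0 xc := fun x hx => ⟨hxi.1.trans_le hx.1, hx.2⟩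
  have hcurve : ∀ x ∈ Icc xi xc, curveD hxi.2.le Φ 0 x = weakDL 2 0 (u x)
      ∧ curveD hxi.2.le Φ 1 x = weakDL 2 0 (σ x) ∧ curveD hxi.2.le Φ 2 x = weakDL 2 1 (σ x) := by
    intro x hx
    simp only [curveD, IccExtend_of_mem _ _ hx]
    exact ⟨rfl, rfl, rfl⟩
  rw [intervalIntegral.integral_congr (g := fun y =>
      deriv (deriv χ) y • (coeffA G (clamp xi xc y) • curveD hxi.2.le Φ 0 y)
        + deriv χ y • fluxCurve G κ hxi.2.le Φ y + χ y • sourceCurve G ψ ℓ κ hxi.2.le Φ y)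
    (fun y hy => weak_integrand_eq hbg ℓ hxi hχ (uIcc_of_le hxi.2.le ▸ hy))]
  have hχ' := contDiff_deriv_test hχ
  have hχ'' := contDiff_deriv_test hχ'
  set Dm : ℝ → RealL2 := fun y => (1 - y * G y) • weakDL 2 0 (inField hbg ℓ hxi hκ f g φ y)
        + (y * G y) • weakDL 2 0 (outField hbg ℓ hxi hκ f g φ y) with hDm
  -- `M` is a primitive of the weak integrand. It vanishes near `xc` together with `χ`, and its
  -- value at `xi` gives the boundary terms with the data.
  set M : ℝ → RealL2 := fun y => (coeffA G y * deriv χ y) • weakDL 2 0 (u y) - χ y • Dm y with hM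
  have hDeq : ∀ x ∈ Ioo 0 xc, Dm x = coeffA G x • weakDL 2 0 (v x)
      + (2 * coeffB G x) • (weakDL 2 0 (σ x) + (1 - κ) • weakDL 2 0 (u x)) := by
    intro x hx
    have := congrArg (weakDL 2 0) (coeffA_smul_waveVelocity hbg ℓ hxi hκ (f := f) (g := g)
      (φ := φ) hx)
    simp only [map_add, map_smul] at this
    exact this.symm
  have hMd : ∀ x ∈ Ico xi xc, HasDerivAt M
      ((deriv (coeffA G) x * deriv χ x + coeffA G x * deriv (deriv χ) x) • weakDL 2 0 (u x)
        + (coeffA G x * deriv χ x) • weakDL 2 0 (v x) - (deriv χ x • Dm x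
        + χ x • -(coeffC G x • weakDL 2 1 (σ x)
        + (coeffR G κ x - 2 * deriv (coeffB G) x) • weakDL 2 0 (σ x)
        + (coeffZ G ψ ℓ κ x - 2 * (1 - κ) * deriv (coeffB G) x) • weakDL 2 0 (u x)))) x := by
    intro x hx
    have hx0 : x ∈ Ioo 0 xc := ⟨hxi.1.trans_le hx.1, hx.2⟩
    have dA := (hbg.analyticOnNhd_coeffA x hx.2.le).differentiableAt.hasDerivAt
    have dχ := (hχ.differentiable (by simp) x).hasDerivAt
    have dχ' := (hχ'.differentiable (by simp) x).hasDerivAt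
    have du := (weakDL 2 0).hasFDerivAt.comp_hasDerivAt x
      (hasDerivAt_waveField hbg ℓ hxi hκ hφ (f := f) (g := g) hx0)
    have dD := hasDerivAt_momentumField hbg ℓ hxi hκ (isGenerator_weakDL 2 0)
      (fun _ _ => rfl) (fun _ _ => rfl) hφ hx0 (hfix x (Ico_subset_Icc_self hx))
      (f := f) (g := g) (weakD_waveSlope_one hbg ℓ hxi hκ hφ (Ioo_subset_Ioc_self hx0)).1
    refine ((((dA.mul dχ').smul du).sub (dχ.smul dD))).congr_deriv ?_
    simp only [Function.comp_apply, Pi.mul_apply]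
    rw [add_comm ((coeffA G x * deriv χ x) • _), add_comm (χ x • _)]
    rfl
  have hM0 : ∀ᶠ x in 𝓝 xc, M x = 0 := by
    have h0 : χ =ᶠ[𝓝 xc] 0 := notMem_tsupport_iff_eventuallyEq.1 fun h => lt_irrefl xc (hsχ h)
    filter_upwards [h0, h0.deriv] with x h1 h2
    have h3 : deriv χ x = 0 := by rw [h2]; exact deriv_const x 0
    simp only [hM, h1, h3, Pi.zero_apply, mul_zero, zero_smul, sub_zero]
  have hcont : ContinuousOn M (Icc xi xc) := by
    intro x hx
    rcases hx.2.lt_or_eq with h | rfl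
    · exact (hMd x ⟨hx.1, h⟩).continuousAt.continuousWithinAt
    · exact (continuousAt_const.congr (EventuallyEq.symm hM0)).continuousWithinAt
  have c0 := continuous_curveD hxi.2.le Φ 0
  have hA := continuous_comp_clamp hxi.2.le hbg.analyticOnNhd_coeffA.continuousOn
  have cI : Continuous fun y =>
      deriv (deriv χ) y • (coeffA G (clamp xi xc y) • curveD hxi.2.le Φ 0 y)
        + deriv χ y • fluxCurve G κ hxi.2.le Φ y + χ y • sourceCurve G ψ ℓ κ hxi.2.le Φ y := by
    have c1 := continuous_fluxCurve hbg hxi (κ := κ) (Φ := Φ)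
    have c2 := continuous_sourceCurve hbg ℓ hxi (κ := κ) (Φ := Φ)
    have c3 := hχ.continuous
    have c4 := hχ'.continuous
    have c5 := hχ''.continuous
    fun_prop
  rw [intervalIntegral.integral_eq_sub_of_hasDerivAt_of_le hxi.2.le hcont (fun x hx => ?_)
    (cI.intervalIntegrable _ _), hM0.self_of_nhds, zero_sub]
  · have e0 : u xi = sobolevD 3 2 0 (by norm_num) f :=
      CharSystem.field_a (D := hbg.charSystem ℓ hκ hxi)
    have e1 : inField hbg ℓ hxi hκ f g φ xi = inData G κ xi f g :=
      CharSystem.ingoing_a (D := hbg.charSystem ℓ hκ hxi)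
    have e2 : outField hbg ℓ hxi hκ f g φ xi = outData G κ xi f g :=
      CharSystem.outgoing_a (D := hbg.charSystem ℓ hκ hxi)
    have e3 : weakDL 2 0 (sobolevD 3 2 0 (by norm_num) f) = weakD f 0 := rfl
    have e4 : weakDL 2 0 (sobolevD 3 2 1 (by norm_num) f) = weakD f 1 := rfl
    have e5 : weakDL 2 0 g = weakD g 0 := rfl
    rw [deriv_mul_test (hbg.analyticOnNhd_coeffA xi hxi.2.le) hχ]
    simp only [hM, hDm, e0, e1, e2, inData, outData, map_add, map_smul, e3, e4, e5, coeffX,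
      coeffB]
    module
  · refine (hMd x (Ioo_subset_Ico_self hx)).congr_deriv ?_
    obtain ⟨k0, k1, k2⟩ := hcurve x (Ioo_subset_Icc_self hx)
    rw [hDeq x ⟨hxi.1.trans hx.1, hx.2⟩]
    simp only [fluxCurve, sourceCurve, weakSource, clamp_of_mem (Ioo_subset_Icc_self hx), k0, k1,
      k2, coeffX, hbg.deriv_coeffX κ hx.2.le]
    module

/-- The characteristic system in `H²` has a solution, and this is the reconstructed field. -/
lemma exists_waveField (f : SobolevSpace 3) (g : SobolevSpace 2) :
    ∃ φ : ℝ → SobolevSpace 2, Continuous φ ∧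
      ∀ x ∈ Icc xi xc, waveField hbg ℓ hxi hκ f g φ x = φ x := by
  obtain ⟨φ, h1, -, h3⟩ := CharSystem.exists_field (hbg.charSystem ℓ hκ hxi) (translation 2)
    (inData G κ xi f g) (outData G κ xi f g) (sobolevD 3 2 0 (by norm_num) f)
  exact ⟨φ, h1, h3⟩

/-- Solutions in the sense of distributions agree with the solution of the characteristic
system. -/
lemma IsSolution.sobolevD_eq {Φ : C(Icc xi xc, SobolevSpace 3)}
    (hΦ : IsSolution G ψ ℓ κ hxi.2.le Φ f g) (hφ : Continuous φ)
    (hfix : ∀ x ∈ Icc xi xc, waveField hbg ℓ hxi hκ f g φ x = φ x) (x : Icc xi xc) :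
    sobolevD 3 2 0 (by norm_num) (Φ x) = φ x := by
  refine SobolevSpace.ext_zero ?_
  have h := CharSystem.field_unique (D := hbg.charSystem ℓ hκ hxi) (T := translationL2)
    (φ' := fun y => weakDL 2 0 (φ y))
    (continuous_curveD hxi.2.le Φ 0) ((weakDL 2 0).continuous.comp hφ)
    (fun y hy => hΦ.field_eq hbg ℓ hxi hκ hy) (fun y hy => by
      have e := CharSystem.map_field (D := hbg.charSystem ℓ hκ hxi) (T := translation 2)
        (T' := translationL2) (ι := weakDL 2 0) (P₀ := inData G κ xi f g)
        (Q₀ := outData G κ xi f g) (f := sobolevD 3 2 0 (by norm_num) f) (fun _ _ => rfl) hφ hy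
      have e' := congrArg (weakDL 2 0) (hfix y hy)
      exact e.symm.trans e') x x.2
  rw [curveD, IccExtend_of_mem _ _ x.2] at h
  exact h

include hbg hκ in
lemma existsUnique_isSolution (f : SobolevSpace 3) (g : SobolevSpace 2) :
    ∃! Φ : C(Icc xi xc, SobolevSpace 3), IsSolution G ψ ℓ κ hxi.2.le Φ f g := by
  obtain ⟨φ, hφ, hfix⟩ := exists_waveField hbg ℓ hxi hκ f g
  refine ⟨_, isSolution_solutionCurve hbg ℓ hxi hκ hφ hfix, fun Φ hΦ => ?_⟩
  ext1 x
  refine SobolevSpace.ext_zero ?_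
  have h1 := hΦ.sobolevD_eq hbg ℓ hxi hκ hφ hfix x
  have h2 := (isSolution_solutionCurve hbg ℓ hxi hκ hφ hfix).sobolevD_eq hbg ℓ hxi hκ hφ hfix x
  exact (congrArg (fun u : SobolevSpace 2 => weakD u 0) (h1.trans h2.symm) :)

end

/-! ### The classical solution -/

/-- A function of two variables with `C^n` partial derivatives is `C^{n+1}`. -/
lemma contDiffOn_succ_of_partial {a b : ℝ} {n : ℕ} {F F₁ F₂ : ℝ → ℝ → ℝ}
    (h₁ : ∀ x ∈ Ioo a b, ∀ ρ, HasDerivAt (fun y => F y ρ) (F₁ x ρ) x)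
    (h₂ : ∀ x ∈ Ioo a b, ∀ ρ, HasDerivAt (F x) (F₂ x ρ) ρ)
    (c₁ : ContDiffOn ℝ n (fun p : ℝ × ℝ => F₁ p.1 p.2) (Ioo a b ×ˢ univ))
    (c₂ : ContDiffOn ℝ n (fun p : ℝ × ℝ => F₂ p.1 p.2) (Ioo a b ×ˢ univ)) :
    ContDiffOn ℝ (n + 1) (fun p : ℝ × ℝ => F p.1 p.2) (Ioo a b ×ˢ univ) := by
  have hO : IsOpen (Ioo a b ×ˢ (univ : Set ℝ)) := isOpen_Ioo.prod isOpen_univ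
  set L₁ : ℝ → ℝ → ℝ →L[ℝ] ℝ := fun x ρ => ContinuousLinearMap.toSpanSingleton ℝ (F₁ x ρ) with hL₁
  set L₂ : ℝ → ℝ → ℝ →L[ℝ] ℝ := fun x ρ => ContinuousLinearMap.toSpanSingleton ℝ (F₂ x ρ) with hL₂
  have hL : ∀ p ∈ Ioo a b ×ˢ (univ : Set ℝ), HasFDerivAt (fun p : ℝ × ℝ => F p.1 p.2)
      ((L₁ p.1 p.2).coprod (L₂ p.1 p.2)) p := by
    intro p hp
    have hev : ∀ᶠ q in 𝓝 p, q ∈ Ioo a b ×ˢ (univ : Set ℝ) := hO.mem_nhds hp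
    have hc : Continuous fun t : ℝ => ContinuousLinearMap.toSpanSingleton ℝ t :=
      (ContinuousLinearMap.toSpanSingletonCLE (𝕜 := ℝ) (E := ℝ)).continuous
    exact (hasStrictFDerivAt_uncurry_coprod (f := F) (f₁ := L₁) (f₂ := L₂)
      (hev.mono fun q hq => (h₁ q.1 hq.1 q.2).hasFDerivAt)
      (hev.mono fun q hq => (h₂ q.1 hq.1 q.2).hasFDerivAt)
      (hc.continuousAt.comp (c₁.continuousOn.continuousAt (hO.mem_nhds hp)))
      (hc.continuousAt.comp (c₂.continuousOn.continuousAt (hO.mem_nhds hp)))).hasFDerivAt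
  rw [contDiffOn_succ_iff_fderiv_of_isOpen hO]
  refine ⟨fun p hp => (hL p hp).differentiableAt.differentiableWithinAt, by simp, ?_⟩
  have h3 : ContDiffOn ℝ n (fun p : ℝ × ℝ => F₁ p.1 p.2 • ContinuousLinearMap.fst ℝ ℝ ℝ
      + F₂ p.1 p.2 • ContinuousLinearMap.snd ℝ ℝ ℝ) (Ioo a b ×ˢ univ) :=
    (c₁.smul contDiffOn_const).add (c₂.smul contDiffOn_const)
  refine h3.congr fun p hp => ?_
  rw [(hL p hp).fderiv]
  ext <;> simp [hL₁, hL₂]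

lemma continuousOn_evalL {s : Set ℝ} {w : ℝ → SobolevSpace 1} (hw : ContinuousOn w s) :
    ContinuousOn (fun p : ℝ × ℝ => evalL p.2 (w p.1)) (s ×ˢ univ) :=
  continuous_evalL.comp_continuousOn (continuousOn_snd.prodMk
    (hw.comp continuousOn_fst fun _ hp => hp.1))

lemma HasDerivAt.evalL {w : ℝ → SobolevSpace 1} {w' : SobolevSpace 1} {x : ℝ}
    (h : HasDerivAt w w' x) (ρ : ℝ) : HasDerivAt (fun y => evalL ρ (w y)) (evalL ρ w') x :=
  (_root_.evalL ρ).hasFDerivAt.comp_hasDerivAt x h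

section

variable {G ψ : ℝ → ℝ} {xc : ℝ} (hbg : IsBackground G ψ xc) (ℓ : ℕ) {xi : ℝ} (hxi : xi ∈ Ioo 0 xc)
  {κ : ℝ} (hκ : κ < 1) {f : SobolevSpace 3} {g : SobolevSpace 2} {φ : ℝ → SobolevSpace 2}

include hbg in
lemma IsBackground.hasDerivAt_dτ {x : ℝ} (hx : x ∈ Ioo 0 xc) :
    HasDerivAt (fun x => G x / (1 - x * G x)) ((deriv G x * (1 - x * G x)
      + G x * (G x + x * deriv G x)) / (1 - x * G x) ^ 2) x := by
  refine ((hbg.hasDerivAt_G hx.2.le).div (hbg.hasDerivAt_lapse hx.2.le)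
    (hbg.lapse_pos hx).ne').congr_deriv ?_
  congr 1
  ring

/-- The continuous representative of the `x`-velocity has a continuous `x`-derivative. -/
lemma exists_hasDerivAt_waveVelocity (hφ : Continuous φ) : ∃ v' : ℝ → SobolevSpace 1,
    ContinuousOn v' (Ioo 0 xc) ∧ ∀ x ∈ Ioo 0 xc, HasDerivAt
      (fun y => sobolevD 2 1 0 (by norm_num) (waveVelocity hbg ℓ hxi hκ f g φ y)) (v' x) x := by
  set P := inField hbg ℓ hxi hκ f g φ with hP
  set Q := outField hbg ℓ hxi hκ f g φ with hQ
  set ι := sobolevD 2 1 0 (by norm_num) with hι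
  set δ := sobolevD 2 1 1 (by norm_num) with hδ
  set P' : ℝ → SobolevSpace 1 := fun x => -(G x / (1 - x * G x)) • (δ (P x)
        + (1 - κ) • ι (P x))
        + ((ℓ : ℝ) * ((ℓ : ℝ) + 1) * Real.exp (ψ x) - 2 * x * deriv G x) • ι (φ x) with hP'
  set Q' : ℝ → SobolevSpace 1 := fun x => x⁻¹ • (δ (Q x) + (1 - κ) • ι (Q x))
        + ((ℓ : ℝ) * ((ℓ : ℝ) + 1) * Real.exp (ψ x) - 2 * x * deriv G x) • ι (φ x) with hQ'
  have dP : ∀ x ∈ Ioo 0 xc, HasDerivAt (fun y => ι (P y)) (P' x) x := fun x hx =>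
    hasDerivAt_inField hbg ℓ hxi hκ (isGenerator_sobolevD 2 1 0 (by norm_num))
      (fun _ _ => rfl) (fun _ _ => rfl) hφ hx
  have dQ : ∀ x ∈ Ioo 0 xc, HasDerivAt (fun y => ι (Q y)) (Q' x) x := fun x hx =>
    hasDerivAt_outField hbg ℓ hxi hκ (isGenerator_sobolevD 2 1 0 (by norm_num))
      (fun _ _ => rfl) (fun _ _ => rfl) hφ hx
  have cP : ContinuousOn P (Ioo 0 xc) := continuousOn_inField hbg ℓ hxi hκ hφ
  have cQ : ContinuousOn Q (Ioo 0 xc) :=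
    (continuousOn_outField hbg ℓ hxi hκ hφ).mono Ioo_subset_Ioc_self
  have cG : ContinuousOn G (Ioo 0 xc) := hbg.continuousOn_G.mono fun x hx => hx.2.le
  have cG' : ContinuousOn (deriv G) (Ioo 0 xc) := hbg.continuousOn_deriv_G.mono fun x hx => hx.2.le
  have cψ : ContinuousOn ψ (Ioo 0 xc) :=
    hbg.analytic_psi.continuousOn.mono fun x hx => hx.2.le
  have hN : ∀ x ∈ Ioo 0 xc, 1 - x * G x ≠ 0 := fun x hx => (hbg.lapse_pos hx).ne'
  have hN2 : ∀ x ∈ Ioo 0 xc, (1 - x * G x) ^ 2 ≠ 0 := fun x hx => pow_ne_zero 2 (hN x hx)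
  have hx0 : ∀ x ∈ Ioo 0 xc, x ≠ 0 := fun x hx => hx.1.ne'
  have cι : ∀ {w : ℝ → SobolevSpace 2}, ContinuousOn w (Ioo 0 xc) →
      ContinuousOn (fun x => ι (w x)) (Ioo 0 xc) := fun h => ι.continuous.comp_continuousOn h
  have cδ : ∀ {w : ℝ → SobolevSpace 2}, ContinuousOn w (Ioo 0 xc) →
      ContinuousOn (fun x => δ (w x)) (Ioo 0 xc) := fun h => δ.continuous.comp_continuousOn h
  have hv : ∀ y, ι (waveVelocity hbg ℓ hxi hκ f g φ y)
      = (-(1 / 2) : ℝ) • ((G y / (1 - y * G y)) • ι (P y) + y⁻¹ • ι (Q y)) := by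
    intro y
    have e : waveVelocity hbg ℓ hxi hκ f g φ y = (-(1 / 2) : ℝ) • ((G y / (1 - y * G y)) •
      P y + y⁻¹ • Q y) := rfl
    rw [e, map_smul, map_add, map_smul, map_smul]
  clear_value ι δ P Q
  have c1 := cι cP
  have c2 := cι cQ
  have c3 := cδ cP
  have c4 := cδ cQ
  have c5 := cι hφ.continuousOn
  have cinv : ContinuousOn (fun x : ℝ => x⁻¹) (Ioo 0 xc) := continuousOn_id.inv₀ hx0
  have cW : ContinuousOn (fun x => (ℓ : ℝ) * ((ℓ : ℝ) + 1) * Real.exp (ψ x)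
      - 2 * x * deriv G x) (Ioo 0 xc) := by fun_prop
  have cP' : ContinuousOn P' (Ioo 0 xc) :=
    (hbg.continuousOn_dτ.neg.smul (c3.add (c1.const_smul (1 - κ)))).add (cW.smul c5)
  have cQ' : ContinuousOn Q' (Ioo 0 xc) :=
    (cinv.smul (c4.add (c2.const_smul (1 - κ)))).add (cW.smul c5)
  clear_value P' Q'
  refine ⟨fun x => (-(1 / 2) : ℝ) • (((G x / (1 - x * G x)) • P' x + ((deriv G x * (1 - x * G x)
      + G x * (G x + x * deriv G x)) / (1 - x * G x) ^ 2) • ι (P x))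
      + (x⁻¹ • Q' x + (-(x ^ 2)⁻¹) • ι (Q x))), ?_, fun x hx => ?_⟩
  · have d1 := hbg.continuousOn_dτ
    have d2 : ContinuousOn (fun x => (deriv G x * (1 - x * G x)
      + G x * (G x + x * deriv G x)) / (1 - x * G x) ^ 2) (Ioo 0 xc) := by
      refine ContinuousOn.div (by fun_prop) (by fun_prop) hN2
    have d3 : ContinuousOn (fun x : ℝ => (x ^ 2)⁻¹) (Ioo 0 xc) :=
      (continuousOn_pow 2).inv₀ fun x hx => pow_ne_zero 2 (hx0 x hx)
    exact (((d1.smul cP').add (d2.smul c1)).add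
      ((cinv.smul cQ').add (d3.neg.smul c2))).const_smul (-(1 / 2) : ℝ)
  · have h := (((hbg.hasDerivAt_dτ hx).smul (dP x hx)).add
      ((hasDerivAt_inv (hx0 x hx)).smul (dQ x hx))).const_smul (-(1 / 2) : ℝ)
    exact h.congr_of_eventuallyEq (Eventually.of_forall hv)

/-- The continuous representative of the reconstructed field. -/
def classicalField (f : SobolevSpace 3) (g : SobolevSpace 2) (φ : ℝ → SobolevSpace 2)
    (x ρ : ℝ) : ℝ :=
  evalL ρ (sobolevD 2 1 0 (by norm_num) (waveField hbg ℓ hxi hκ f g φ x))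

lemma hasDerivAt_classicalField_left (hφ : Continuous φ) {x : ℝ} (hx : x ∈ Ioo 0 xc) (ρ : ℝ) :
    HasDerivAt (fun y => classicalField hbg ℓ hxi hκ f g φ y ρ)
      (evalL ρ (sobolevD 2 1 0 (by norm_num) (waveVelocity hbg ℓ hxi hκ f g φ x))) x :=
  HasDerivAt.evalL ((sobolevD 2 1 0 (by norm_num)).hasFDerivAt.comp_hasDerivAt x
    (hasDerivAt_waveField hbg ℓ hxi hκ hφ hx)) ρ

lemma hasDerivAt_classicalField_right (hφ : Continuous φ) {x : ℝ} (hx : x ∈ Ioc 0 xc) (ρ : ℝ) :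
    HasDerivAt (classicalField hbg ℓ hxi hκ f g φ x)
      (evalL ρ (sobolevD 2 1 0 (by norm_num) (waveSlope hbg ℓ hxi hκ f g φ x))) ρ := by
  rw [sobolevD_waveSlope hbg ℓ hxi hκ hφ hx]
  exact hasDerivAt_evalL _ ρ

lemma hasDerivAt_slope_left (hφ : Continuous φ) {x : ℝ} (hx : x ∈ Ioo 0 xc) (ρ : ℝ) :
    HasDerivAt (fun y => evalL ρ (sobolevD 2 1 0 (by norm_num) (waveSlope hbg ℓ hxi hκ f g φ y)))
      (evalL ρ (sobolevD 2 1 1 (by norm_num) (waveVelocity hbg ℓ hxi hκ f g φ x))) x := by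
  refine (HasDerivAt.evalL ((sobolevD 2 1 1 (by norm_num)).hasFDerivAt.comp_hasDerivAt x
    (hasDerivAt_waveField hbg ℓ hxi hκ hφ hx)) ρ).congr_of_eventuallyEq ?_
  filter_upwards [Ioo_mem_nhds hx.1 hx.2] with y hy
  rw [sobolevD_waveSlope hbg ℓ hxi hκ hφ (Ioo_subset_Ioc_self hy)]
  rfl

lemma continuousOn_waveVelocity (hφ : Continuous φ) :
    ContinuousOn (waveVelocity hbg ℓ hxi hκ f g φ) (Ioo 0 xc) :=
  CharSystem.continuousOn_velocity (D := hbg.charSystem ℓ hκ hxi) hφ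

/-- Velocity and slope are `H²`-valued, so every second partial derivative is the evaluation of a
continuous `H¹`-valued curve. -/
lemma contDiffOn_classicalField (hφ : Continuous φ) :
    ContDiffOn ℝ 2 (fun p : ℝ × ℝ => classicalField hbg ℓ hxi hκ f g φ p.1 p.2)
      (Ioo 0 xc ×ˢ univ) := by
  obtain ⟨v', cv', hv'⟩ := exists_hasDerivAt_waveVelocity hbg ℓ hxi hκ (f := f) (g := g) hφ
  have cv := continuousOn_waveVelocity hbg ℓ hxi hκ (f := f) (g := g) hφ
  have cσ := (continuousOn_waveSlope hbg ℓ hxi hκ (f := f) (g := g) hφ).mono Ioo_subset_Ioc_self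
  have h01 : ∀ {w : ℝ → SobolevSpace 1}, ContinuousOn w (Ioo 0 xc) →
      ContDiffOn ℝ ((0 : ℕ) : WithTop ℕ∞) (fun p : ℝ × ℝ => evalL p.2 (w p.1))
        (Ioo 0 xc ×ˢ univ) :=
    fun hw => contDiffOn_zero.2 (continuousOn_evalL hw)
  have hδv := (sobolevD 2 1 1 (by norm_num)).continuous.comp_continuousOn cv
  have hδσ := (sobolevD 2 1 1 (by norm_num)).continuous.comp_continuousOn cσ
  refine contDiffOn_succ_of_partial (n := 1)
    (fun x hx ρ => hasDerivAt_classicalField_left hbg ℓ hxi hκ hφ hx ρ)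
    (fun x hx ρ => hasDerivAt_classicalField_right hbg ℓ hxi hκ hφ (Ioo_subset_Ioc_self hx) ρ)
    (contDiffOn_succ_of_partial (n := 0)
      (F := fun x ρ => evalL ρ (sobolevD 2 1 0 (by norm_num) (waveVelocity hbg ℓ hxi hκ f g φ x)))
      (fun x hx ρ => HasDerivAt.evalL (hv' x hx) ρ)
      (fun x hx ρ => hasDerivAt_evalL _ ρ) (h01 cv') (h01 hδv))
    (contDiffOn_succ_of_partial (n := 0)
      (F := fun x ρ => evalL ρ (sobolevD 2 1 0 (by norm_num) (waveSlope hbg ℓ hxi hκ f g φ x)))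
      (fun x hx ρ => hasDerivAt_slope_left hbg ℓ hxi hκ hφ hx ρ)
      (fun x hx ρ => hasDerivAt_evalL _ ρ) (h01 hδv) (h01 hδσ))

lemma waveOp_classicalField (hφ : Continuous φ) {x : ℝ} (hx : x ∈ Ioo 0 xc)
    (hfix : waveField hbg ℓ hxi hκ f g φ x = φ x) (ρ : ℝ) :
    waveOp G ψ ℓ κ (classicalField hbg ℓ hxi hκ f g φ) x ρ = 0 := by
  obtain ⟨v', -, hv'⟩ := exists_hasDerivAt_waveVelocity hbg ℓ hxi hκ (f := f) (g := g) hφ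
  set ι := sobolevD 2 1 0 (by norm_num) with hι
  set δ := sobolevD 2 1 1 (by norm_num) with hδ
  set u := waveField hbg ℓ hxi hκ f g φ with hu
  set v := waveVelocity hbg ℓ hxi hκ f g φ with hv
  set σ := waveSlope hbg ℓ hxi hκ f g φ with hσ
  have hIoo : ∀ᶠ y in 𝓝 x, y ∈ Ioo 0 xc := Ioo_mem_nhds hx.1 hx.2
  have e1 : deriv (fun s => classicalField hbg ℓ hxi hκ f g φ s ρ) =ᶠ[𝓝 x]
      fun y => evalL ρ (ι (v y)) := hIoo.mono fun y hy =>
    (hasDerivAt_classicalField_left hbg ℓ hxi hκ hφ hy ρ).deriv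
  have e2 : deriv (classicalField hbg ℓ hxi hκ f g φ x) = fun ρ => evalL ρ (ι (σ x)) :=
    funext fun ρ => (hasDerivAt_classicalField_right hbg ℓ hxi hκ hφ (Ioo_subset_Ioc_self hx)
      ρ).deriv
  have e3 : (fun s => deriv (classicalField hbg ℓ hxi hκ f g φ s) ρ) =ᶠ[𝓝 x]
      fun y => evalL ρ (ι (σ y)) := hIoo.mono fun y hy =>
    (hasDerivAt_classicalField_right hbg ℓ hxi hκ hφ (Ioo_subset_Ioc_self hy) ρ).deriv
  have d1 : iteratedDeriv 2 (fun s => classicalField hbg ℓ hxi hκ f g φ s ρ) x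
      = evalL ρ (v' x) := by
    rw [iteratedDeriv_succ, iteratedDeriv_one, e1.deriv_eq]
    exact (HasDerivAt.evalL (hv' x hx) ρ).deriv
  have d2 : deriv (fun s => deriv (classicalField hbg ℓ hxi hκ f g φ s) ρ) x
      = evalL ρ (δ (v x)) := by
    rw [e3.deriv_eq]
    exact (hasDerivAt_slope_left hbg ℓ hxi hκ hφ hx ρ).deriv
  have d3 : iteratedDeriv 2 (classicalField hbg ℓ hxi hκ f g φ x) ρ = evalL ρ (δ (σ x)) := by
    rw [iteratedDeriv_succ, iteratedDeriv_one, e2]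
    exact (hasDerivAt_evalL _ ρ).deriv
  have hD := HasDerivAt.evalL (hasDerivAt_momentumField hbg ℓ hxi hκ
    (isGenerator_sobolevD 2 1 0 (by norm_num)) (fun _ _ => rfl) (fun _ _ => rfl) hφ hx hfix
    (sobolevD_waveSlope hbg ℓ hxi hκ hφ (f := f) (g := g) (Ioo_subset_Ioc_self hx))) ρ
  have dA := (hbg.analyticOnNhd_coeffA x hx.2.le).differentiableAt.hasDerivAt
  have dB := (hbg.analyticOnNhd_coeffB x hx.2.le).differentiableAt.hasDerivAt
  have hD' := (dA.mul (HasDerivAt.evalL (hv' x hx) ρ)).add ((dB.const_mul 2).mul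
    ((hasDerivAt_slope_left hbg ℓ hxi hκ (f := f) (g := g) hφ hx ρ).add
      ((hasDerivAt_classicalField_left hbg ℓ hxi hκ (f := f) (g := g) hφ hx ρ).const_mul (1 - κ))))
  -- The momentum is differentiated in two ways: by the transport equations, and by the product rule
  -- from `α φ̃_x + 2β A φ̃`. Equality of the two results is the wave equation.
  have key := hD.unique (hD'.congr_of_eventuallyEq (hIoo.mono fun y hy => by
    have := congrArg (fun w => evalL ρ (ι w)) (coeffA_smul_waveVelocity hbg ℓ hxi hκ (f := f)
      (g := g) (φ := φ) hy)
    simp only [map_add, map_smul] at this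
    simp only [map_add, map_smul]
    exact this.symm))
  have e4 : deriv (fun s => classicalField hbg ℓ hxi hκ f g φ s ρ) x = evalL ρ (ι (v x)) :=
    e1.self_of_nhds
  have e5 : deriv (classicalField hbg ℓ hxi hκ f g φ x) ρ = evalL ρ (ι (σ x)) :=
    congrFun e2 ρ
  rw [waveOp, d1, d2, d3, e4, e5]
  have e6 : classicalField hbg ℓ hxi hκ f g φ x ρ = evalL ρ (ι (u x)) := rfl
  simp only [map_neg, map_add, map_smul, smul_eq_mul, ← hι, ← hδ, ← hu, ← hv, ← hσ, e6,
    Pi.add_apply] at key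
  rw [e6, coeffX]
  linear_combination -key

lemma waveVelocity_initial : waveVelocity hbg ℓ hxi hκ f g φ xi = g := by
  have e1 : inField hbg ℓ hxi hκ f g φ xi = inData G κ xi f g :=
    CharSystem.ingoing_a (D := hbg.charSystem ℓ hκ hxi)
  have e2 : outField hbg ℓ hxi hκ f g φ xi = outData G κ xi f g :=
    CharSystem.outgoing_a (D := hbg.charSystem ℓ hκ hxi)
  have e : waveVelocity hbg ℓ hxi hκ f g φ xi = (-(1 / 2) : ℝ) • ((G xi / (1 - xi * G xi)) •
    inField hbg ℓ hxi hκ f g φ xi + xi⁻¹ • outField hbg ℓ hxi hκ f g φ xi) := rfl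
  have h1 := (hbg.lapse_pos hxi).ne'
  have h2 := hxi.1.ne'
  rw [e, e1, e2, inData, outData]
  simp only [coeffA, coeffB]
  have h3 : 1 - G xi * xi ≠ 0 := by rwa [mul_comm]
  match_scalars <;> field_simp <;> ring

lemma isClassicalVersion_classicalField {Φ : C(Icc xi xc, SobolevSpace 3)}
    (hΦ : IsSolution G ψ ℓ κ hxi.2.le Φ f g) (hφ : Continuous φ)
    (hfix : ∀ x ∈ Icc xi xc, waveField hbg ℓ hxi hκ f g φ x = φ x) :
    IsClassicalVersion G ψ ℓ κ Φ f g (classicalField hbg ℓ hxi hκ f g φ) where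
  represents x := by
    refine (evalL_ae_eq _).trans (Eventually.of_forall fun ρ => ?_)
    have := hΦ.sobolevD_eq hbg ℓ hxi hκ hφ hfix x
    rw [← hfix x x.2] at this
    rw [← this]
    rfl
  smooth := (contDiffOn_classicalField hbg ℓ hxi hκ hφ).mono
    (prod_mono (fun _ hx => ⟨hxi.1.trans_le hx.1, hx.2⟩) Subset.rfl)
  wave_eq x hx ρ := waveOp_classicalField hbg ℓ hxi hκ hφ ⟨hxi.1.trans hx.1, hx.2⟩
    (hfix x (Ioo_subset_Icc_self hx)) ρ
  initial := by
    refine (evalL_ae_eq _).trans (Eventually.of_forall fun ρ => ?_)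
    have e0 : waveField hbg ℓ hxi hκ f g φ xi = sobolevD 3 2 0 (by norm_num) f :=
      CharSystem.field_a (D := hbg.charSystem ℓ hκ hxi)
    rw [e0]
    rfl
  initial_deriv := by
    filter_upwards [evalL_ae_eq (sobolevD 2 1 0 (by norm_num) g)] with ρ hρ
    have h := hasDerivAt_classicalField_left hbg ℓ hxi hκ (f := f) (g := g) hφ hxi ρ
    rw [waveVelocity_initial, hρ] at h
    exact h.hasDerivWithinAt

/-- A classical version is given by the representatives of the solution of the characteristic
system. -/
lemma IsClassicalVersion.eq_classicalField {Φ : C(Icc xi xc, SobolevSpace 3)} {φt : ℝ → ℝ → ℝ}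
    (h : IsClassicalVersion G ψ ℓ κ Φ f g φt)
    (hΦ : IsSolution G ψ ℓ κ hxi.2.le Φ f g) (hφ : Continuous φ)
    (hfix : ∀ x ∈ Icc xi xc, waveField hbg ℓ hxi hκ f g φ x = φ x) {x : ℝ} (hx : x ∈ Ico xi xc) :
    φt x = classicalField hbg ℓ hxi hκ f g φ x := by
  have h1 : Continuous (φt x) := h.smooth.continuousOn.comp_continuous
    (by fun_prop : Continuous fun ρ : ℝ => (x, ρ)) fun ρ => ⟨hx, mem_univ _⟩
  have h2 : Continuous (classicalField hbg ℓ hxi hκ f g φ x) :=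
    continuous_evalL.comp (by fun_prop : Continuous fun ρ : ℝ => (ρ,
      sobolevD 2 1 0 (Nat.le_succ 1) (waveField hbg ℓ hxi hκ f g φ x)))
  refine (Continuous.ae_eq_iff_eq volume h1 h2).1 ?_
  exact (h.represents ⟨x, Ico_subset_Icc_self hx⟩).trans
    ((isClassicalVersion_classicalField hbg ℓ hxi hκ hΦ hφ hfix).represents
      ⟨x, Ico_subset_Icc_self hx⟩).symm

end

/-! ### Resolvents of the generator -/

namespace IsometryGroup

variable {X : Type*} [NormedAddCommGroup X] [NormedSpace ℝ X] (T : IsometryGroup X) {d : ℝ}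

/-- `(d + ∂)⁻¹ h`, for the generator `∂` of `T`. -/
def resolvent (d : ℝ) (h : X) : X := ∫ s in Iic (0 : ℝ), T.wact d s h

lemma continuous_wact_left (h : X) : Continuous fun s => T.wact d s h :=
  (T.continuous_wact d).comp (by fun_prop : Continuous fun r : ℝ => (r, h))

lemma integrableOn_wact (hd : 0 < d) (h : X) (s : ℝ) :
    IntegrableOn (fun r => T.wact d r h) (Iic s) := by
  refine ((integrableOn_exp_mul_Iic hd s).mul_const ‖h‖).mono'
    (T.continuous_wact_left h).aestronglyMeasurable (Eventually.of_forall fun r => ?_)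
  rw [T.norm_wact]

lemma norm_resolvent_le (hd : 0 < d) (h : X) : ‖T.resolvent d h‖ ≤ ‖h‖ / d := by
  refine (norm_integral_le_of_norm_le ((integrableOn_exp_mul_Iic hd 0).mul_const ‖h‖)
    (Eventually.of_forall fun r => (T.norm_wact d r h).le)).trans (le_of_eq ?_)
  rw [integral_mul_const, integral_exp_mul_Iic hd]
  simp only [mul_zero, Real.exp_zero]
  ring

variable [CompleteSpace X]

/-- Applying `T.wact d s` shifts the domain of integration to `(-∞, s]`. Hence the orbit of a
resolvent is differentiable, even if that of `h` is not. -/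
lemma wact_resolvent (hd : 0 < d) (h : X) (s : ℝ) :
    T.wact d s (T.resolvent d h) = T.resolvent d h + ∫ r in (0 : ℝ)..s, T.wact d r h := by
  have h1 : T.wact d s (T.resolvent d h) = ∫ r in Iic s, T.wact d r h := by
    rw [resolvent, ← (T.wact d s).integral_comp_comm (T.integrableOn_wact hd h 0)]
    have := (measurePreserving_add_left volume s).setIntegral_preimage_emb
      (measurableEmbedding_addLeft s) (fun r => T.wact d r h) (Iic s)
    rw [preimage_const_add_Iic, sub_self] at this
    rw [← this]
    simp only [T.wact_add]
  rw [h1, ← intervalIntegral.integral_Iic_sub_Iic (T.integrableOn_wact hd h 0)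
    (T.integrableOn_wact hd h s), resolvent]
  abel

lemma hasDerivAt_wact_resolvent (hd : 0 < d) (h : X) (s : ℝ) :
    HasDerivAt (fun s => T.wact d s (T.resolvent d h)) (T.wact d s h) s :=
  (((T.continuous_wact_left h).integral_hasStrictDerivAt 0 s).hasDerivAt.const_add
    (T.resolvent d h)).congr_of_eventuallyEq (Eventually.of_forall fun s =>
      T.wact_resolvent hd h s)

end IsometryGroup

/-! ### The limit of the velocity at the horizon -/

section

variable {G ψ : ℝ → ℝ} {xc : ℝ} (hbg : IsBackground G ψ xc) (ℓ : ℕ) {xi : ℝ} (hxi : xi ∈ Ioo 0 xc)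
  {κ : ℝ} (hκ : κ < 1) {f : SobolevSpace 3} {g : SobolevSpace 2} {φ : ℝ → SobolevSpace 2}

/-- The quotient of the coefficient `W` of the characteristic system and of `G` at the horizon. -/
def horizonRatio (G ψ : ℝ → ℝ) (ℓ : ℕ) (xc : ℝ) : ℝ :=
  ((ℓ : ℝ) * ((ℓ : ℝ) + 1) * Real.exp (ψ xc) - 2 * xc * deriv G xc) / G xc

/-- The limit of `(1 - xG)⁻¹` times the ingoing field. -/
def inLimit (G ψ : ℝ → ℝ) (ℓ : ℕ) (κ xc : ℝ) (φ : ℝ → SobolevSpace 2) : SobolevSpace 2 :=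
  (translation 2).resolvent (-κ - xc ^ 2 * deriv G xc) (horizonRatio G ψ ℓ xc • φ xc)

/-- The quotient `p = P / (1 - xG)` satisfies `p_x = τ' (-(∂ + δ) p + (W/G) φ)` with `δ = 1 - κ - (G
+ xG') / G`: the lapse in the denominator weakens the damping, and `δ → d = -κ - xc² G'(xc)`. In the
time `τ → ∞` this relaxes to the solution `R` of `(d + ∂) R = (W/G) φ` at `xc`. -/
lemma tendsto_inField_div (hκb : κ < -(xc ^ 2 * deriv G xc)) (hφ : Continuous φ) :
    Tendsto (fun x => (1 - x * G x)⁻¹ • inField hbg ℓ hxi hκ f g φ x) (𝓝[<] xc)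
      (𝓝 (inLimit G ψ ℓ κ xc φ)) := by
  have hxc := hbg.horizon_pos
  set D := hbg.charSystem ℓ hκ hxi with hD
  set T := translation 2 with hT
  set d := -κ - xc ^ 2 * deriv G xc with hd
  have hd0 : 0 < d := by rw [hd]; linarith
  set w : ℝ → ℝ := fun x =>
    ((ℓ : ℝ) * ((ℓ : ℝ) + 1) * Real.exp (ψ x) - 2 * x * deriv G x) / G x with hw
  set k := w xc • φ xc with hk
  set R := T.resolvent d k with hR
  change Tendsto _ _ (𝓝 R)
  set δ : ℝ → ℝ := fun x => (1 - κ) - (G x + x * deriv G x) / G x with hδ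
  -- The accumulated damping of `p`: `θ' = τ' δ` and `e^θ = e^{(1-κ)τ} (1 - xG)`.
  set θ : ℝ → ℝ := fun x => (1 - κ) * D.τ x + Real.log (1 - x * G x) with hθ
  have hGc := hbg.G_pos ⟨hxc, le_rfl⟩
  have hδt : Tendsto δ (𝓝[<] xc) (𝓝 d) := by
    have h1 := (hbg.tendsto_lapse_deriv.div
      (IsBackground.tendsto_of_continuousOn hbg.continuousOn_G) hGc.ne').const_sub (1 - κ)
    have h2 : 1 - κ - (1 + xc ^ 2 * deriv G xc) / xc / G xc = d := by
      rw [hbg.G_horizon, hd]; field_simp; ring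
    rwa [h2] at h1
  have hwt : Tendsto w (𝓝[<] xc) (𝓝 (w xc)) := by
    have h1 : ContinuousOn (fun x => (ℓ : ℝ) * ((ℓ : ℝ) + 1) * Real.exp (ψ x)
        - 2 * x * deriv G x) (Iic xc) :=
      (continuousOn_const.mul hbg.analytic_psi.rexp.continuousOn).sub
        ((continuousOn_const.mul continuousOn_id).mul hbg.continuousOn_deriv_G)
    exact (IsBackground.tendsto_of_continuousOn h1).div
      (IsBackground.tendsto_of_continuousOn hbg.continuousOn_G) hGc.ne'
  have hφt : Tendsto φ (𝓝[<] xc) (𝓝 (φ xc)) := (hφ.tendsto xc).mono_left nhdsWithin_le_nhds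
  have hθd : ∀ x ∈ Ioo 0 xc, HasDerivAt θ (D.dτ x * δ x) x := by
    intro x hx
    refine (((D.hasDerivAt_τ x hx).const_mul (1 - κ)).add
      ((hbg.hasDerivAt_lapse hx.2.le).log (hbg.lapse_pos hx).ne')).congr_deriv ?_
    change (1 - κ) * (G x / (1 - x * G x)) + _ = (G x / (1 - x * G x)) * _
    have h1 := (hbg.lapse_pos hx).ne'
    have h2 := (hbg.G_pos (Ioo_subset_Ioc_self hx)).ne'
    simp only [hδ]
    field_simp
    ring
  have hθt : Tendsto θ (𝓝[<] xc) atTop := by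
    refine tendsto_atTop_of_deriv_le hxc hθd
      (fun x hx => (D.hasDerivAt_τ x hx).const_mul (d / 2)) ?_
      ((hbg.tendsto_τ hxi).const_mul_atTop (half_pos hd0))
    filter_upwards [hδt.eventually (lt_mem_nhds (half_lt_self hd0)), Ioo_mem_nhdsLT hxc]
      with x hx hx'
    rw [mul_comm]
    exact mul_le_mul_of_nonneg_left hx.le (hbg.dτ_pos hx').le
  have hexp : ∀ x ∈ Ioo 0 xc, Real.exp (θ x) = Real.exp ((1 - κ) * D.τ x) * (1 - x * G x) := by
    intro x hx
    rw [hθ, Real.exp_add, Real.exp_log (hbg.lapse_pos hx)]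
  -- This is `e^θ T(τ) (p - R)`, written so that it can be differentiated in `H²`: the first part is
  -- a primitive, and the orbit of `R` is differentiable because `R` is a resolvent.
  set Y : ℝ → SobolevSpace 2 := fun x => inData G κ xi f g + D.inSource T φ x
    - Real.exp (θ x - d * D.τ x) • T.wact d (D.τ x) R with hY
  set F : ℝ → SobolevSpace 2 := fun x => (D.dτ x * Real.exp (θ x)) •
    T.act (D.τ x) (w x • φ x - k - (δ x - d) • R) with hF
  have key := tendsto_exp_neg_mul_norm hxi.2 hd0 (θ := θ) (dτ := D.dτ) (δ := δ) (Y := Y) (F := F)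
    (ε := fun x => ‖w x • φ x - k‖ + |δ x - d| * ‖R‖)
    (fun x hx => hθd x ⟨hxi.1.trans hx.1, hx.2⟩)
    (fun x hx => (hbg.dτ_pos ⟨hxi.1.trans hx.1, hx.2⟩).le) (fun x hx => ?_) (fun x hx => ?_) hδt
    (by
      have h1 := ((hwt.smul hφt).sub_const k).norm.add
        (((hδt.sub_const d).abs).mul_const ‖R‖)
      simpa [hk] using h1) hθt
  · refine tendsto_iff_norm_sub_tendsto_zero.2 (key.congr' ?_)
    filter_upwards [Ioo_mem_nhdsLT hxi.2] with x hx
    have hx0 : x ∈ Ioo 0 xc := ⟨hxi.1.trans hx.1, hx.2⟩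
    have e1 : inData G κ xi f g + D.inSource T φ x
        = T.wact (1 - κ) (D.τ x) (inField hbg ℓ hxi hκ f g φ x) :=
      (T.wact_cancel_neg (1 - κ) (D.τ x) _).symm
    have e2 : Y x = Real.exp (θ x) • T.act (D.τ x)
        ((1 - x * G x)⁻¹ • inField hbg ℓ hxi hκ f g φ x - R) := by
      have h1 := (hbg.lapse_pos hx0).ne'
      simp only [hY, e1, IsometryGroup.wact_apply, map_sub, map_smul, smul_sub, smul_smul]
      rw [← Real.exp_add, sub_add_cancel]
      congr 2
      rw [hexp x hx0]
      field_simp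
    rw [e2, norm_smul, T.norm_act, Real.norm_of_nonneg (Real.exp_nonneg _), ← mul_assoc,
      ← Real.exp_add, neg_add_cancel, Real.exp_zero, one_mul]
  · have hx0 : x ∈ Ioo 0 xc := ⟨hxi.1.trans hx.1, hx.2⟩
    have h1 := (CharSystem.hasDerivAt_inSource (D := D) (T := T) hφ hx0).const_add
      (inData G κ xi f g)
    have h2 := ((hθd x hx0).sub ((D.hasDerivAt_τ x hx0).const_mul d)).exp
    have h3 := (T.hasDerivAt_wact_resolvent hd0 k (D.τ x)).scomp x (D.hasDerivAt_τ x hx0)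
    refine (h1.sub (h2.smul h3)).congr_deriv ?_
    have e1 : Real.exp ((1 - κ) * D.τ x) * (1 - x * G x) = Real.exp (θ x) := (hexp x hx0).symm
    have e2 : Real.exp (θ x - d * D.τ x) * Real.exp (d * D.τ x) = Real.exp (θ x) := by
      rw [← Real.exp_add, sub_add_cancel]
    have e3 : D.W x = (D.dτ x * (1 - x * G x)) * w x := by
      have h1 := (hbg.lapse_pos hx0).ne'
      have h2 := (hbg.G_pos (Ioo_subset_Ioc_self hx0)).ne'
      change ((ℓ : ℝ) * ((ℓ : ℝ) + 1) * Real.exp (ψ x) - 2 * x * deriv G x)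
        = (G x / (1 - x * G x) * (1 - x * G x)) * _
      simp only [hw]
      field_simp
    have e4 : D.c = 1 - κ := rfl
    simp only [hF, IsometryGroup.wact_apply, map_sub, map_smul, Function.comp_apply, ← hR, e4, e3]
    simp only [Pi.sub_apply]
    rw [← e1] at e2 ⊢
    match_scalars
    · ring
    · linear_combination (-D.dτ x) * e2
    · linear_combination (-D.dτ x * (δ x - d)) * e2
  · have h1 : 0 ≤ D.dτ x := (hbg.dτ_pos ⟨hxi.1.trans hx.1, hx.2⟩).le
    simp only [hF]
    rw [norm_smul, T.norm_act, Real.norm_of_nonneg (mul_nonneg h1 (Real.exp_nonneg _))]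
    refine mul_le_mul_of_nonneg_left ((norm_sub_le _ _).trans ?_)
      (mul_nonneg h1 (Real.exp_nonneg _))
    rw [norm_smul (δ x - d), Real.norm_eq_abs]

/-- The limit of the velocity at the horizon. -/
def velocityLimit (f : SobolevSpace 3) (g : SobolevSpace 2) (φ : ℝ → SobolevSpace 2) :
    SobolevSpace 2 :=
  (-(1 / 2) : ℝ) • (G xc • inLimit G ψ ℓ κ xc φ + xc⁻¹ • outField hbg ℓ hxi hκ f g φ xc)

lemma tendsto_outField (hφ : Continuous φ) : Tendsto (outField hbg ℓ hxi hκ f g φ) (𝓝[<] xc)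
    (𝓝 (outField hbg ℓ hxi hκ f g φ xc)) := by
  have h := continuousOn_outField hbg ℓ hxi hκ hφ (f := f) (g := g) xc ⟨hbg.horizon_pos, le_rfl⟩
  refine h.mono_left ?_
  rw [← nhdsWithin_Ioo_eq_nhdsLT hbg.horizon_pos]
  exact nhdsWithin_mono _ Ioo_subset_Ioc_self

lemma tendsto_waveVelocity (hκb : κ < -(xc ^ 2 * deriv G xc)) (hφ : Continuous φ) :
    Tendsto (waveVelocity hbg ℓ hxi hκ f g φ) (𝓝[<] xc)
      (𝓝 (velocityLimit hbg ℓ hxi hκ f g φ)) := by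
  have h1 := (IsBackground.tendsto_of_continuousOn hbg.continuousOn_G).smul
    (tendsto_inField_div hbg ℓ hxi hκ hκb hφ (f := f) (g := g))
  have h2 : Tendsto (fun x : ℝ => x⁻¹) (𝓝[<] xc) (𝓝 xc⁻¹) :=
    (tendsto_inv₀ hbg.horizon_pos.ne').mono_left nhdsWithin_le_nhds
  refine ((h1.add (h2.smul (tendsto_outField hbg ℓ hxi hκ hφ))).const_smul
    (-(1 / 2) : ℝ)).congr fun x => ?_
  rw [smul_smul]
  rfl

end

/-! ### The a priori bound for the velocity at the horizon -/

lemma RealL2.integral_sq (u : RealL2) : ∫ s, u s ^ 2 = ‖u‖ ^ 2 := by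
  rw [← real_inner_self_eq_norm_sq, L2.inner_def]
  refine integral_congr_ae (Eventually.of_forall fun s => ?_)
  simp [sq]

section

variable {G ψ : ℝ → ℝ} {xc : ℝ} (hbg : IsBackground G ψ xc) (ℓ : ℕ) {xi : ℝ} (hxi : xi ∈ Ioo 0 xc)
  {κ : ℝ} (hκ : κ < 1)

/-- The initial value of `α φ̃_x + β φ̃_ρ`. -/
def momentumData (G : ℝ → ℝ) (xi : ℝ) (f : SobolevSpace 3) (g : SobolevSpace 2) : SobolevSpace 2 :=
  coeffA G xi • g + coeffB G xi • sobolevD 3 2 1 (by norm_num) f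

lemma initialEnergy_eq (f : SobolevSpace 3) (g : SobolevSpace 2) (j : Fin 3) :
    initialEnergy G xi f g j = ‖weakD (sobolevD 3 2 0 (by norm_num) f) j‖ ^ 2
      + ‖weakD (momentumData G xi f g) j‖ ^ 2
      + ‖weakD (sobolevD 3 2 1 (by norm_num) f) j‖ ^ 2 := by
  have e : weakD (momentumData G xi f g) j
      = coeffA G xi • weakD g j + coeffB G xi • weakD f j.succ := rfl
  have h : ∀ u : RealL2, Integrable (fun s => u s ^ 2) := fun u => (Lp.memLp u).integrable_sq
  have h2 : ∀ u v : RealL2, Integrable (fun s => u s ^ 2 + v s ^ 2) := fun u v => (h u).add (h v)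
  rw [← RealL2.integral_sq, ← RealL2.integral_sq, ← RealL2.integral_sq, ← integral_add (h _) (h _),
    ← integral_add (h2 _ _) (h _), initialEnergy, e]
  refine integral_congr_ae ?_
  filter_upwards [Lp.coeFn_add (coeffA G xi • weakD g j) (coeffB G xi • weakD f j.succ),
    Lp.coeFn_smul (coeffA G xi) (weakD g j), Lp.coeFn_smul (coeffB G xi) (weakD f j.succ)]
    with s h1 h2 h3
  rw [h1, Pi.add_apply, h2, h3]
  rfl

lemma sum_initialEnergy (f : SobolevSpace 3) (g : SobolevSpace 2) :
    initialEnergy G xi f g 0 + initialEnergy G xi f g 1 + initialEnergy G xi f g 2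
      = ‖sobolevD 3 2 0 (by norm_num) f‖ ^ 2 + ‖momentumData G xi f g‖ ^ 2
        + ‖sobolevD 3 2 1 (by norm_num) f‖ ^ 2 := by
  have h : ∀ u : SobolevSpace 2,
      ‖u‖ ^ 2 = ‖weakD u 0‖ ^ 2 + ‖weakD u 1‖ ^ 2 + ‖weakD u 2‖ ^ 2 := fun u =>
    (SobolevSpace.norm_sq u).trans (Fin.sum_univ_three _)
  simp only [initialEnergy_eq, h]
  ring

lemma exists_data_bound (G : ℝ → ℝ) (κ xi : ℝ) : ∃ C : ℝ, 0 < C ∧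
    ∀ (f : SobolevSpace 3) (g : SobolevSpace 2),
    (‖inData G κ xi f g‖ + ‖outData G κ xi f g‖ + ‖sobolevD 3 2 0 (by norm_num) f‖) ^ 2
      ≤ C * (initialEnergy G xi f g 0 + initialEnergy G xi f g 1 + initialEnergy G xi f g 2) := by
  set k₁ := ‖(coeffB G xi + 1) * (1 - κ)‖ with hk₁
  set k₂ := ‖(coeffB G xi - 1) * (1 - κ)‖ with hk₂
  -- By Cauchy–Schwarz for `2 ‖p‖ + 2 ‖u'‖ + k ‖u‖` with `k = k₁ + k₂ + 1`: the constant is `2² + 2²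
  -- + k²`.
  refine ⟨8 + (k₁ + k₂ + 1) ^ 2, by positivity, fun f g => ?_⟩
  rw [sum_initialEnergy]
  set p := momentumData G xi f g with hp
  set u := sobolevD 3 2 0 (by norm_num) f with hu
  set u' := sobolevD 3 2 1 (by norm_num) f with hu'
  have h1 : ‖inData G κ xi f g‖ ≤ ‖p‖ + ‖u'‖ + k₁ * ‖u‖ := by
    have e : inData G κ xi f g = p + u' + ((coeffB G xi + 1) * (1 - κ)) • u := by
      rw [hp, inData, momentumData]; module
    rw [e, hk₁, ← norm_smul]
    exact norm_add₃_le
  have h2 : ‖outData G κ xi f g‖ ≤ ‖p‖ + ‖u'‖ + k₂ * ‖u‖ := by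
    have e : outData G κ xi f g = p - u' + ((coeffB G xi - 1) * (1 - κ)) • u := by
      rw [hp, outData, momentumData]; module
    rw [e, hk₂, ← norm_smul]
    exact (norm_add_le _ _).trans (add_le_add_left (norm_sub_le _ _) _)
  have h3 : ‖inData G κ xi f g‖ + ‖outData G κ xi f g‖ + ‖u‖
      ≤ 2 * ‖p‖ + 2 * ‖u'‖ + (k₁ + k₂ + 1) * ‖u‖ := by linarith
  refine (pow_le_pow_left₀ (by positivity) h3 2).trans ?_
  generalize k₁ + k₂ + 1 = k
  nlinarith [sq_nonneg (2 * ‖p‖ - 2 * ‖u'‖), sq_nonneg (2 * ‖u‖ - k * ‖p‖),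
    sq_nonneg (2 * ‖u‖ - k * ‖u'‖)]

lemma exists_velocityLimit_bound (hκb : κ < -(xc ^ 2 * deriv G xc)) : ∃ C : ℝ, 0 < C ∧
    ∀ (f : SobolevSpace 3) (g : SobolevSpace 2) (φ : ℝ → SobolevSpace 2), Continuous φ →
      (∀ x ∈ Icc xi xc, waveField hbg ℓ hxi hκ f g φ x = φ x) →
      ‖velocityLimit hbg ℓ hxi hκ f g φ‖ ≤ C * (‖inData G κ xi f g‖ + ‖outData G κ xi f g‖
        + ‖sobolevD 3 2 0 (by norm_num) f‖) := by
  set D := hbg.charSystem ℓ hκ hxi with hD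
  obtain ⟨C₁, hC₁, hap⟩ := CharSystem.exists_apriori_bound D (translation 2)
  obtain ⟨w, M, hw, -, -⟩ := D.exists_weight
  set d := -κ - xc ^ 2 * deriv G xc with hd
  have hd0 : 0 < d := by rw [hd]; linarith
  have hw0 : 0 ≤ w := (abs_nonneg _).trans (hw xi (left_mem_Icc.2 hxi.2.le))
  set K := ‖horizonRatio G ψ ℓ xc‖ with hK
  have hL : 0 < xc - xi := sub_pos.2 hxi.2
  have hO := CharSystem.outBound_pos (D := D)
  refine ⟨1 / 2 * (‖G xc‖ * (K * C₁ / d) + ‖xc⁻¹‖ * (D.outBound * (1 + (xc - xi) * (w * C₁)))) + 1,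
    by positivity, fun f g φ hφ hfix => ?_⟩
  set S := ‖inData G κ xi f g‖ + ‖outData G κ xi f g‖ + ‖sobolevD 3 2 0 (by norm_num) f‖ with hS
  have hS0 : 0 ≤ S := by positivity
  have hφS : ∀ x ∈ Icc xi xc, ‖φ x‖ ≤ C₁ * S := hap _ _ _ φ hφ hfix
  have hR : ‖inLimit G ψ ℓ κ xc φ‖ ≤ K * C₁ / d * S := by
    refine ((translation 2).norm_resolvent_le hd0 _).trans ?_
    rw [norm_smul, div_mul_eq_mul_div, mul_assoc]
    exact div_le_div_of_nonneg_right (mul_le_mul_of_nonneg_left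
      (hφS xc (right_mem_Icc.2 hxi.2.le)) (norm_nonneg _)) hd0.le
  have hQ : ‖outField hbg ℓ hxi hκ f g φ xc‖
      ≤ D.outBound * (1 + (xc - xi) * (w * C₁)) * S := by
    have h1 := CharSystem.norm_outgoing_le (D := D) (T := translation 2)
      (Q₀ := outData G κ xi f g) (m := fun _ => w * (C₁ * S)) hφ continuous_const
      (fun y hy => by
        rw [norm_smul]
        exact mul_le_mul (hw y hy) (hφS y hy) (norm_nonneg _) hw0) (right_mem_Icc.2 hxi.2.le)
    refine h1.trans ?_
    rw [intervalIntegral.integral_const, smul_eq_mul, mul_assoc]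
    refine mul_le_mul_of_nonneg_left ?_ hO.le
    have h2 : ‖outData G κ xi f g‖ ≤ S := by
      have := norm_nonneg (inData G κ xi f g)
      have := norm_nonneg (sobolevD 3 2 0 (by norm_num) f)
      rw [hS]
      linarith
    have e1 : D.b - D.a = xc - xi := rfl
    rw [e1]
    linarith
  have h1 : ‖G xc • inLimit G ψ ℓ κ xc φ‖ ≤ ‖G xc‖ * (K * C₁ / d * S) := by
    rw [norm_smul]; exact mul_le_mul_of_nonneg_left hR (norm_nonneg _)
  have h2 : ‖xc⁻¹ • outField hbg ℓ hxi hκ f g φ xc‖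
      ≤ ‖xc⁻¹‖ * (D.outBound * (1 + (xc - xi) * (w * C₁)) * S) := by
    rw [norm_smul]; exact mul_le_mul_of_nonneg_left hQ (norm_nonneg _)
  have h3 := norm_add_le (G xc • inLimit G ψ ℓ κ xc φ) (xc⁻¹ • outField hbg ℓ hxi hκ f g φ xc)
  rw [velocityLimit, norm_smul]
  have e4 : ‖(-(1 / 2) : ℝ)‖ = 1 / 2 := by norm_num
  rw [e4]
  nlinarith

/-- The velocity of a classical solution has a limit at the horizon, which is bounded by the
initial energies. -/
lemma exists_energy_bound (hκb : κ < -(xc ^ 2 * deriv G xc)) : ∃ C : ℝ, 0 < C ∧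
    ∀ (f : SobolevSpace 3) (g : SobolevSpace 2) (φ : ℝ → SobolevSpace 2), Continuous φ →
      (∀ x ∈ Icc xi xc, waveField hbg ℓ hxi hκ f g φ x = φ x) → ∀ ρ : ℝ,
      |evalL ρ (sobolevD 2 1 0 (by norm_num) (velocityLimit hbg ℓ hxi hκ f g φ))| ^ 2
        ≤ C * (initialEnergy G xi f g 0 + initialEnergy G xi f g 1 + initialEnergy G xi f g 2) := by
  obtain ⟨C₁, hC₁, h₁⟩ := exists_velocityLimit_bound hbg ℓ hxi hκ hκb
  obtain ⟨C₂, hC₂, h₂⟩ := exists_data_bound G κ xi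
  set K := 2 * ‖expKernelL2‖ * ‖sobolevD 2 1 0 (by norm_num)‖ * C₁ + 1 with hK
  have hK0 : 0 < K := by positivity
  refine ⟨K ^ 2 * C₂, by positivity, fun f g φ hφ hfix ρ => ?_⟩
  set S := ‖inData G κ xi f g‖ + ‖outData G κ xi f g‖ + ‖sobolevD 3 2 0 (by norm_num) f‖ with hS
  have hS0 : 0 ≤ S := by positivity
  have h3 : |evalL ρ (sobolevD 2 1 0 (by norm_num) (velocityLimit hbg ℓ hxi hκ f g φ))|
      ≤ K * S := by
    refine (abs_evalL_le ρ _).trans ?_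
    have e1 := (sobolevD 2 1 0 (by norm_num)).le_opNorm (velocityLimit hbg ℓ hxi hκ f g φ)
    have e2 := mul_le_mul_of_nonneg_left (h₁ f g φ hφ hfix)
      (norm_nonneg (sobolevD 2 1 0 (by norm_num)))
    have e3 := mul_le_mul_of_nonneg_left (e1.trans e2)
      (by positivity : 0 ≤ 2 * ‖expKernelL2‖)
    refine e3.trans ?_
    rw [hK]
    nlinarith
  refine (pow_le_pow_left₀ (abs_nonneg _) h3 2).trans ?_
  rw [mul_pow, mul_assoc]
  exact mul_le_mul_of_nonneg_left (h₂ f g) (sq_nonneg _)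

end

/-! ### Time-like geodesics that reach the horizon -/

/-- Translation in `ρ` rescales the metric by a constant factor. With the normalisation `g(u, u) =
-1` this makes the rate of change of the conjugate momentum constant. -/
lemma deriv_lagrangian_rho (G ψ : ℝ → ℝ) (x ρ ux ur ut : ℝ) :
    deriv (fun s => lagrangian G ψ x s ux ur ut) ρ = 2 * lagrangian G ψ x ρ ux ur ut := by
  unfold lagrangian
  set k := -2 * G x * Real.exp (ψ x) * ux ^ 2
      + 2 * Real.exp (ψ x) * (1 - 2 * x * G x) * ux * ur
      + 2 * x * Real.exp (ψ x) * (1 - x * G x) * ur ^ 2 + ut ^ 2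
  refine HasDerivAt.deriv (((((hasDerivAt_id ρ).const_mul 2).exp.const_mul (1 / 2)).mul_const
    k).congr_deriv ?_)
  simp only [id]
  ring

lemma deriv_lagrangian_ur (G ψ : ℝ → ℝ) (x ρ ux ur ut : ℝ) :
    deriv (fun w => lagrangian G ψ x ρ ux w ut) ur
      = Real.exp (2 * ρ) * Real.exp (ψ x) * (coeffB G x * ux - coeffA G x * ur) := by
  unfold lagrangian
  refine HasDerivAt.deriv (((((hasDerivAt_id ur).const_mul
    (2 * Real.exp (ψ x) * (1 - 2 * x * G x) * ux)).const_add
    (-2 * G x * Real.exp (ψ x) * ux ^ 2)).add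
    (((hasDerivAt_id ur).pow 2).const_mul (2 * x * Real.exp (ψ x) * (1 - x * G x)))).add_const
    (ut ^ 2) |>.const_mul (1 / 2 * Real.exp (2 * ρ)) |>.congr_deriv ?_)
  simp only [id, coeffA, coeffB]
  ring

lemma deriv_lagrangian_ut (G ψ : ℝ → ℝ) (x ρ ux ur ut : ℝ) :
    deriv (fun w => lagrangian G ψ x ρ ux ur w) ut = Real.exp (2 * ρ) * ut := by
  unfold lagrangian
  refine HasDerivAt.deriv ((((hasDerivAt_id ut).pow 2).const_add
    (-2 * G x * Real.exp (ψ x) * ux ^ 2 + 2 * Real.exp (ψ x) * (1 - 2 * x * G x) * ux * ur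
      + 2 * x * Real.exp (ψ x) * (1 - x * G x) * ur ^ 2)).const_mul
    (1 / 2 * Real.exp (2 * ρ)) |>.congr_deriv ?_)
  simp only [id]
  ring

namespace IsTimelikeGeodesic

variable {G ψ : ℝ → ℝ} {xc a b : ℝ} {x ρ ϑ ux ur ut : ℝ → ℝ}

/-- The momentum conjugate to `ρ` decreases at unit rate, by self-similarity. -/
lemma exists_momentum_rho (h : IsTimelikeGeodesic G ψ a b x ρ ϑ ux ur ut) : ∃ p : ℝ,
    ∀ τ ∈ Ioo a b, Real.exp (2 * ρ τ) * Real.exp (ψ (x τ))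
      * (coeffB G (x τ) * ux τ - coeffA G (x τ) * ur τ) = p + (b - τ) := by
  have hd : ∀ τ ∈ Ioo a b, HasDerivAt (fun σ => Real.exp (2 * ρ σ) * Real.exp (ψ (x σ))
      * (coeffB G (x σ) * ux σ - coeffA G (x σ) * ur σ) - (b - σ)) 0 τ := by
    intro τ hτ
    have h1 := h.euler_rho τ hτ
    simp only [deriv_lagrangian_ur, deriv_lagrangian_rho, h.unit τ hτ] at h1
    exact (h1.sub ((hasDerivAt_id τ).const_sub b)).congr_deriv (by ring)
  obtain ⟨p, hp⟩ := isOpen_Ioo.exists_is_const_of_deriv_eq_zero isPreconnected_Ioo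
    (fun τ hτ => (hd τ hτ).differentiableAt.differentiableWithinAt) fun τ hτ => (hd τ hτ).deriv
  exact ⟨p, fun τ hτ => by linarith [hp τ hτ]⟩

/-- The angular momentum is conserved. -/
lemma exists_angular_momentum (h : IsTimelikeGeodesic G ψ a b x ρ ϑ ux ur ut) : ∃ J : ℝ,
    ∀ τ ∈ Ioo a b, Real.exp (2 * ρ τ) * ut τ = J := by
  have hd : ∀ τ ∈ Ioo a b, HasDerivAt (fun σ => Real.exp (2 * ρ σ) * ut σ) 0 τ := by
    intro τ hτ
    have h1 := h.euler_theta τ hτ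
    simpa only [deriv_lagrangian_ut] using h1
  exact isOpen_Ioo.exists_is_const_of_deriv_eq_zero isPreconnected_Ioo
    (fun τ hτ => (hd τ hτ).differentiableAt.differentiableWithinAt) fun τ hτ => (hd τ hτ).deriv

/-- The tangent of a time-like geodesic that reaches the horizon converges. -/
lemma exists_tendsto_tangent (h : IsTimelikeGeodesic G ψ a b x ρ ϑ ux ur ut)
    (hbg : IsBackground G ψ xc) (hab : a < b) (hx : ∀ τ ∈ Ioo a b, x τ ∈ Ioo 0 xc) {ρ₀ : ℝ}
    (hxb : Tendsto x (𝓝[<] b) (𝓝 xc)) (hρb : Tendsto ρ (𝓝[<] b) (𝓝 ρ₀)) :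
    ∃ U V : ℝ, Tendsto ux (𝓝[<] b) (𝓝 U) ∧ Tendsto ur (𝓝[<] b) (𝓝 V) := by
  obtain ⟨pb, hp⟩ := h.exists_momentum_rho
  obtain ⟨J, hJ⟩ := h.exists_angular_momentum
  set E : ℝ → ℝ := fun τ => Real.exp (2 * ρ τ) * Real.exp (ψ (x τ)) with hE
  set k : ℝ → ℝ := fun τ => 1 + J ^ 2 * Real.exp (-(2 * ρ τ)) with hk
  set A : ℝ → ℝ := fun τ => coeffA G (x τ) with hA
  set B : ℝ → ℝ := fun τ => coeffB G (x τ) with hB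
  set C : ℝ → ℝ := fun τ => coeffC G (x τ) with hC
  have hE0 : ∀ τ, 0 < E τ := fun τ => by positivity
  have hk0 : ∀ τ, 0 < k τ := fun τ => by positivity
  have hA0 : ∀ τ ∈ Ioo a b, A τ < 0 := fun τ hτ => by
    have h1 := mul_pos (hx τ hτ).1 (hbg.lapse_pos (hx τ hτ))
    simp only [hA, coeffA]
    linarith
  have hABC : ∀ τ, B τ ^ 2 - A τ * C τ = 1 := fun τ => by
    simp only [hA, hB, hC, coeffA, coeffB, coeffC]; ring
  have hunit : ∀ τ ∈ Ioo a b,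
      E τ * (-C τ * ux τ ^ 2 + 2 * B τ * ux τ * ur τ - A τ * ur τ ^ 2) = -k τ := by
    intro τ hτ
    have h1 := h.unit τ hτ
    have h2 : Real.exp (2 * ρ τ) * ut τ ^ 2 = J ^ 2 * Real.exp (-(2 * ρ τ)) := by
      rw [← hJ τ hτ, Real.exp_neg]
      field_simp
    simp only [lagrangian] at h1
    simp only [hE, hA, hB, hC, hk, coeffA, coeffB, coeffC, ← h2]
    linear_combination h1
  set q : ℝ → ℝ := fun τ => E τ * ux τ with hq
  -- Eliminating `ur` between the normalisation and the `ρ`-momentum, by means of `B² - AC = 1`,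
  -- determines the square of `E ux`.
  have hq2 : ∀ τ ∈ Ioo a b, q τ ^ 2 = (pb + (b - τ)) ^ 2 - A τ * k τ * E τ := by
    intro τ hτ
    rw [← hp τ hτ]
    change (E τ * ux τ) ^ 2 = (E τ * (B τ * ux τ - A τ * ur τ)) ^ 2 - _
    linear_combination (A τ * E τ) * hunit τ hτ - (E τ ^ 2 * ux τ ^ 2) * hABC τ
  -- As `A < 0` before the horizon, the right side of `hq2` is positive. By the Darboux property
  -- `ux` then has a fixed sign, and it is positive because `x` tends to `xc` from below.
  have hne : ∀ τ ∈ Ioo a b, ux τ ≠ 0 := by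
    intro τ hτ h0
    have h1 := hq2 τ hτ
    have h2 : 0 < -A τ * k τ * E τ :=
      mul_pos (mul_pos (neg_pos.2 (hA0 τ hτ)) (hk0 τ)) (hE0 τ)
    simp only [hq, h0, mul_zero] at h1
    nlinarith [sq_nonneg (pb + (b - τ))]
  have hpos : ∀ τ ∈ Ioo a b, 0 < ux τ := by
    rcases hasDerivWithinAt_forall_lt_or_forall_gt_of_forall_ne (convex_Ioo a b)
      (fun τ hτ => (h.tangent_x τ hτ).hasDerivWithinAt) hne with hlt | hgt
    · exfalso
      have hanti : AntitoneOn x (Ioo a b) := by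
        refine antitoneOn_of_deriv_nonpos (convex_Ioo a b)
          (fun τ hτ => (h.tangent_x τ hτ).continuousAt.continuousWithinAt) (fun τ hτ => ?_)
          fun τ hτ => ?_
        · exact (h.tangent_x τ (interior_subset hτ)).differentiableAt.differentiableWithinAt
        · rw [(h.tangent_x τ (interior_subset hτ)).deriv]
          exact (hlt τ (interior_subset hτ)).le
      obtain ⟨τ₀, hτ₀⟩ := nonempty_Ioo.2 hab
      have h1 : ∀ᶠ τ in 𝓝[<] b, x τ ≤ x τ₀ := by
        filter_upwards [Ioo_mem_nhdsLT hτ₀.2] with τ hτ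
        exact hanti hτ₀ ⟨hτ₀.1.trans hτ.1, hτ.2⟩ hτ.1.le
      exact absurd (le_of_tendsto hxb h1) (not_le.2 (hx τ₀ hτ₀).2)
    · exact hgt
  have hxb' : Tendsto x (𝓝[<] b) (𝓝[<] xc) := by
    refine tendsto_nhdsWithin_iff.2 ⟨hxb, ?_⟩
    filter_upwards [Ioo_mem_nhdsLT hab] with τ hτ using (hx τ hτ).2
  have hAb : Tendsto A (𝓝[<] b) (𝓝 0) := by
    have h1 := (IsBackground.tendsto_of_continuousOn
      hbg.analyticOnNhd_coeffA.continuousOn).comp hxb'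
    have e : coeffA G xc = 0 := by rw [coeffA, hbg.horizon_root]; ring
    rwa [e] at h1
  have hBb : Tendsto B (𝓝[<] b) (𝓝 (-1)) := by
    have h1 := (IsBackground.tendsto_of_continuousOn
      hbg.analyticOnNhd_coeffB.continuousOn).comp hxb'
    have e : coeffB G xc = -1 := by rw [coeffB, mul_assoc, hbg.horizon_root]; ring
    rwa [e] at h1
  have hCb : Tendsto C (𝓝[<] b) (𝓝 (coeffC G xc)) :=
    (IsBackground.tendsto_of_continuousOn hbg.analyticOnNhd_coeffC.continuousOn).comp hxb'
  have hψb : Tendsto (fun τ => ψ (x τ)) (𝓝[<] b) (𝓝 (ψ xc)) :=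
    (IsBackground.tendsto_of_continuousOn hbg.analytic_psi.continuousOn).comp hxb'
  have hEb : Tendsto E (𝓝[<] b) (𝓝 (Real.exp (2 * ρ₀) * Real.exp (ψ xc))) :=
    ((Real.continuous_exp.tendsto _).comp (hρb.const_mul 2)).mul
      ((Real.continuous_exp.tendsto _).comp hψb)
  set Eb := Real.exp (2 * ρ₀) * Real.exp (ψ xc)
  have hEb_pos : 0 < Eb := by positivity
  have hkb : Tendsto k (𝓝[<] b) (𝓝 (1 + J ^ 2 * Real.exp (-(2 * ρ₀)))) :=
    (((Real.continuous_exp.tendsto _).comp (hρb.const_mul 2).neg).const_mul _).const_add _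
  have hpb : Tendsto (fun τ => pb + (b - τ)) (𝓝[<] b) (𝓝 pb) := by
    have h1 : Tendsto (fun τ => pb + (b - τ)) (𝓝 b) (𝓝 (pb + (b - b))) :=
      (by fun_prop : Continuous fun τ => pb + (b - τ)).tendsto b
    rw [sub_self, add_zero] at h1
    exact h1.mono_left nhdsWithin_le_nhds
  have hqb : Tendsto q (𝓝[<] b) (𝓝 |pb|) := by
    have h1 := (((hpb.pow 2).sub ((hAb.mul hkb).mul hEb))).sqrt
    rw [zero_mul, zero_mul, sub_zero, Real.sqrt_sq_eq_abs] at h1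
    refine h1.congr' ?_
    filter_upwards [Ioo_mem_nhdsLT hab] with τ hτ
    rw [← hq2 τ hτ]
    exact Real.sqrt_sq (mul_pos (hE0 τ) (hpos τ hτ)).le
  -- If `pb ≥ 0`, then `B ux - A ur ≥ 0`. Near the horizon `B` is close to `-1`, and this forces `ur
  -- ≥ ¼ τ'(x) ux`; the sharp factor tends to `½`, so `¼` leaves room. Hence `ρ` grows at least like
  -- `¼ τ(x)` and diverges, contrary to `ρ → ρ₀`.
  have hpneg : pb < 0 := by
    by_contra! hp0
    obtain ⟨τ₀, hτ₀⟩ := nonempty_Ioo.2 hab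
    have hb0 := hx τ₀ hτ₀
    have hlim : Tendsto (fun τ => -B τ - 1 / 2 * (x τ * G (x τ))) (𝓝[<] b) (𝓝 (1 / 2)) := by
      have h1 := (IsBackground.tendsto_of_continuousOn hbg.continuousOn_G).comp hxb'
      have h2 := hBb.neg.sub ((hxb.mul h1).const_mul (1 / 2))
      rw [hbg.horizon_root] at h2
      have e : - -1 - 1 / 2 * 1 = (1 / 2 : ℝ) := by norm_num
      rw [e] at h2
      exact h2
    have hev : ∀ᶠ τ in 𝓝[<] b,
        1 / 4 * (G (x τ) / (1 - x τ * G (x τ)) * ux τ) ≤ ur τ := by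
      filter_upwards [Ioo_mem_nhdsLT hab, hlim.eventually (lt_mem_nhds (by norm_num :
        (0 : ℝ) < 1 / 2))] with τ hτ h1
      have h2 := hp τ hτ
      have h3 : 0 ≤ B τ * ux τ - A τ * ur τ := by
        have h4 : 0 ≤ E τ * (B τ * ux τ - A τ * ur τ) := by
          refine le_of_le_of_eq ?_ h2.symm
          linarith [hτ.2]
        exact nonneg_of_mul_nonneg_right h4 (hE0 τ)
      have h5 := hbg.lapse_pos (hx τ hτ)
      have h6 := (hx τ hτ).1
      have h7 : A τ = -2 * x τ * (1 - x τ * G (x τ)) := rfl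
      have h8 := mul_nonneg h1.le (hpos τ hτ).le
      have e : 1 / 4 * (G (x τ) / (1 - x τ * G (x τ)) * ux τ)
          = 1 / 4 * (G (x τ) * ux τ) / (1 - x τ * G (x τ)) := by ring
      rw [e, div_le_iff₀ h5]
      rw [h7] at h3
      have h9 : x τ * (1 / 4 * (G (x τ) * ux τ)) ≤ x τ * (ur τ * (1 - x τ * G (x τ))) := by
        nlinarith
      exact le_of_mul_le_mul_left h9 h6
    have htop : Tendsto ρ (𝓝[<] b) atTop := by
      refine tendsto_atTop_of_deriv_le hab h.tangent_rho
        (H := fun τ => 1 / 4 * ∫ y in x τ₀..x τ, G y / (1 - y * G y))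
        (fun τ hτ => ?_) hev (((hbg.tendsto_τ hb0).comp hxb').const_mul_atTop (by norm_num))
      exact ((hasDerivAt_primitive hbg.continuousOn_dτ hb0 (hx τ hτ)).comp τ
        (h.tangent_x τ hτ)).const_mul _
    exact not_tendsto_nhds_of_tendsto_atTop htop _ hρb
  refine ⟨|pb| / Eb, (coeffC G xc * pb ^ 2 - (-1) ^ 2 * (1 + J ^ 2 * Real.exp (-(2 * ρ₀))) * Eb)
    / (Eb * (-1 * |pb| + pb)), ?_, ?_⟩
  · refine (hqb.div hEb hEb_pos.ne').congr fun τ => ?_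
    have := (hE0 τ).ne'
    simp only [hq, Pi.div_apply]
    field_simp
  · have hne0 : -1 * |pb| + pb ≠ 0 := by
      rw [abs_of_neg hpneg]; linarith
    have hden := (hBb.mul hqb).add hpb
    refine (((hCb.mul (hpb.pow 2)).sub (((hBb.pow 2).mul hkb).mul hEb)).div (hEb.mul hden)
      (mul_ne_zero hEb_pos.ne' hne0)).congr' ?_
    filter_upwards [Ioo_mem_nhdsLT hab, hden.eventually_ne hne0] with τ hτ h1
    have h2 := (hE0 τ).ne'
    have h3 : A τ * (E τ * ur τ) = B τ * q τ - (pb + (b - τ)) := by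
      rw [← hp τ hτ]
      change A τ * (E τ * ur τ) = B τ * (E τ * ux τ) - E τ * (B τ * ux τ - A τ * ur τ)
      ring
    -- Solving `h3` for `ur` gives `0 / 0` at the horizon, because `B q` and the momentum have the
    -- same limit. Multiplication with the conjugate `B q + (pb + (b - τ))`, whose limit `-|pb| +
    -- pb` is not zero, produces an explicit factor `A` that cancels.
    have h4 : A τ * (C τ * (pb + (b - τ)) ^ 2 - B τ ^ 2 * k τ * E τ)
        = A τ * (ur τ * (E τ * (B τ * q τ + (pb + (b - τ))))) := by
      linear_combination (pb + (b - τ)) ^ 2 * (-hABC τ) + B τ ^ 2 * (-hq2 τ hτ)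
        - (B τ * q τ + (pb + (b - τ))) * h3
    have h5 := mul_left_cancel₀ (hA0 τ hτ).ne h4
    simp only [Pi.div_apply]
    rw [div_eq_iff (mul_ne_zero h2 h1)]
    exact h5

end IsTimelikeGeodesic

/-! ### The energy that an observer measures at the horizon -/

section

variable {G ψ : ℝ → ℝ} {xc : ℝ} (hbg : IsBackground G ψ xc) (ℓ : ℕ) {xi : ℝ} (hxi : xi ∈ Ioo 0 xc)
  {κ : ℝ} (hκ : κ < 1) {f : SobolevSpace 3} {g : SobolevSpace 2} {φ : ℝ → SobolevSpace 2}
  {Φ : C(Icc xi xc, SobolevSpace 3)} {φt : ℝ → ℝ → ℝ}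

lemma IsClassicalVersion.deriv_left (h : IsClassicalVersion G ψ ℓ κ Φ f g φt)
    (hΦ : IsSolution G ψ ℓ κ hxi.2.le Φ f g) (hφ : Continuous φ)
    (hfix : ∀ x ∈ Icc xi xc, waveField hbg ℓ hxi hκ f g φ x = φ x) {x : ℝ} (hx : x ∈ Ioo xi xc)
    (ρ : ℝ) : deriv (fun s => φt s ρ) x
      = evalL ρ (sobolevD 2 1 0 (by norm_num) (waveVelocity hbg ℓ hxi hκ f g φ x)) := by
  refine ((hasDerivAt_classicalField_left hbg ℓ hxi hκ hφ ⟨hxi.1.trans hx.1, hx.2⟩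
    ρ).congr_of_eventuallyEq ?_).deriv
  filter_upwards [Ioo_mem_nhds hx.1 hx.2] with y hy
  rw [h.eq_classicalField hbg ℓ hxi hκ hΦ hφ hfix (Ioo_subset_Ico_self hy)]

lemma IsClassicalVersion.hasDerivAt_right (h : IsClassicalVersion G ψ ℓ κ Φ f g φt)
    (hΦ : IsSolution G ψ ℓ κ hxi.2.le Φ f g) (hφ : Continuous φ)
    (hfix : ∀ x ∈ Icc xi xc, waveField hbg ℓ hxi hκ f g φ x = φ x) {x : ℝ} (hx : x ∈ Ioo xi xc)
    (ρ : ℝ) : HasDerivAt (φt x)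
      (evalL ρ (sobolevD 2 1 0 (by norm_num) (waveSlope hbg ℓ hxi hκ f g φ x))) ρ := by
  rw [h.eq_classicalField hbg ℓ hxi hκ hΦ hφ hfix (Ioo_subset_Ico_self hx)]
  exact hasDerivAt_classicalField_right hbg ℓ hxi hκ hφ ⟨hxi.1.trans hx.1, hx.2.le⟩ ρ

/-- The velocity of a classical solution converges at the horizon. -/
lemma IsClassicalVersion.tendsto_deriv_left (h : IsClassicalVersion G ψ ℓ κ Φ f g φt)
    (hΦ : IsSolution G ψ ℓ κ hxi.2.le Φ f g) (hφ : Continuous φ)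
    (hfix : ∀ x ∈ Icc xi xc, waveField hbg ℓ hxi hκ f g φ x = φ x)
    (hκb : κ < -(xc ^ 2 * deriv G xc)) (ρ : ℝ) :
    Tendsto (fun x => deriv (fun s => φt s ρ) x) (𝓝[<] xc)
      (𝓝 (evalL ρ (sobolevD 2 1 0 (by norm_num) (velocityLimit hbg ℓ hxi hκ f g φ)))) := by
  refine ((((evalL ρ).comp (sobolevD 2 1 0 (by norm_num))).continuous.tendsto _).comp
    (tendsto_waveVelocity hbg ℓ hxi hκ hκb hφ)).congr' ?_
  filter_upwards [Ioo_mem_nhdsLT hxi.2] with x hx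
  exact (h.deriv_left hbg ℓ hxi hκ hΦ hφ hfix hx ρ).symm

lemma Filter.Tendsto.evalL {Y : Type*} {l : Filter Y} {r : Y → ℝ} {r₀ : ℝ}
    {w : Y → SobolevSpace 2} {w₀ : SobolevSpace 2} (hr : Tendsto r l (𝓝 r₀))
    (hw : Tendsto w l (𝓝 w₀)) :
    Tendsto (fun y => _root_.evalL (r y) (sobolevD 2 1 0 (by norm_num) (w y))) l
      (𝓝 (_root_.evalL r₀ (sobolevD 2 1 0 (by norm_num) w₀))) :=
  (continuous_evalL.tendsto (r₀, sobolevD 2 1 0 (by norm_num) w₀)).comp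
    (hr.prodMk_nhds (((sobolevD 2 1 0 (by norm_num)).continuous.tendsto w₀).comp hw))

/-- Flux and energy of the multipole converge along a time-like geodesic that reaches the
horizon. -/
lemma IsClassicalVersion.exists_tendsto_energy (h : IsClassicalVersion G ψ ℓ κ Φ f g φt)
    (hΦ : IsSolution G ψ ℓ κ hxi.2.le Φ f g) (hφ : Continuous φ)
    (hfix : ∀ x ∈ Icc xi xc, waveField hbg ℓ hxi hκ f g φ x = φ x)
    (hκb : κ < -(xc ^ 2 * deriv G xc)) {a b : ℝ} {x ρ ϑ ux ur ut : ℝ → ℝ} {ρ₀ : ℝ} (hab : a < b)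
    (hgeo : IsTimelikeGeodesic G ψ a b x ρ ϑ ux ur ut) (hx : ∀ τ ∈ Ioo a b, x τ ∈ Ioo xi xc)
    (hxb : Tendsto x (𝓝[<] b) (𝓝 xc)) (hρb : Tendsto ρ (𝓝[<] b) (𝓝 ρ₀)) :
    ∃ F E : ℝ,
      Tendsto (fun τ => fieldFlux (multipole κ φt) (x τ) (ρ τ) (ux τ) (ur τ))
        (𝓝[<] b) (𝓝 F) ∧
      Tendsto (fun τ => fieldEnergy G ψ (multipole κ φt) (x τ) (ρ τ) (ux τ) (ur τ))
        (𝓝[<] b) (𝓝 E) := by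
  obtain ⟨U, V, hU, hV⟩ := hgeo.exists_tendsto_tangent hbg hab
    (fun τ hτ => ⟨hxi.1.trans (hx τ hτ).1, (hx τ hτ).2⟩) hxb hρb
  have hxb' : Tendsto x (𝓝[<] b) (𝓝[<] xc) := by
    refine tendsto_nhdsWithin_iff.2 ⟨hxb, ?_⟩
    filter_upwards [Ioo_mem_nhdsLT hab] with τ hτ using (hx τ hτ).2
  have hxb'' : Tendsto x (𝓝[<] b) (𝓝[Ioc 0 xc] xc) := by
    refine tendsto_nhdsWithin_iff.2 ⟨hxb, ?_⟩
    filter_upwards [Ioo_mem_nhdsLT hab] with τ hτ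
      using ⟨hxi.1.trans (hx τ hτ).1, (hx τ hτ).2.le⟩
  have hxc : xc ∈ Ioc 0 xc := ⟨hbg.horizon_pos, le_rfl⟩
  have hv := hρb.evalL ((tendsto_waveVelocity hbg ℓ hxi hκ hκb hφ (f := f) (g := g)).comp hxb')
  have hs := hρb.evalL ((continuousOn_waveSlope hbg ℓ hxi hκ hφ (f := f) (g := g) xc hxc).tendsto.comp
    hxb'')
  have hu := hρb.evalL ((continuousOn_waveField hbg ℓ hxi hκ hφ (f := f) (g := g) xc hxc).tendsto.comp
    hxb'')
  have hexp : Tendsto (fun τ => Real.exp (-κ * ρ τ)) (𝓝[<] b) (𝓝 (Real.exp (-κ * ρ₀))) :=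
    (Real.continuous_exp.tendsto _).comp (hρb.const_mul (-κ))
  have hX := hexp.mul hv
  have hR := hexp.mul (hs.sub (hu.const_mul κ))
  have eX : ∀ τ ∈ Ioo a b, deriv (fun s => multipole κ φt s (ρ τ)) (x τ)
      = Real.exp (-κ * ρ τ) * evalL (ρ τ) (sobolevD 2 1 0 (by norm_num)
        (waveVelocity hbg ℓ hxi hκ f g φ (x τ))) := fun τ hτ => by
    simp only [multipole]
    rw [deriv_const_mul_field, h.deriv_left hbg ℓ hxi hκ hΦ hφ hfix (hx τ hτ)]
  have eR : ∀ τ ∈ Ioo a b, deriv (multipole κ φt (x τ)) (ρ τ)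
      = Real.exp (-κ * ρ τ) * (evalL (ρ τ) (sobolevD 2 1 0 (by norm_num)
        (waveSlope hbg ℓ hxi hκ f g φ (x τ))) - κ * evalL (ρ τ) (sobolevD 2 1 0 (by norm_num)
        (waveField hbg ℓ hxi hκ f g φ (x τ)))) := fun τ hτ => by
    have h1 := ((hasDerivAt_id (ρ τ)).const_mul (-κ)).exp.mul
      (h.hasDerivAt_right hbg ℓ hxi hκ hΦ hφ hfix (hx τ hτ) (ρ τ))
    have h2 : φt (x τ) (ρ τ) = evalL (ρ τ) (sobolevD 2 1 0 (by norm_num)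
        (waveField hbg ℓ hxi hκ f g φ (x τ))) := by
      rw [h.eq_classicalField hbg ℓ hxi hκ hΦ hφ hfix (Ioo_subset_Ico_self (hx τ hτ))]
      rfl
    refine (HasDerivAt.deriv (f := multipole κ φt (x τ)) h1).trans ?_
    rw [← h2]
    simp only [id]
    ring
  have hIoo := Ioo_mem_nhdsLT hab
  have hFlux := (hU.mul hX).add (hV.mul hR)
  have hFlux' : Tendsto (fun τ => fieldFlux (multipole κ φt) (x τ) (ρ τ) (ux τ) (ur τ)) (𝓝[<] b)
      (𝓝 _) := hFlux.congr' (by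
    filter_upwards [hIoo] with τ hτ
    rw [fieldFlux, eX τ hτ, eR τ hτ]
    rfl)
  have hA := (IsBackground.tendsto_of_continuousOn hbg.analyticOnNhd_coeffA.continuousOn).comp hxb'
  have hB := (IsBackground.tendsto_of_continuousOn hbg.analyticOnNhd_coeffB.continuousOn).comp hxb'
  have hC := (IsBackground.tendsto_of_continuousOn hbg.analyticOnNhd_coeffC.continuousOn).comp hxb'
  have hψ := (IsBackground.tendsto_of_continuousOn hbg.analytic_psi.continuousOn).comp hxb'
  have hGrad := ((Real.continuous_exp.tendsto _).comp ((hρb.const_mul (-2)).sub hψ)).mul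
    (((hA.mul (hX.pow 2)).add (((hB.const_mul 2).mul hX).mul hR)).add (hC.mul (hR.pow 2)))
  refine ⟨_, _, hFlux', ((hFlux'.pow 2).add (hGrad.const_mul (1 / 2))).congr' ?_⟩
  filter_upwards [hIoo] with τ hτ
  rw [fieldEnergy, gradSq, eX τ hτ, eR τ hτ]
  rfl

end

/-- By `horizon_slope`, `-xc² G'(xc) < 1`. So the damping rate `1 - κ` of the ingoing field is
positive. -/
lemma IsBackground.scaling_lt_one {G ψ : ℝ → ℝ} {xc κ : ℝ} (h : IsBackground G ψ xc)
    (hκ : κ ≤ (1 - xc ^ 2 * deriv G xc) / 2) : κ < 1 := by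
  have := h.horizon_slope
  linarith

theorem theorem7 (G ψ : ℝ → ℝ) (xc : ℝ) (hbg : IsBackground G ψ xc) (ℓ : ℕ)
    (xi : ℝ) (hxi : xi ∈ Ioo 0 xc)
    (κ : ℝ) (hκ0 : 0 ≤ κ) (hκ : κ ≤ (1 - xc ^ 2 * deriv G xc) / 2) :
    -- existence and uniqueness in `C([xi, xc], H^{3,2})`
    (∀ (f : SobolevSpace 3) (g : SobolevSpace 2),
      ∃! Φ : C(Icc xi xc, SobolevSpace 3), IsSolution G ψ ℓ κ hxi.2.le Φ f g) ∧
    -- the solution is a classical one before the Cauchy horizon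
    (∀ (f : SobolevSpace 3) (g : SobolevSpace 2) (Φ : C(Icc xi xc, SobolevSpace 3)),
      IsSolution G ψ ℓ κ hxi.2.le Φ f g → ∃ φ, IsClassicalVersion G ψ ℓ κ Φ f g φ) ∧
    (κ < -(xc ^ 2 * deriv G xc) →
      -- the limit of `φ̃_x` at the Cauchy horizon and its a priori bound
      (∃ C₀ C₁ C₂ : ℝ, 0 < C₀ ∧ 0 < C₁ ∧ 0 < C₂ ∧
        ∀ (f : SobolevSpace 3) (g : SobolevSpace 2) (Φ : C(Icc xi xc, SobolevSpace 3))
          (φ : ℝ → ℝ → ℝ),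
          IsSolution G ψ ℓ κ hxi.2.le Φ f g → IsClassicalVersion G ψ ℓ κ Φ f g φ →
          ∀ ρ : ℝ, ∃ L : ℝ,
            Tendsto (fun x => deriv (fun s => φ s ρ) x) (𝓝[<] xc) (𝓝 L) ∧
            |L| ^ 2 ≤ C₀ * initialEnergy G xi f g 0 + C₁ * initialEnergy G xi f g 1
              + C₂ * initialEnergy G xi f g 2) ∧
      -- observers who reach the Cauchy horizon measure a finite flux and a finite energy
      (∀ (f : SobolevSpace 3) (g : SobolevSpace 2) (Φ : C(Icc xi xc, SobolevSpace 3))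
        (φ : ℝ → ℝ → ℝ),
        IsSolution G ψ ℓ κ hxi.2.le Φ f g → IsClassicalVersion G ψ ℓ κ Φ f g φ →
        ∀ (a b : ℝ) (x ρ ϑ ux ur ut : ℝ → ℝ) (ρ₀ : ℝ), a < b →
          IsTimelikeGeodesic G ψ a b x ρ ϑ ux ur ut →
          (∀ τ ∈ Ioo a b, x τ ∈ Ioo xi xc) →
          Tendsto x (𝓝[<] b) (𝓝 xc) → Tendsto ρ (𝓝[<] b) (𝓝 ρ₀) →
          ∃ F E : ℝ,
            Tendsto (fun τ => fieldFlux (multipole κ φ) (x τ) (ρ τ) (ux τ) (ur τ))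
              (𝓝[<] b) (𝓝 F) ∧
            Tendsto (fun τ => fieldEnergy G ψ (multipole κ φ) (x τ) (ρ τ) (ux τ) (ur τ))
              (𝓝[<] b) (𝓝 E))) := by
  have hκ1 := hbg.scaling_lt_one hκ
  refine ⟨fun f g => existsUnique_isSolution hbg ℓ hxi hκ1 f g, fun f g Φ hΦ => ?_,
    fun hκb => ⟨?_, fun f g Φ φ hΦ h a b x ρ ϑ ux ur ut ρ₀ hab hgeo hx hxb hρb => ?_⟩⟩
  · obtain ⟨u, hu, hfix⟩ := exists_waveField hbg ℓ hxi hκ1 f g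
    exact ⟨_, isClassicalVersion_classicalField hbg ℓ hxi hκ1 hΦ hu hfix⟩
  · obtain ⟨C, hC, hbound⟩ := exists_energy_bound hbg ℓ hxi hκ1 hκb
    -- One constant serves for all three terms, because the sum of the energies is a sum of squared
    -- `H²` norms of the data.
    refine ⟨C, C, C, hC, hC, hC, fun f g Φ φ hΦ h ρ => ?_⟩
    obtain ⟨u, hu, hfix⟩ := exists_waveField hbg ℓ hxi hκ1 f g
    refine ⟨_, h.tendsto_deriv_left hbg ℓ hxi hκ1 hΦ hu hfix hκb ρ, ?_⟩
    rw [← mul_add, ← mul_add]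
    exact hbound f g u hu hfix ρ
  · obtain ⟨u, hu, hfix⟩ := exists_waveField hbg ℓ hxi hκ1 f g
    exact h.exists_tendsto_energy hbg ℓ hxi hκ1 hΦ hu hfix hκb hab hgeo hx hxb hρb
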